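/- Let $Q$ be a $\sigma$-compact Hausdorff smooth $d$-manifold (without boundary), $\mu$ a Borel measure on $Q$ that is finite on compact sets and positive on non-empty open sets, and $E\to Q$ a Hermitian complex line bundle, realized as the image of a smooth family $p$ of rank-one orthogonal projections in $M_N(\mathbb C)$. Let $C_0^\infty(Q)$ be the smooth functions vanishing at infinity, $\mathcal A=C^\infty_0(Q)\otimes M_n(\mathbb C)$ with centre $\mathcal Z$, acting by multiplication on $\mathcal H=L^2(Q,E;\mu)\otimes\mathbb C^n$. For open $V\subseteq Q$ let $\mathcal D(V)\subset\mathcal H$ be the smooth sections of $E\otimes\mathbb C^n$ with compact support in $V$. Among the linear operators $\mathcal D(V)\to\mathcal D(V)$, let $\mathcal Z'$ be the set of those commuting with all elements of $\mathcal Z$, and let $\overline{\mathcal A}$ be the closure of $\mathcal A$ in the weak topology given by the matrix elements $S\mapsto\langle\varphi,S\psi\rangle$, $\varphi\in\mathcal H$, $\psi\in\mathcal D(V)$. (These operators may be unbounded in $\mathcal H$.) Let $H:\mathcal D(Q)\to\mathcal D(Q)$ be a hermitian operator (the Hamiltonian at a fixed time), write $\dot a=i[H,a]$ on $\mathcal D(Q)$,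 and assume the noncommutative uncertainty relation $[z,\dot b]\in\mathcal A$ for all compactly supported $z\in\mathcal Z$, $b\in\mathcal A$. Let $T^a$ ($a=1,\dots,n^2-1$) be hermitian generators of $su(n)$ in the fundamental representation, i.e. a basis of the real space of traceless hermitian $n\times n$ matrices. Let $x^1,\dots,x^d$ be real smooth functions on $Q$ which restrict to local coordinates (a chart) on an open set $V$, and let $s$ be a smooth frame of $E$ over $V$ with $|s|^2\,d\mu=dx^1\cdots dx^d$; put $\partial_l(f\otimes s)=(\partial f/\partial x^l)\otimes s$. Then: 1. $\overline{\mathcal A}=\mathcal Z'$ on $\mathcal D(W)$, for every open $W\subseteq Q$. 2. There are real smooth functions $g^{kl}=g^{lk}$ on $V$ with $[x^k,\dot x^l]=i g^{kl}$ on $\mathcal D(V)$. If $(g^{kl}(q))$ is invertible at every $q\in V$, there are smooth hermitian-matrix-valued functions $A_1,\dots,A_d$ on $V$ such that on $\mathcal D(V)$, with summation over $l$, $$\dot x^k=\tfrac12\big(g^{kl}(-i\partial_l-A_l)+(-i\partial_l-A_l)g^{kl}\big).\qquad(*)$$ 3. For all smooth hermitian-matrix-valued functions $A_1,\dots,A_d$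 on $V$ satisfying $(*)$ there exist hermitian operators $A_0^a\in\overline{\mathcal A}=\mathcal Z'$ on $\mathcal D(V)$ such that on $\mathcal D(V)$, with summation over $k$, $$\dot T^a=-\tfrac i2\big(\dot x^k[A_k,T^a]+[A_k,T^a]\dot x^k\big)+A_0^a .$$ Moreover there are operators $R^a\in\overline{\mathcal A}=\mathcal Z'$ on $\mathcal D(V)$ (in general not hermitian) with $\dot T^a=-i\,\dot x^k[A_k,T^a]+R^a$ on $\mathcal D(V)$. -/

import Mathlib

open scoped Manifold ContDiff Topology Matrix

namespace GaugeQM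

section Basic

variable (d : ℕ) {Q : Type*} [TopologicalSpace Q] [ChartedSpace (EuclideanSpace ℝ (Fin d)) Q]

/-- A matrix-valued function on the manifold `Q` is smooth on `V` (entrywise). -/
def SmoothOn {r c : ℕ} (V : Set Q) (f : Q → Matrix (Fin r) (Fin c) ℂ) : Prop :=
  ∀ i j, ContMDiffOn (𝓡 d) 𝓘(ℝ, ℂ) ∞ (fun q => f q i j) V

variable {d}

theorem SmoothOn.mul {r c e : ℕ} {V : Set Q} {f : Q → Matrix (Fin r) (Fin c) ℂ}
    {g : Q → Matrix (Fin c) (Fin e) ℂ} (hf : SmoothOn d V f) (hg : SmoothOn d V g) :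
    SmoothOn d V (fun q => f q * g q) := by
  intro i j
  simp only [Matrix.mul_apply]
  apply contMDiffOn_finsetSum
  intro k _
  have h : ContDiff ℝ ∞ (fun z : ℂ × ℂ => z.1 * z.2) := contDiff_mul
  exact h.contMDiff.comp_contMDiffOn ((hf i k).prodMk_space (hg k j))

theorem SmoothOn.add {r c : ℕ} {V : Set Q} {f g : Q → Matrix (Fin r) (Fin c) ℂ}
    (hf : SmoothOn d V f) (hg : SmoothOn d V g) : SmoothOn d V (fun q => f q + g q) :=
  fun i j => (hf i j).add (hg i j)

theorem smoothOn_const {r c : ℕ} {V : Set Q} (M : Matrix (Fin r) (Fin c) ℂ) :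
    SmoothOn d V (fun _ : Q => M) :=
  fun _ _ => contMDiffOn_const

theorem SmoothOn.smul {r c : ℕ} {V : Set Q} {f : Q → Matrix (Fin r) (Fin c) ℂ}
    (hf : SmoothOn d V f) (t : ℂ) : SmoothOn d V (fun q => t • f q) := by
  have h := (smoothOn_const (d := d) (V := V) (Matrix.diagonal (fun _ : Fin r => t))).mul hf
  intro i j
  exact (h i j).congr (fun q _ => by simp [Matrix.diagonal_mul])

/-- If `a` is smooth on the open set `V` and `f` is smooth with support in `V`,
then `a f` is smooth on all of `Q`. -/
theorem SmoothOn.mul_of_tsupport {r c e : ℕ} {V : TopologicalSpace.Opens Q}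
    {a : Q → Matrix (Fin r) (Fin c) ℂ} {f : Q → Matrix (Fin c) (Fin e) ℂ}
    (ha : SmoothOn d V a) (hf : SmoothOn d Set.univ f) (hs : tsupport f ⊆ V) :
    SmoothOn d Set.univ (fun q => a q * f q) := by
  have h := ha.mul (fun i j => (hf i j).mono (Set.subset_univ (V : Set Q)))
  intro i j q _
  by_cases hq : q ∈ V
  · exact (((h i j) q hq).contMDiffAt (V.isOpen.mem_nhds hq)).contMDiffWithinAt
  · have hz : f =ᶠ[𝓝 q] 0 := notMem_tsupport_iff_eventuallyEq.mp (fun hh => hq (hs hh))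
    have hz' : (fun q => (a q * f q) i j) =ᶠ[𝓝 q] fun _ => (0 : ℂ) := by
      filter_upwards [hz] with y hy
      simp [hy]
    exact (contMDiffAt_const.congr_of_eventuallyEq hz').contMDiffWithinAt

variable (d)

/-- The algebra of smooth `M_n(ℂ)`-valued functions on the open set `V`
(represented by functions on `Q`, of which only the values on `V` matter). -/
def smoothFun (n : ℕ) (V : TopologicalSpace.Opens Q) :
    Subalgebra ℂ (Q → Matrix (Fin n) (Fin n) ℂ) where
  carrier := {a | SmoothOn d (V : Set Q) a}
  mul_mem' {a b} ha hb := SmoothOn.mul (V := (V : Set Q)) (f := a) (g := b) ha hb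
  add_mem' {a b} ha hb := SmoothOn.add (V := (V : Set Q)) (f := a) (g := b) ha hb
  algebraMap_mem' _ := smoothOn_const _

/-- Restriction of smooth functions from `Q` to `V`. -/
def restrictFun {n : ℕ} (V : TopologicalSpace.Opens Q) :
    smoothFun d n (⊤ : TopologicalSpace.Opens Q) →ₐ[ℂ] smoothFun d n V :=
  Subalgebra.inclusion (fun _ ha i j => (ha i j).mono (Set.subset_univ _))

/-- A constant matrix as a smooth function. -/
def constFun {n : ℕ} (V : TopologicalSpace.Opens Q) (T : Matrix (Fin n) (Fin n) ℂ) :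
    smoothFun d n V :=
  ⟨fun _ => T, smoothOn_const T⟩

/-- A real smooth function `f` on `Q`, as the scalar matrix-valued function `f · 1`. -/
noncomputable def scalarFun (n : ℕ) (f : C^∞⟮𝓡 d, Q; 𝓘(ℝ, ℝ), ℝ⟯) :
    smoothFun d n (⊤ : TopologicalSpace.Opens Q) :=
  ⟨fun q => ((f q : ℝ) : ℂ) • (1 : Matrix (Fin n) (Fin n) ℂ), by
    have hf : ContMDiff (𝓡 d) 𝓘(ℝ, ℂ) ∞ (fun q => ((f q : ℝ) : ℂ)) :=
      (Complex.ofRealCLM.contDiff.contMDiff).comp f.contMDiff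
    intro i j
    by_cases h : i = j
    · subst h
      simpa using hf.contMDiffOn
    · simpa [h] using contMDiffOn_const⟩

/-- The algebra `𝒜 = C^∞_0(Q) ⊗ M_n(ℂ)`: smooth matrix-valued functions vanishing at infinity. -/
def algA (Q : Type*) [TopologicalSpace Q] [ChartedSpace (EuclideanSpace ℝ (Fin d)) Q] (n : ℕ) :
    Set (smoothFun d n (⊤ : TopologicalSpace.Opens Q)) :=
  {a | ∀ i j, Filter.Tendsto (fun q => a.1 q i j) (Filter.cocompact Q) (𝓝 0)}

/-- The centre `𝒵` of `𝒜`. -/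
def centerZ (Q : Type*) [TopologicalSpace Q] [ChartedSpace (EuclideanSpace ℝ (Fin d)) Q] (n : ℕ) :
    Set (smoothFun d n (⊤ : TopologicalSpace.Opens Q)) :=
  {z | z ∈ algA d Q n ∧ ∀ a ∈ algA d Q n, z * a = a * z}

/-- A Hermitian complex line bundle `E` over `Q`, presented (as a finitely generated projective
module) by a smooth family of orthogonal projections of rank one in `M_N(ℂ)`. The fibre of `E` over
`q` is the line of row vectors `v` with `v p(q) = v`, with the Hermitian metric of `ℂ^N`. -/
structure LineBundle (Q : Type*) [TopologicalSpace Q]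
    [ChartedSpace (EuclideanSpace ℝ (Fin d)) Q] (N : ℕ) where
  p : Q → Matrix (Fin N) (Fin N) ℂ
  smooth : SmoothOn d Set.univ p
  idem : ∀ q, p q * p q = p q
  herm : ∀ q, (p q).IsHermitian
  trace_one : ∀ q, (p q).trace = 1

end Basic

section Hilbert

variable {d N : ℕ} {Q : Type*} [TopologicalSpace Q] [ChartedSpace (EuclideanSpace ℝ (Fin d)) Q]
  (E : LineBundle d Q N) (n : ℕ)

/-- `𝓓(V) ⊆ L²(Q, E) ⊗ ℂⁿ`: smooth sections of `E ⊗ ℂⁿ` with compact support contained in `V`.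
A section is an `n × N` matrix-valued function whose rows lie in the fibres of `E`. -/
def sect (V : TopologicalSpace.Opens Q) : Submodule ℂ (Q → Matrix (Fin n) (Fin N) ℂ) where
  carrier := {ψ | SmoothOn d Set.univ ψ ∧ HasCompactSupport ψ ∧ tsupport ψ ⊆ V ∧
    ∀ q, ψ q * E.p q = ψ q}
  add_mem' := by
    rintro f g ⟨h1, h2, h3, h4⟩ ⟨k1, k2, k3, k4⟩
    exact ⟨h1.add k1, h2.add k2, (tsupport_add f g).trans (Set.union_subset h3 k3),
      fun q => by simp [Matrix.add_mul, h4, k4]⟩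
  zero_mem' := ⟨smoothOn_const 0, HasCompactSupport.zero, by simp [tsupport], fun q => by simp⟩
  smul_mem' := by
    rintro t f ⟨h1, h2, h3, h4⟩
    have hsub : tsupport (t • f) ⊆ tsupport f := by
      apply closure_mono
      intro q hq h0
      exact hq (by simp [Pi.smul_apply, h0])
    exact ⟨h1.smul t, h2.of_isClosed_subset isClosed_closure hsub,
      hsub.trans h3, fun q => by simp [h4]⟩

/-- Sections with support in `V` as sections over `Q`. -/
def incl (V : TopologicalSpace.Opens Q) : sect E n V →ₗ[ℂ] sect E n ⊤ :=
  Submodule.inclusion (fun _ h => ⟨h.1, h.2.1, Set.subset_univ _, h.2.2.2⟩)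

variable {n}

/-- The representation of smooth matrix-valued functions on `V` by multiplication on `𝓓(V)`. -/
def rep (V : TopologicalSpace.Opens Q) : smoothFun d n V →ₐ[ℂ] Module.End ℂ (sect E n V) :=
  AlgHom.ofLinearMap
    { toFun := fun a =>
        { toFun := fun ψ => ⟨fun q => a.1 q * ψ.1 q, by
            obtain ⟨h1, h2, h3, h4⟩ := ψ.2
            have hsub : tsupport (fun q => a.1 q * ψ.1 q) ⊆ tsupport ψ.1 := by
              apply closure_mono
              intro q hq h0
              exact hq (by simp [h0])
            have hcs : HasCompactSupport (fun q => a.1 q * ψ.1 q) :=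
              h2.of_isClosed_subset isClosed_closure hsub
            exact ⟨SmoothOn.mul_of_tsupport a.2 h1 h3, hcs,
              hsub.trans h3, fun q => by simp [Matrix.mul_assoc, h4]⟩⟩
          map_add' := fun ψ χ => by ext1; funext q; simp [Matrix.mul_add]
          map_smul' := fun t ψ => by ext1; funext q; simp }
      map_add' := fun a b => by ext1 ψ; ext1; funext q; simp [Matrix.add_mul]
      map_smul' := fun t a => by ext1 ψ; ext1; funext q; simp }
    (by ext1 ψ; ext1; funext q; simp)
    (fun a b => by ext1 ψ; ext1; funext q; simp [Matrix.mul_assoc])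

/-- The time derivative `ȧ = i [H, a]` for the time evolution generated by `H`. -/
noncomputable def velocity (H : Module.End ℂ (sect E n ⊤))
    (a : smoothFun d n (⊤ : TopologicalSpace.Opens Q)) : Module.End ℂ (sect E n ⊤) :=
  Complex.I • (H * rep E ⊤ a - rep E ⊤ a * H)

/-- The (weak) noncommutative uncertainty relation `[z, ḃ] ∈ 𝒜` for `z ∈ 𝒵`, `b ∈ 𝒜`,
required only for `z` and `b` of compact support. -/
def NCUncertainty (H : Module.End ℂ (sect E n ⊤)) : Prop :=
  ∀ z ∈ centerZ d Q n, ∀ b ∈ algA d Q n, HasCompactSupport z.1 → HasCompactSupport b.1 →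
    ∃ c ∈ algA d Q n, rep E ⊤ z * velocity E H b - velocity E H b * rep E ⊤ z = rep E ⊤ c

variable [MeasurableSpace Q] (μ : MeasureTheory.Measure Q)

/-- The scalar product of `L²(Q, E) ⊗ ℂⁿ`. -/
noncomputable def innerL2 (φ ψ : Q → Matrix (Fin n) (Fin N) ℂ) : ℂ :=
  ∫ q, ((φ q)ᴴ * ψ q).trace ∂μ

/-- The operator `S` on `𝓓(V)` is hermitian. -/
def IsHermOp {V : TopologicalSpace.Opens Q} (S : Module.End ℂ (sect E n V)) : Prop :=
  ∀ φ ψ : sect E n V, innerL2 μ (S φ).1 ψ.1 = innerL2 μ φ.1 (S ψ).1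

variable (n) in
/-- Square integrable sections of `E ⊗ ℂⁿ`. -/
def IsL2Section (φ : Q → Matrix (Fin n) (Fin N) ℂ) : Prop :=
  (∀ i m, MeasureTheory.MemLp (fun q => φ q i m) 2 μ) ∧ ∀ q, φ q * E.p q = φ q

/-- The weak topology on operators on `𝓓(V)`: the coarsest one for which all matrix elements
`S ↦ ⟨φ, S ψ⟩`, with `φ ∈ L²(Q, E) ⊗ ℂⁿ` and `ψ ∈ 𝓓(V)`, are continuous. -/
noncomputable abbrev weakTopology (V : TopologicalSpace.Opens Q) :
    TopologicalSpace (Module.End ℂ (sect E n V)) :=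
  TopologicalSpace.induced
    (fun S (w : {φ : Q → Matrix (Fin n) (Fin N) ℂ // IsL2Section E n μ φ} × sect E n V) =>
      innerL2 μ w.1.1 (S w.2).1)
    inferInstance

variable (n) in
/-- The weak closure of (the representation on `𝓓(V)` of) the algebra `𝒜`. -/
def weakClosureA (V : TopologicalSpace.Opens Q) : Set (Module.End ℂ (sect E n V)) :=
  @closure _ (weakTopology E μ V) ((fun a => rep E V (restrictFun d V a)) '' algA d Q n)

variable (n) in
/-- The commutant `𝒵'` of the centre, among the operators on `𝓓(V)`. -/
def commutantZ (V : TopologicalSpace.Opens Q) : Set (Module.End ℂ (sect E n V)) :=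
  {S | ∀ z ∈ centerZ d Q n, S * rep E V (restrictFun d V z) = rep E V (restrictFun d V z) * S}

/-- The open domain of a chart. -/
def dom (φ : OpenPartialHomeomorph Q (EuclideanSpace ℝ (Fin d))) : TopologicalSpace.Opens Q :=
  ⟨φ.source, φ.open_source⟩

/-- `s` is a smooth frame of `E` over the domain of the chart `φ`, normalized so that
`|s|² dμ = dx¹ ⋯ dx^d`. Writing `ψ = f ⊗ s` thus identifies the square integrable sections over the
chart domain unitarily with functions `f ∈ L²(φ.target, dx) ⊗ ℂⁿ`. -/
structure IsAdaptedFrame (φ : OpenPartialHomeomorph Q (EuclideanSpace ℝ (Fin d)))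
    (s : Q → Fin N → ℂ) : Prop where
  smooth : ∀ m, ContMDiffOn (𝓡 d) 𝓘(ℝ, ℂ) ∞ (fun q => s q m) φ.source
  mem_fibre : ∀ q ∈ φ.source, s q ᵥ* E.p q = s q
  ne_zero : ∀ q ∈ φ.source, s q ≠ 0
  density : ∀ B ⊆ φ.source, MeasurableSet B →
    ∫⁻ q in B, ENNReal.ofReal (∑ m, ‖s q m‖ ^ 2) ∂μ = MeasureTheory.volume (φ '' B)

end Hilbert

section Coordinates

variable {d N n : ℕ} {Q : Type*} [TopologicalSpace Q]
  (φ : OpenPartialHomeomorph Q (EuclideanSpace ℝ (Fin d))) (s : Q → Fin N → ℂ)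

/-- The component `f : Q → ℂⁿ` of a section `ψ = f ⊗ s` in the frame `s`. -/
noncomputable def coeff (ψ : Q → Matrix (Fin n) (Fin N) ℂ) (q : Q) : Fin n → ℂ :=
  ((∑ m, ‖s q m‖ ^ 2 : ℝ) : ℂ)⁻¹ • (ψ q *ᵥ star (s q))

open Classical in
/-- The partial derivative in local coordinates, `∂_l (f ⊗ s) = (∂f / ∂x^l) ⊗ s`
(extended by `0` outside the chart). -/
noncomputable def pderiv (l : Fin d) (ψ : Q → Matrix (Fin n) (Fin N) ℂ) (q : Q) :
    Matrix (Fin n) (Fin N) ℂ :=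
  if q ∈ φ.source then
    Matrix.vecMulVec
      (fderiv ℝ (fun y => coeff s ψ (φ.symm y)) (φ q) (EuclideanSpace.single l 1)) (s q)
  else 0

/-- The covariant momentum `-i ∂_l - A_l` in local coordinates. -/
noncomputable def covMom (A : Fin d → Q → Matrix (Fin n) (Fin n) ℂ) (l : Fin d)
    (ψ : Q → Matrix (Fin n) (Fin N) ℂ) (q : Q) : Matrix (Fin n) (Fin N) ℂ :=
  (-Complex.I) • pderiv φ s l ψ q - A l q * ψ q

/-- The hermitian form `½ ∑_l (g^{kl} (-i ∂_l - A_l) + (-i ∂_l - A_l) g^{kl})` of the operator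
`g^{kl} (-i ∂_l - A_l)`, applied to `ψ`. -/
noncomputable def kinVel (g : Q → Matrix (Fin d) (Fin d) ℝ)
    (A : Fin d → Q → Matrix (Fin n) (Fin n) ℂ) (k : Fin d)
    (ψ : Q → Matrix (Fin n) (Fin N) ℂ) (q : Q) : Matrix (Fin n) (Fin N) ℂ :=
  (1 / 2 : ℂ) • ∑ l, (((g q k l : ℝ) : ℂ) • covMom φ s A l ψ q
    + covMom φ s A l (fun r => ((g r k l : ℝ) : ℂ) • ψ r) q)

end Coordinates

/-- The `T^a` are hermitian generators of `su(n)` in the fundamental representation: a basis of the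
real vector space of traceless hermitian `n × n` matrices. -/
structure IsSuGenerators {n : ℕ} (T : Fin (n ^ 2 - 1) → Matrix (Fin n) (Fin n) ℂ) : Prop where
  herm : ∀ a, (T a).IsHermitian
  traceless : ∀ a, (T a).trace = 0
  linInd : LinearIndependent ℝ T
  spans : ∀ M : Matrix (Fin n) (Fin n) ℂ, M.IsHermitian → M.trace = 0 →
    M ∈ Submodule.span ℝ (Set.range T)

end GaugeQM

set_option linter.unusedSectionVars false

/-! The theorem rests on one principle: an operator on `𝓓(W)` that commutes with enough scalar
functions is multiplication by a smooth matrix-valued function. By Hadamard's lemma a section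
vanishing at `q₀` is, near `q₀`, a sum of terms `(x^m - x^m(q₀)) χ_m`. An operator commuting with
these factors keeps the value zero at `q₀`, so it acts fibrewise (`isPointwise_of_commute_scal`,
`isPointwise_of_commute_coord`). As the fibres of `E` are lines, a linear map of `ℂⁿ ⊗ E_q` is an `n
× n` matrix (`exists_rep_of_isPointwise`).

Part 1. The principle identifies `𝒵'` with the smooth matrix functions on `W`. A weak neighbourhood
sees only finitely many compactly supported sections, so cutting a function off puts it in the
closure of `𝒜`; conversely, commuting with `𝒵` is a weakly closed condition.

Part 2. The uncertainty relation makes `H` local, so `H` restricts to an operator `h` on `𝓓(V)`, and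
cut-offs remove the compact support condition (`isPointwise_commutator`). Thus `[x^k, [h, x^l]]` is
multiplication by a matrix function. The Jacobi identity makes it symmetric in `k, l` and makes it
commute with all constant matrices; with hermiticity of `H` it is a real scalar `g^{kl}`. The
symmetrized `g^{kl}(-i∂_l)` has the same commutators with the coordinates as `ẋ^k`, so the two
differ by a matrix function, and applying `g⁻¹` to it gives `A`.

Part 3. By `(*)`, `[ẋ^m, T] = -∑ g^{ml} [A_l, T]`, and the Jacobi identity gives `[x^m, Ṫ] = ∑
g^{ml} [A_l, T]`. Since `[x^m, ẋ^k] = i g^{mk}`, the stated terms in `ẋ^k` have this same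
commutator, so the remainder commutes with all coordinates and is again a matrix function. -/

namespace GaugeQM

/-! ### Smooth parameter integrals and Hadamard's lemma -/

section Calculus

variable {X F : Type*} [NormedAddCommGroup X] [NormedSpace ℝ X] [FiniteDimensional ℝ X]
  [NormedAddCommGroup F] [NormedSpace ℝ F]

/-- Differentiation under the integral sign. The dominating constant bounds the `y`-derivative on
the compact set `closedBall y 1 ×ˢ Icc 0 1`; this is where finite dimension of `X` enters. -/
theorem hasFDerivAt_intervalIntegral_of_contDiff {f : X → ℝ → F}
    (hf : ContDiff ℝ ∞ (Function.uncurry f)) (y : X) :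
    HasFDerivAt (fun y => ∫ t in (0 : ℝ)..1, f y t)
      (∫ t in (0 : ℝ)..1, fderiv ℝ (fun z => f z t) y) y := by
  have hc : Continuous (fun p : X × ℝ => fderiv ℝ (fun z => f z p.2) p.1) := by
    have : ContDiff ℝ 0 (fun p : X × ℝ => fderiv ℝ (fun z => f z p.2) p.1) := by
      refine ContDiff.fderiv (m := ∞) (f := fun (p : X × ℝ) z => f z p.2) ?_ contDiff_fst (by simp)
      exact hf.comp (contDiff_snd.prodMk (contDiff_snd.comp contDiff_fst))
    exact this.continuous
  obtain ⟨C, hC⟩ := ((isCompact_closedBall y 1).prod (isCompact_Icc (a := (0 : ℝ))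
    (b := 1))).exists_bound_of_continuousOn hc.continuousOn
  have hft : ∀ z, Continuous (f z) := fun z =>
    hf.continuous.comp (by fun_prop : Continuous fun t => (z, t))
  refine intervalIntegral.hasFDerivAt_integral_of_dominated_of_fderiv_le (bound := fun _ => C)
    (F' := fun y t => fderiv ℝ (fun z => f z t) y)
    (Metric.closedBall_mem_nhds y one_pos)
    (Filter.Eventually.of_forall fun z => (hft z).aestronglyMeasurable)
    ((hft y).intervalIntegrable _ _)
    (hc.comp (by fun_prop : Continuous fun t : ℝ => (y, t))).aestronglyMeasurable
    (Filter.Eventually.of_forall fun t ht z hz => ?_)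
    intervalIntegrable_const
    (Filter.Eventually.of_forall fun t _ z _ => ?_)
  · rw [Set.uIoc_of_le zero_le_one] at ht
    exact hC (z, t) ⟨hz, ht.1.le, ht.2⟩
  · have : ContDiff ℝ ∞ (fun z => f z t) := hf.comp (contDiff_id.prodMk contDiff_const)
    exact (this.differentiable (by simp) z).hasFDerivAt

/-- Induction on the order of differentiability. In finite dimension it suffices to treat
directional derivatives, and each of these is an integral of the same kind with values in the same
`F`. -/
theorem contDiff_intervalIntegral {f : X → ℝ → F}
    (hf : ContDiff ℝ ∞ (Function.uncurry f)) :
    ContDiff ℝ ∞ (fun y => ∫ t in (0 : ℝ)..1, f y t) := by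
  rw [contDiff_infty]
  intro n
  induction n generalizing f with
  | zero =>
    exact contDiff_zero.2 (continuous_iff_continuousAt.2
      fun y => (hasFDerivAt_intervalIntegral_of_contDiff hf y).continuousAt)
  | succ n ih =>
    have h := hasFDerivAt_intervalIntegral_of_contDiff hf
    rw [Nat.cast_succ, contDiff_succ_iff_fderiv_apply]
    refine ⟨fun y => (h y).differentiableAt, by simp, fun v => ?_⟩
    have hs : ContDiff ℝ ∞ (fun p : X × ℝ => fderiv ℝ (fun z => f z p.2) p.1) := by
      refine ContDiff.fderiv (m := ∞) (f := fun (p : X × ℝ) z => f z p.2) ?_ contDiff_fst (by simp)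
      exact hf.comp (contDiff_snd.prodMk (contDiff_snd.comp contDiff_fst))
    have key : (fun y => fderiv ℝ (fun y => ∫ t in (0 : ℝ)..1, f y t) y v)
        = fun y => ∫ t in (0 : ℝ)..1, fderiv ℝ (fun z => f z t) y v := by
      funext y
      rw [(h y).fderiv]
      refine ContinuousLinearMap.intervalIntegral_apply ?_ v
      exact (hs.continuous.comp
        (by fun_prop : Continuous fun t : ℝ => (y, t))).intervalIntegrable _ _
    rw [key]
    exact ih (f := fun y t => fderiv ℝ (fun z => f z t) y v) (hs.clm_apply contDiff_const)

end Calculus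

/-- Hadamard's lemma. -/
theorem exists_sum_coord_mul_of_eq_zero {d : ℕ} {f : EuclideanSpace ℝ (Fin d) → ℂ}
    (hf : ContDiff ℝ ∞ f) (y₀ : EuclideanSpace ℝ (Fin d)) (h0 : f y₀ = 0) :
    ∃ g : Fin d → EuclideanSpace ℝ (Fin d) → ℂ, (∀ m, ContDiff ℝ ∞ (g m)) ∧
      ∀ y, f y = ∑ m, ((y m - y₀ m : ℝ) : ℂ) * g m y := by
  have hF : ContDiff ℝ ∞ (fderiv ℝ f) := hf.fderiv_right (by simp)
  refine ⟨fun m y => ∫ t in (0 : ℝ)..1,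
    fderiv ℝ f (y₀ + t • (y - y₀)) (EuclideanSpace.single m 1), fun m => ?_, fun y => ?_⟩
  · refine contDiff_intervalIntegral
      (f := fun y t => fderiv ℝ f (y₀ + t • (y - y₀)) (EuclideanSpace.single m 1)) ?_
    refine (hF.comp ?_).clm_apply contDiff_const
    exact contDiff_const.add (contDiff_snd.smul (contDiff_fst.sub contDiff_const))
  · have hline : ∀ t : ℝ, HasDerivAt (fun t : ℝ => f (y₀ + t • (y - y₀)))
        (fderiv ℝ f (y₀ + t • (y - y₀)) (y - y₀)) t := by
      intro t
      have h1 : HasDerivAt (fun t : ℝ => y₀ + t • (y - y₀)) (y - y₀) t := by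
        simpa using ((hasDerivAt_id t).smul_const (y - y₀)).const_add y₀
      exact ((hf.differentiable (by simp)) _).hasFDerivAt.comp_hasDerivAt t h1
    have hcont : ∀ v, Continuous (fun t : ℝ => fderiv ℝ f (y₀ + t • (y - y₀)) v) := fun v =>
      (hF.continuous.comp (by fun_prop : Continuous fun t : ℝ => y₀ + t • (y - y₀))).clm_apply
        continuous_const
    have hint := intervalIntegral.integral_eq_sub_of_hasDerivAt (fun t _ => hline t)
      ((hcont (y - y₀)).intervalIntegrable 0 1)
    have hsum : y - y₀ = ∑ m, (y m - y₀ m) • EuclideanSpace.single m (1 : ℝ) := by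
      have := (EuclideanSpace.basisFun (Fin d) ℝ).sum_repr (y - y₀)
      simpa using this.symm
    have : f y = ∫ t in (0 : ℝ)..1, fderiv ℝ f (y₀ + t • (y - y₀)) (y - y₀) := by
      rw [hint]; simp [h0]
    rw [this]
    simp_rw [← intervalIntegral.integral_const_mul]
    rw [← intervalIntegral.integral_finsetSum]
    · congr 1
      funext t
      conv_lhs => rw [hsum]
      rw [map_sum]
      simp only [map_smul, Complex.real_smul]
      -- The basis expansion of `y - y₀` was also inserted in the base point of the derivative; it
      -- is undone there.
      rw [← hsum]
    · intro m _
      exact (continuous_const.mul (hcont _)).intervalIntegrable _ _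

/-! ### Projections of rank one -/

section RankOne

/-- A hermitian idempotent of trace one is the projection onto a line. -/
theorem exists_eq_vecMulVec_of_trace_one {N : ℕ} {p : Matrix (Fin N) (Fin N) ℂ}
    (hp : p * p = p) (hh : p.IsHermitian) (ht : p.trace = 1) :
    ∃ u : Fin N → ℂ, p = Matrix.vecMulVec (star u) u ∧ u ⬝ᵥ star u = 1 := by
  -- By idempotence a row of `p` is fixed by `p`; a non-zero row, normalized, serves as `u`.
  obtain ⟨m, hm⟩ : ∃ m, p m ≠ 0 := by
    by_contra! h
    have : p = 0 := by ext i j; simp [h i]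
    simp [this] at ht
  have hr : p m ᵥ* p = p m := by
    have := congrFun hp m
    ext j
    exact congrFun this j
  set c : ℂ := p m ⬝ᵥ star (p m) with hc
  have hcre : c = ((∑ j, ‖p m j‖ ^ 2 : ℝ) : ℂ) := by
    rw [hc, dotProduct]
    push_cast
    exact Finset.sum_congr rfl fun j _ => Complex.mul_conj' _
  have hpos : 0 < ∑ j, ‖p m j‖ ^ 2 := by
    obtain ⟨j, hj⟩ := Function.ne_iff.1 hm
    exact Finset.sum_pos' (fun _ _ => by positivity) ⟨j, Finset.mem_univ _, by
      have : 0 < ‖p m j‖ := norm_pos_iff.2 hj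
      positivity⟩
  set r : ℝ := (Real.sqrt (∑ j, ‖p m j‖ ^ 2))⁻¹ with hrdef
  have hr2 : (r : ℂ) * r * c = 1 := by
    rw [hcre, ← Complex.ofReal_mul, ← Complex.ofReal_mul]
    norm_cast
    rw [hrdef, ← mul_inv, Real.mul_self_sqrt hpos.le, inv_mul_cancel₀ hpos.ne']
  set u : Fin N → ℂ := (r : ℂ) • p m with hu
  have hnorm : u ⬝ᵥ star u = 1 := by
    rw [hu, star_smul, smul_dotProduct, dotProduct_smul, ← hc]
    simpa [mul_assoc] using hr2
  have hup : u ᵥ* p = u := by rw [hu, Matrix.smul_vecMul, hr]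
  have hpu : p *ᵥ star u = star u := by
    conv_lhs => rw [← hh.eq]
    rw [← Matrix.star_vecMul, hup]
  refine ⟨u, ?_, hnorm⟩
  set w := Matrix.vecMulVec (star u) u with hw
  have hpw : p * w = w := by rw [hw, Matrix.mul_vecMulVec, hpu]
  have hwp : w * p = w := by rw [hw, Matrix.vecMulVec_mul, hup]
  have hww : w * w = w := by
    rw [hw, Matrix.vecMulVec_mul_vecMulVec, hnorm]; simp
  have hwh : wᴴ = w := by rw [hw, Matrix.conjTranspose_vecMulVec]; simp
  have htr : w.trace = 1 := by rw [hw, Matrix.trace_vecMulVec, dotProduct_comm, hnorm]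
  -- Since `p w = w p = w`, this product is `p - w`, of trace `1 - 1`. The trace is the squared
  -- Hilbert–Schmidt norm, so `p = w`.
  have : ((p - w)ᴴ * (p - w)).trace = 0 := by
    rw [Matrix.conjTranspose_sub, hh.eq, hwh, sub_mul, mul_sub, mul_sub, hp, hpw, hwp, hww]
    simp [ht, htr]
  open scoped ComplexOrder in
  exact sub_eq_zero.1 (Matrix.trace_conjTranspose_mul_self_eq_zero_iff.1 this)

end RankOne

/-! ### Cut-off functions -/

section Bump

variable {d : ℕ} {Q : Type*} [TopologicalSpace Q] [T2Space Q] [SigmaCompactSpace Q]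
  [ChartedSpace (EuclideanSpace ℝ (Fin d)) Q] [IsManifold (𝓡 d) ∞ Q]

/-- The value one near `K`, and not only on `K`, allows one cut-off to serve all points close to a
given one; this yields smoothness in `exists_rep_of_isPointwise`. -/
theorem exists_bump {K : Set Q} (hK : IsCompact K) {U : Set Q} (hU : IsOpen U) (hKU : K ⊆ U) :
    ∃ χ : C^∞⟮𝓡 d, Q; 𝓘(ℝ, ℝ), ℝ⟯, HasCompactSupport χ ∧ tsupport χ ⊆ U ∧
      ∀ q ∈ K, ∀ᶠ r in 𝓝 q, χ r = 1 := by
  have : LocallyCompactSpace Q := ChartedSpace.locallyCompactSpace (EuclideanSpace ℝ (Fin d)) Q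
  obtain ⟨L, hL, hKL, hLU⟩ := exists_compact_between hK hU hKU
  obtain ⟨χ, h1, h0, -⟩ := exists_contMDiffMap_one_nhds_of_subset_interior (n := ⊤) (𝓡 d)
    hK.isClosed hKL
  have hs : tsupport χ ⊆ L := closure_minimal
    (fun q hq => by_contra fun h => hq (h0 q h)) hL.isClosed
  exact ⟨χ, hL.of_isClosed_subset isClosed_closure hs, hs.trans hLU,
    fun q hq => h1.filter_mono (nhds_le_nhdsSet hq)⟩

end Bump

/-! ### Smooth complex and matrix-valued functions -/

section Smooth

variable {d : ℕ} {Q : Type*} [TopologicalSpace Q] [ChartedSpace (EuclideanSpace ℝ (Fin d)) Q]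

theorem contMDiffOn_complex_mul {U : Set Q} {f g : Q → ℂ}
    (hf : ContMDiffOn (𝓡 d) 𝓘(ℝ, ℂ) ∞ f U) (hg : ContMDiffOn (𝓡 d) 𝓘(ℝ, ℂ) ∞ g U) :
    ContMDiffOn (𝓡 d) 𝓘(ℝ, ℂ) ∞ (fun q => f q * g q) U := by
  have h : ContDiff ℝ ∞ (fun z : ℂ × ℂ => z.1 * z.2) := contDiff_mul
  exact h.contMDiff.comp_contMDiffOn (hf.prodMk_space hg)

theorem contMDiffOn_ofReal {U : Set Q} {f : Q → ℝ} (hf : ContMDiffOn (𝓡 d) 𝓘(ℝ, ℝ) ∞ f U) :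
    ContMDiffOn (𝓡 d) 𝓘(ℝ, ℂ) ∞ (fun q => (f q : ℂ)) U :=
  Complex.ofRealCLM.contDiff.contMDiff.comp_contMDiffOn hf

theorem contMDiffOn_star {U : Set Q} {f : Q → ℂ} (hf : ContMDiffOn (𝓡 d) 𝓘(ℝ, ℂ) ∞ f U) :
    ContMDiffOn (𝓡 d) 𝓘(ℝ, ℂ) ∞ (fun q => star (f q)) U :=
  Complex.conjCLE.contDiff.contMDiff.comp_contMDiffOn hf

theorem SmoothOn.fun_smul {r c : ℕ} {U : Set Q} {f : Q → ℂ} {a : Q → Matrix (Fin r) (Fin c) ℂ}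
    (hf : ContMDiffOn (𝓡 d) 𝓘(ℝ, ℂ) ∞ f U) (ha : SmoothOn d U a) :
    SmoothOn d U (fun q => f q • a q) :=
  fun i j => contMDiffOn_complex_mul hf (ha i j)

theorem SmoothOn.conjTranspose {r c : ℕ} {U : Set Q} {a : Q → Matrix (Fin r) (Fin c) ℂ}
    (ha : SmoothOn d U a) : SmoothOn d U (fun q => (a q)ᴴ) :=
  fun i j => contMDiffOn_star (ha j i)

theorem SmoothOn.mono {r c : ℕ} {U V : Set Q} {a : Q → Matrix (Fin r) (Fin c) ℂ}
    (ha : SmoothOn d V a) (h : U ⊆ V) : SmoothOn d U a :=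
  fun i j => (ha i j).mono h

theorem SmoothOn.continuousOn {r c : ℕ} {U : Set Q} {a : Q → Matrix (Fin r) (Fin c) ℂ}
    (ha : SmoothOn d U a) : ContinuousOn a U :=
  continuousOn_pi.2 fun i => continuousOn_pi.2 fun j => (ha i j).continuousOn

theorem SmoothOn.congr {r c : ℕ} {U : Set Q} {a b : Q → Matrix (Fin r) (Fin c) ℂ}
    (ha : SmoothOn d U a) (h : ∀ q ∈ U, b q = a q) : SmoothOn d U b :=
  fun i j => (ha i j).congr fun q hq => by rw [h q hq]

end Smooth

/-! ### Passage to coordinates -/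

section Chart

variable {d : ℕ} {Q : Type*} [TopologicalSpace Q] [T2Space Q]
  [ChartedSpace (EuclideanSpace ℝ (Fin d)) Q] [IsManifold (𝓡 d) ∞ Q]
  {φ : OpenPartialHomeomorph Q (EuclideanSpace ℝ (Fin d))}

omit [T2Space Q] [ChartedSpace (EuclideanSpace ℝ (Fin d)) Q] [IsManifold (𝓡 d) ∞ Q] in
theorem support_indicator_comp_symm_subset {F : Type*} [Zero F] {f : Q → F} :
    Function.support (φ.target.indicator (f ∘ φ.symm)) ⊆ φ '' (tsupport f ∩ φ.source) := by
  intro y hy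
  have hyt : y ∈ φ.target := by
    by_contra h
    exact hy (Set.indicator_of_notMem h _)
  refine ⟨φ.symm y, ⟨subset_tsupport _ fun h => hy ?_, φ.map_target hyt⟩, φ.right_inv hyt⟩
  rw [Set.indicator_of_mem hyt]
  exact h

omit [T2Space Q] [ChartedSpace (EuclideanSpace ℝ (Fin d)) Q] [IsManifold (𝓡 d) ∞ Q] in
theorem hasCompactSupport_indicator_comp_symm {F : Type*} [Zero F] {f : Q → F}
    (hc : HasCompactSupport f)
    (hs : tsupport f ⊆ φ.source) : HasCompactSupport (φ.target.indicator (f ∘ φ.symm)) := by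
  refine HasCompactSupport.intro (K := φ '' tsupport f)
    (hc.isCompact.image_of_continuousOn (φ.continuousOn.mono hs)) fun y hy => ?_
  by_contra h
  exact hy (Set.image_mono Set.inter_subset_left (support_indicator_comp_symm_subset h))

omit [T2Space Q] [IsManifold (𝓡 d) ∞ Q] in
theorem contDiffOn_comp_symm (hφ : φ ∈ IsManifold.maximalAtlas (𝓡 d) ∞ Q) {F : Type*}
    [NormedAddCommGroup F] [NormedSpace ℝ F] {f : Q → F}
    (hf : ContMDiffOn (𝓡 d) 𝓘(ℝ, F) ∞ f φ.source) :
    ContDiffOn ℝ ∞ (f ∘ φ.symm) φ.target := by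
  rw [← contMDiffOn_iff_contDiffOn]
  exact hf.comp (contMDiffOn_symm_of_mem_maximalAtlas hφ) fun y hy => φ.map_target hy

-- The image of the support is compact, hence closed in the whole coordinate space, so the extension
-- by zero is locally zero at every point outside `φ.target`.
omit [T2Space Q] [IsManifold (𝓡 d) ∞ Q] in
theorem contDiff_indicator_comp_symm (hφ : φ ∈ IsManifold.maximalAtlas (𝓡 d) ∞ Q) {F : Type*}
    [NormedAddCommGroup F] [NormedSpace ℝ F] {f : Q → F}
    (hf : ContMDiffOn (𝓡 d) 𝓘(ℝ, F) ∞ f φ.source) (hc : HasCompactSupport f)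
    (hs : tsupport f ⊆ φ.source) : ContDiff ℝ ∞ (φ.target.indicator (f ∘ φ.symm)) := by
  rw [contDiff_iff_contDiffAt]
  intro y
  by_cases hy : y ∈ φ.target
  · refine ((contDiffOn_comp_symm hφ hf).contDiffAt
      (φ.open_target.mem_nhds hy)).congr_of_eventuallyEq ?_
    filter_upwards [φ.open_target.mem_nhds hy] with z hz
    exact Set.indicator_of_mem hz _
  · have hK : IsClosed (φ '' tsupport f) :=
      (hc.isCompact.image_of_continuousOn (φ.continuousOn.mono hs)).isClosed
    have hyK : y ∉ φ '' tsupport f := by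
      rintro ⟨q, hq, rfl⟩
      exact hy (φ.map_source (hs hq))
    refine (contDiffAt_const (c := 0)).congr_of_eventuallyEq ?_
    filter_upwards [hK.isOpen_compl.mem_nhds hyK] with z hz
    by_contra h
    exact hz (Set.image_mono Set.inter_subset_left (support_indicator_comp_symm_subset h))

/-- Hadamard's lemma is applied to the extension by zero, so `φ.target` need not be star-shaped. The
factors it yields are defined on all of coordinate space without support control; the cut-off `χ`,
equal to one on the support of `f`, brings them back into `U`. -/
theorem exists_sum_chart_mul_of_eq_zero [SigmaCompactSpace Q]
    (hφ : φ ∈ IsManifold.maximalAtlas (𝓡 d) ∞ Q)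
    {U : Set Q} (hU : IsOpen U) (hUs : U ⊆ φ.source) {f : Q → ℂ}
    (hf : ContMDiff (𝓡 d) 𝓘(ℝ, ℂ) ∞ f) (hc : HasCompactSupport f) (hs : tsupport f ⊆ U)
    {q₀ : Q} (hq₀ : q₀ ∈ φ.source) (h0 : f q₀ = 0) :
    ∃ h : Fin d → Q → ℂ, (∀ m, ContMDiff (𝓡 d) 𝓘(ℝ, ℂ) ∞ (h m)) ∧
      (∀ m, HasCompactSupport (h m)) ∧ (∀ m, tsupport (h m) ⊆ U) ∧
      ∀ q, f q = ∑ m, ((φ q m - φ q₀ m : ℝ) : ℂ) * h m q := by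
  obtain ⟨g, hg, hfg⟩ := exists_sum_coord_mul_of_eq_zero
    (contDiff_indicator_comp_symm hφ hf.contMDiffOn hc (hs.trans hUs)) (φ q₀) (by
      rw [Set.indicator_of_mem (φ.map_source hq₀), Function.comp_apply, φ.left_inv hq₀, h0])
  obtain ⟨χ, hχc, hχU, hχ1⟩ := exists_bump (d := d) hc.isCompact hU hs
  have hsub : ∀ m, tsupport (fun q => (χ q : ℂ) * g m (φ q)) ⊆ tsupport χ := by
    intro m
    refine closure_mono fun q hq h => hq ?_
    simp [h]
  refine ⟨fun m q => (χ q : ℂ) * g m (φ q), fun m => ?_,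
    fun m => hχc.of_isClosed_subset isClosed_closure (hsub m),
    fun m => (hsub m).trans hχU, fun q => ?_⟩
  · refine contMDiff_of_tsupport fun q hq => ?_
    have hqs : q ∈ φ.source := hUs (hχU (hsub m hq))
    have h1 := contMDiffOn_complex_mul (U := φ.source)
      (contMDiffOn_ofReal χ.contMDiff.contMDiffOn)
      ((hg m).contMDiff.comp_contMDiffOn (contMDiffOn_of_mem_maximalAtlas hφ))
    exact h1.contMDiffAt (φ.open_source.mem_nhds hqs)
  · by_cases hq : q ∈ tsupport f
    · have hqs : q ∈ φ.source := hUs (hs hq)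
      have h1 := hfg (φ q)
      rw [Set.indicator_of_mem (φ.map_source hqs), Function.comp_apply, φ.left_inv hqs] at h1
      rw [h1]
      simp [(hχ1 q hq).self_of_nhds]
    · have hf0 : f q = 0 := image_eq_zero_of_notMem_tsupport hq
      rw [hf0]
      -- Off the support of `f` but inside the chart, the sum is `χ f = 0`; outside the chart `χ`
      -- vanishes.
      by_cases hqs : q ∈ φ.source
      · have h1 := hfg (φ q)
        rw [Set.indicator_of_mem (φ.map_source hqs), Function.comp_apply, φ.left_inv hqs, hf0] at h1
        have : ∑ m, ((φ q m - φ q₀ m : ℝ) : ℂ) * ((χ q : ℂ) * g m (φ q))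
            = (χ q : ℂ) * ∑ m, ((φ q m - φ q₀ m : ℝ) : ℂ) * g m (φ q) := by
          rw [Finset.mul_sum]
          exact Finset.sum_congr rfl fun m _ => by ring
        rw [this, ← h1, mul_zero]
      · have : χ q = 0 := image_eq_zero_of_notMem_tsupport fun h => hqs (hUs (hχU h))
        simp [this]

end Chart

theorem tsupport_subset_tsupport {X F G : Type*} [TopologicalSpace X] [Zero F] [Zero G]
    {f : X → F} {g : X → G} (h : ∀ q, f q = 0 → g q = 0) : tsupport g ⊆ tsupport f :=
  closure_mono fun q hq hf => hq (h q hf)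

/-! ### Sections of the bundle and fibrewise operators -/

section Sections

variable {d N n : ℕ} {Q : Type*} [TopologicalSpace Q] [ChartedSpace (EuclideanSpace ℝ (Fin d)) Q]
  (E : LineBundle d Q N) {W : TopologicalSpace.Opens Q}

/-- Multiplication by a real smooth function on `𝓓(W)`. -/
noncomputable def scal (W : TopologicalSpace.Opens Q) (f : C^∞⟮𝓡 d, Q; 𝓘(ℝ, ℝ), ℝ⟯) :
    Module.End ℂ (sect E n W) :=
  rep E W (restrictFun d W (scalarFun d n f))

@[simp] theorem rep_apply (a : smoothFun d n W) (ψ : sect E n W) (q : Q) :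
    (rep E W a ψ).1 q = a.1 q * ψ.1 q := rfl

@[simp] theorem scal_apply (f : C^∞⟮𝓡 d, Q; 𝓘(ℝ, ℝ), ℝ⟯) (ψ : sect E n W) (q : Q) :
    (scal E W f ψ).1 q = (f q : ℂ) • ψ.1 q := by
  change ((f q : ℂ) • (1 : Matrix (Fin n) (Fin n) ℂ)) * ψ.1 q = _
  simp

variable {E}

theorem sect_ext {ψ χ : sect E n W} (h : ∀ q, ψ.1 q = χ.1 q) : ψ = χ :=
  Subtype.ext (funext h)

theorem sect_mul_p (ψ : sect E n W) (q : Q) : ψ.1 q * E.p q = ψ.1 q := ψ.2.2.2.2 q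

theorem sect_smooth (ψ : sect E n W) : SmoothOn d Set.univ ψ.1 := ψ.2.1

theorem sect_continuous (ψ : sect E n W) : Continuous ψ.1 :=
  continuousOn_univ.1 ψ.2.1.continuousOn

theorem sect_hasCompactSupport (ψ : sect E n W) : HasCompactSupport ψ.1 := ψ.2.2.1

theorem sect_tsupport_subset (ψ : sect E n W) : tsupport ψ.1 ⊆ W := ψ.2.2.2.1

theorem sect_eq_zero_of_notMem (ψ : sect E n W) {q : Q} (hq : q ∉ W) : ψ.1 q = 0 :=
  image_eq_zero_of_notMem_tsupport fun h => hq (sect_tsupport_subset ψ h)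

variable (E) in
/-- The section `q ↦ χ(q) v p(q)`, for a smooth function `χ` of compact support. -/
noncomputable def constSect (χ : C^∞⟮𝓡 d, Q; 𝓘(ℝ, ℝ), ℝ⟯) (hc : HasCompactSupport χ)
    (hW : tsupport χ ⊆ W) : Matrix (Fin n) (Fin N) ℂ →ₗ[ℂ] sect E n W where
  toFun v := ⟨fun q => (χ q : ℂ) • (v * E.p q), by
    have hsub : tsupport (fun q => (χ q : ℂ) • (v * E.p q)) ⊆ tsupport χ :=
      tsupport_subset_tsupport fun q h => by simp [h]
    exact ⟨SmoothOn.fun_smul (contMDiffOn_ofReal χ.contMDiff.contMDiffOn)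
      ((smoothOn_const v).mul E.smooth), hc.of_isClosed_subset isClosed_closure hsub,
      hsub.trans hW, fun q => by simp [Matrix.mul_assoc, E.idem]⟩⟩
  map_add' v w := sect_ext fun q => by
    change (χ q : ℂ) • ((v + w) * E.p q) = (χ q : ℂ) • (v * E.p q) + (χ q : ℂ) • (w * E.p q)
    rw [Matrix.add_mul, smul_add]
  map_smul' t v := sect_ext fun q => by
    change (χ q : ℂ) • ((t • v) * E.p q) = t • (χ q : ℂ) • (v * E.p q)
    rw [Matrix.smul_mul, smul_comm]

@[simp] theorem constSect_apply (χ : C^∞⟮𝓡 d, Q; 𝓘(ℝ, ℝ), ℝ⟯) (hc : HasCompactSupport χ)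
    (hW : tsupport χ ⊆ W) (v : Matrix (Fin n) (Fin N) ℂ) (q : Q) :
    (constSect E χ hc hW v).1 q = (χ q : ℂ) • (v * E.p q) := rfl

/-- The operator `S` acts pointwise: `(S ψ)(q)` depends on `ψ(q)` only. -/
def IsPointwise (S : Module.End ℂ (sect E n W)) : Prop :=
  ∀ (ψ : sect E n W) (q : Q), ψ.1 q = 0 → (S ψ).1 q = 0

theorem IsPointwise.congr {S : Module.End ℂ (sect E n W)} (hS : IsPointwise S)
    {ψ χ : sect E n W} {q : Q} (h : ψ.1 q = χ.1 q) : (S ψ).1 q = (S χ).1 q := by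
  have := hS (ψ - χ) q (by change ψ.1 q - χ.1 q = 0; rw [h, sub_self])
  rw [map_sub] at this
  exact sub_eq_zero.1 this

/-- A linear map on `ℂⁿ ⊗ ℂ^N` compatible with a rank one projection `p` acts on `ℂⁿ ⊗ im p`
by a matrix. -/
theorem eq_of_mul_of_rankOne {p : Matrix (Fin N) (Fin N) ℂ} {u : Fin N → ℂ}
    (hp : p = Matrix.vecMulVec (star u) u)
    (L : Matrix (Fin n) (Fin N) ℂ →ₗ[ℂ] Matrix (Fin n) (Fin N) ℂ)
    (hL : ∀ v, L (v * p) = L v) (hL' : ∀ v, L v * p = L v)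
    {v : Matrix (Fin n) (Fin N) ℂ} (hv : v * p = v) :
    L v = (Matrix.of fun i j => ∑ m, L (Matrix.single j m 1) i m) * v := by
  set X : Fin n → Matrix (Fin n) (Fin N) ℂ :=
    fun j => L (Matrix.vecMulVec (Pi.single j 1) u) with hX
  -- The projection sends `single j m 1` to `star (u m)` times `e_j ⊗ u`, so the sum over `m` in the
  -- claimed matrix is the coefficient of `X j` along `u`. The resulting formula is free of `u`,
  -- which is chosen point by point without any smoothness.
  have hs : ∀ j m, L (Matrix.single j m 1) = star (u m) • X j := by
    intro j m
    rw [← hL, hX, ← map_smul]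
    congr 1
    rw [hp]
    ext i r
    by_cases h : j = i <;>
      simp [Matrix.mul_apply, Matrix.vecMulVec_apply, Matrix.single_apply, h, eq_comm]
  have hv' : v = ∑ j, (v *ᵥ star u) j • Matrix.vecMulVec (Pi.single j 1) u := by
    conv_lhs => rw [← hv, hp, Matrix.mul_vecMulVec]
    ext i r
    simp [Matrix.sum_apply, Matrix.vecMulVec_apply, Pi.single_apply]
  conv_lhs => rw [hv', map_sum]
  simp only [map_smul]
  ext i r
  have hXp : ∀ j, X j i r = (∑ m, X j i m * star (u m)) * u r := by
    intro j
    conv_lhs => rw [hX]; simp only []; rw [← hL', hp, Matrix.mul_vecMulVec]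
    rfl
  have hvr : ∀ j, v j r = (v *ᵥ star u) j * u r := by
    intro j
    conv_lhs => rw [← hv, hp, Matrix.mul_vecMulVec]
    rfl
  rw [Matrix.sum_apply, Matrix.mul_apply]
  refine Finset.sum_congr rfl fun j _ => ?_
  simp only [Matrix.of_apply, hs, Matrix.smul_apply, smul_eq_mul]
  rw [hvr j]
  change _ * X j i r = _
  rw [hXp j]
  have : ∑ m, star (u m) * X j i m = ∑ m, X j i m * star (u m) :=
    Finset.sum_congr rfl fun m _ => mul_comm _ _
  rw [this]
  ring

end Sections

/-! ### Operators commuting with functions are matrix functions -/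

section Pointwise

variable {d N n : ℕ} {Q : Type*} [TopologicalSpace Q] [T2Space Q] [SigmaCompactSpace Q]
  [ChartedSpace (EuclideanSpace ℝ (Fin d)) Q] [IsManifold (𝓡 d) ∞ Q]
  {E : LineBundle d Q N} {W : TopologicalSpace.Opens Q}

/-- Every vector in a fibre is the value of a section. -/
theorem exists_sect_eq {q : Q} (hq : q ∈ W) {v : Matrix (Fin n) (Fin N) ℂ}
    (hv : v * E.p q = v) : ∃ ψ : sect E n W, ψ.1 q = v := by
  obtain ⟨χ, hc, hW, h1⟩ := exists_bump (d := d) isCompact_singleton W.isOpen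
    (Set.singleton_subset_iff.2 hq)
  exact ⟨constSect E χ hc hW v, by simp [(h1 q rfl).self_of_nhds, hv]⟩

/-- Testing on a section with value `e_j ⊗ u` at `q`, where the unit vector `u` spans the fibre, and
pairing with `star u` recovers the `j`-th column of the matrix. -/
theorem eq_of_rep_eq {a b : smoothFun d n W} (h : rep E W a = rep E W b) {q : Q} (hq : q ∈ W) :
    a.1 q = b.1 q := by
  obtain ⟨u, hu, hu1⟩ := exists_eq_vecMulVec_of_trace_one (E.idem q) (E.herm q) (E.trace_one q)
  have hup : u ᵥ* E.p q = u := by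
    rw [hu, Matrix.vecMul_vecMulVec, hu1]; simp
  ext i j
  obtain ⟨ψ, hψ⟩ := exists_sect_eq (n := n) (E := E) hq
    (v := Matrix.vecMulVec (Pi.single j 1) u) (by rw [Matrix.vecMulVec_mul, hup])
  have h1 : a.1 q * ψ.1 q = b.1 q * ψ.1 q := by
    rw [← rep_apply, ← rep_apply, h]
  rw [hψ, Matrix.mul_vecMulVec, Matrix.mul_vecMulVec] at h1
  have h2 := congrArg (fun M => (M *ᵥ star u) i) h1
  simpa [Matrix.vecMulVec_mulVec, hu1] using h2

/-- A fibrewise operator induces a linear map of `ℂⁿ ⊗ E_q`, which is a matrix because `E_q` is a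
line. The entries are read off from the values of `S` on the sections `χ (single j m 1) p`, and are
smooth because `S` produces smooth sections. -/
theorem exists_rep_of_isPointwise {S : Module.End ℂ (sect E n W)} (hS : IsPointwise S) :
    ∃ a : smoothFun d n W, S = rep E W a := by
  classical
  have hb : ∀ q : W, ∃ χ : C^∞⟮𝓡 d, Q; 𝓘(ℝ, ℝ), ℝ⟯, HasCompactSupport χ ∧ tsupport χ ⊆ W ∧
      ∀ᶠ r in 𝓝 (q : Q), χ r = 1 := by
    intro q
    obtain ⟨χ, hc, hW, h1⟩ := exists_bump (d := d) isCompact_singleton W.isOpen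
      (Set.singleton_subset_iff.2 q.2)
    exact ⟨χ, hc, hW, h1 q rfl⟩
  choose χ hc hW h1 using hb
  let a₀ (q : W) (r : Q) : Matrix (Fin n) (Fin n) ℂ :=
    Matrix.of fun i j => ∑ m, (S (constSect E (χ q) (hc q) (hW q) (Matrix.single j m 1))).1 r i m
  let a : Q → Matrix (Fin n) (Fin n) ℂ := fun q => if hq : q ∈ W then a₀ ⟨q, hq⟩ q else 0
  -- The cut-off used in `a` changes from point to point. Close to `q` it may be replaced by the
  -- fixed `χ q`: both are one at `r`, and only the value at `r` matters to `S`.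
  have ha₀ : ∀ (q : W), ∀ᶠ r in 𝓝 (q : Q), a r = a₀ q r := by
    intro q
    filter_upwards [h1 q, W.isOpen.mem_nhds q.2] with r hr hrW
    have hrW' : r ∈ W := hrW
    simp only [a, hrW', dif_pos, a₀]
    ext i j
    simp only [Matrix.of_apply]
    refine Finset.sum_congr rfl fun m _ => ?_
    rw [hS.congr (q := r)]
    simp [hr, (h1 ⟨r, hrW'⟩).self_of_nhds]
  have hsm : SmoothOn d (W : Set Q) a := by
    intro i j q hq
    have hs : ContMDiffAt (𝓡 d) 𝓘(ℝ, ℂ) ∞ (fun r => a₀ ⟨q, hq⟩ r i j) q := by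
      have : ContMDiff (𝓡 d) 𝓘(ℝ, ℂ) ∞ (fun r => a₀ ⟨q, hq⟩ r i j) := by
        rw [← contMDiffOn_univ]
        change ContMDiffOn (𝓡 d) 𝓘(ℝ, ℂ) ∞ (fun r => ∑ m, (S (constSect E (χ ⟨q, hq⟩) (hc ⟨q, hq⟩)
          (hW ⟨q, hq⟩) (Matrix.single j m 1))).1 r i m) Set.univ
        exact contMDiffOn_finsetSum fun m _ => sect_smooth
          (S (constSect E (χ ⟨q, hq⟩) (hc ⟨q, hq⟩) (hW ⟨q, hq⟩) (Matrix.single j m 1))) i m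
      exact this q
    refine (hs.congr_of_eventuallyEq ?_).contMDiffWithinAt
    filter_upwards [ha₀ ⟨q, hq⟩] with r hr
    rw [hr]
  refine ⟨⟨a, hsm⟩, LinearMap.ext fun ψ => sect_ext fun q => ?_⟩
  rw [rep_apply]
  by_cases hq : q ∈ W
  · obtain ⟨u, hu, hu1⟩ := exists_eq_vecMulVec_of_trace_one (E.idem q) (E.herm q) (E.trace_one q)
    have hχ := (h1 ⟨q, hq⟩).self_of_nhds
    let L : Matrix (Fin n) (Fin N) ℂ →ₗ[ℂ] Matrix (Fin n) (Fin N) ℂ :=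
      (LinearMap.proj q ∘ₗ (sect E n W).subtype) ∘ₗ S ∘ₗ
        constSect E (χ ⟨q, hq⟩) (hc ⟨q, hq⟩) (hW ⟨q, hq⟩)
    have hL : ∀ v, L v = (S (constSect E (χ ⟨q, hq⟩) (hc ⟨q, hq⟩) (hW ⟨q, hq⟩) v)).1 q :=
      fun _ => rfl
    have key := eq_of_mul_of_rankOne hu L
      (fun v => hS.congr (by simp [Matrix.mul_assoc, E.idem])) (fun v => sect_mul_p _ q)
      (sect_mul_p ψ q)
    have e1 : (S ψ).1 q = L (ψ.1 q) := hS.congr (by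
      change _ = ((χ ⟨q, hq⟩ q : ℝ) : ℂ) • (ψ.1 q * E.p q)
      rw [hχ, sect_mul_p]; simp)
    rw [e1, key]
    simp only [a, hq, dif_pos, a₀, hL]
  · rw [sect_eq_zero_of_notMem _ hq, sect_eq_zero_of_notMem ψ hq, Matrix.mul_zero]

/-- Hadamard's lemma for sections supported in a chart. -/
theorem exists_sum_chart_smul_of_eq_zero {φ : OpenPartialHomeomorph Q (EuclideanSpace ℝ (Fin d))}
    (hφ : φ ∈ IsManifold.maximalAtlas (𝓡 d) ∞ Q) {ψ : sect E n W}
    (hs : tsupport ψ.1 ⊆ φ.source) {q₀ : Q} (hq₀ : q₀ ∈ φ.source) (h0 : ψ.1 q₀ = 0) :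
    ∃ χ : Fin d → sect E n W, (∀ m, tsupport (χ m).1 ⊆ φ.source) ∧
      ∀ q, ψ.1 q = ∑ m, ((φ q m - φ q₀ m : ℝ) : ℂ) • (χ m).1 q := by
  have hsub : ∀ i j, tsupport (fun q => ψ.1 q i j) ⊆ tsupport ψ.1 := fun i j =>
    tsupport_subset_tsupport fun q h => by simp [h]
  have hh := fun i j => exists_sum_chart_mul_of_eq_zero hφ (W.isOpen.inter φ.open_source)
    Set.inter_subset_right (contMDiffOn_univ.1 (sect_smooth ψ i j))
    ((sect_hasCompactSupport ψ).of_isClosed_subset isClosed_closure (hsub i j))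
    ((hsub i j).trans (Set.subset_inter (sect_tsupport_subset ψ) hs)) hq₀
    (by simp [h0])
  choose h hsm hc hU hsum using hh
  let K : Fin d → Set Q := fun m => ⋃ i, ⋃ j, tsupport (h i j m)
  have hK : ∀ m, IsCompact (K m) := fun m => isCompact_iUnion fun i => isCompact_iUnion fun j =>
    (hc i j m).isCompact
  have hKU : ∀ m, K m ⊆ W ∩ φ.source := fun m => Set.iUnion_subset fun i =>
    Set.iUnion_subset fun j => hU i j m
  -- The entrywise factors need not have rows in the fibre of `E`. Multiplication by the projection
  -- repairs this and leaves the sum unchanged, because `ψ p = ψ`.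
  let F : Fin d → Q → Matrix (Fin n) (Fin N) ℂ := fun m q => (Matrix.of fun i j => h i j m q) * E.p q
  have hF : ∀ m, tsupport (F m) ⊆ K m := by
    intro m
    refine closure_minimal (fun q hq => ?_) (hK m).isClosed
    by_contra hqK
    refine hq ?_
    have : (Matrix.of fun i j => h i j m q) = 0 := by
      ext i j
      exact image_eq_zero_of_notMem_tsupport (f := h i j m) fun hh =>
        hqK (Set.mem_iUnion.2 ⟨i, Set.mem_iUnion.2 ⟨j, hh⟩⟩)
    simp only [F, this, Matrix.zero_mul]
  refine ⟨fun m => ⟨F m, ?_, (hK m).of_isClosed_subset isClosed_closure (hF m),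
    (hF m).trans ((hKU m).trans Set.inter_subset_left), fun q => by
      simp only [F, Matrix.mul_assoc, E.idem]⟩,
    fun m => (hF m).trans ((hKU m).trans Set.inter_subset_right), fun q => ?_⟩
  · exact SmoothOn.mul (f := fun q => Matrix.of fun i j => h i j m q)
      (fun i j => (hsm i j m).contMDiffOn) E.smooth
  · simp only [F]
    rw [← sect_mul_p ψ q]
    simp_rw [← Matrix.smul_mul]
    rw [← Matrix.sum_mul]
    congr 1
    ext i j
    simp [hsum i j q, Matrix.sum_apply]

/-- If `ψ` vanishes at `q₀`, then `ψ = ∑ (x^m - x^m(q₀)) χ_m`. Moving `S` past these factors leaves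
`∑ (x^m - x^m(q₀)) S χ_m`, which vanishes at `q₀`. On a chart domain the `d` coordinates are
therefore enough. -/
theorem isPointwise_of_commute_coord {φ : OpenPartialHomeomorph Q (EuclideanSpace ℝ (Fin d))}
    (hφ : φ ∈ IsManifold.maximalAtlas (𝓡 d) ∞ Q)
    {x : Fin d → C^∞⟮𝓡 d, Q; 𝓘(ℝ, ℝ), ℝ⟯} (hx : ∀ q ∈ φ.source, ∀ k, x k q = φ q k)
    {S : Module.End ℂ (sect E n (dom φ))}
    (hS : ∀ k, S * scal E (dom φ) (x k) = scal E (dom φ) (x k) * S) : IsPointwise S := by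
  intro ψ q₀ h0
  by_cases hq₀ : q₀ ∈ dom φ
  swap
  · exact sect_eq_zero_of_notMem _ hq₀
  obtain ⟨χ, -, hsum⟩ := exists_sum_chart_smul_of_eq_zero hφ (sect_tsupport_subset ψ) hq₀ h0
  have hψ : ψ = ∑ m, (scal E (dom φ) (x m) (χ m) - ((φ q₀ m : ℝ) : ℂ) • χ m) := by
    refine sect_ext fun q => ?_
    rw [hsum q, AddSubmonoidClass.coe_finsetSum, Finset.sum_apply]
    refine Finset.sum_congr rfl fun m _ => ?_
    change _ = (scal E (dom φ) (x m) (χ m)).1 q - ((φ q₀ m : ℝ) : ℂ) • (χ m).1 q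
    rw [scal_apply, ← sub_smul]
    by_cases hq : q ∈ dom φ
    · rw [hx q hq m]; push_cast; rfl
    · simp [sect_eq_zero_of_notMem (χ m) hq]
  rw [hψ, map_sum, AddSubmonoidClass.coe_finsetSum, Finset.sum_apply]
  refine Finset.sum_eq_zero fun m _ => ?_
  have h1 : S (scal E (dom φ) (x m) (χ m)) = scal E (dom φ) (x m) (S (χ m)) :=
    LinearMap.congr_fun (hS m) (χ m)
  rw [map_sub, map_smul, h1]
  change (scal E (dom φ) (x m) (S (χ m))).1 q₀ - ((φ q₀ m : ℝ) : ℂ) • (S (χ m)).1 q₀ = 0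
  rw [scal_apply, hx q₀ hq₀ m, sub_self]

/-- The same argument on an arbitrary open set. First `ψ` is localized by `η` with `η q₀ = 1`, which
does not affect `S ψ` at `q₀`; then the coordinates of a chart around `q₀` are multiplied by `θ`, to
become compactly supported smooth functions on `Q`. -/
theorem isPointwise_of_commute_scal {S : Module.End ℂ (sect E n W)}
    (hS : ∀ f : C^∞⟮𝓡 d, Q; 𝓘(ℝ, ℝ), ℝ⟯, HasCompactSupport f →
      S * scal E W f = scal E W f * S) : IsPointwise S := by
  have hS' : ∀ f : C^∞⟮𝓡 d, Q; 𝓘(ℝ, ℝ), ℝ⟯, HasCompactSupport f → ∀ ψ q,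
      (S (scal E W f ψ)).1 q = (f q : ℂ) • (S ψ).1 q := by
    intro f hf ψ q
    rw [← scal_apply]
    exact congrFun (congrArg Subtype.val (LinearMap.congr_fun (hS f hf) ψ)) q
  intro ψ q₀ h0
  by_cases hq₀ : q₀ ∈ W
  swap
  · exact sect_eq_zero_of_notMem _ hq₀
  set φ := chartAt (EuclideanSpace ℝ (Fin d)) q₀ with hφdef
  have hφ : φ ∈ IsManifold.maximalAtlas (𝓡 d) ∞ Q := IsManifold.chart_mem_maximalAtlas q₀
  have hq₀s : q₀ ∈ φ.source := mem_chart_source _ q₀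
  obtain ⟨η, hηc, hηs, hη1⟩ := exists_bump (d := d) isCompact_singleton φ.open_source
    (Set.singleton_subset_iff.2 hq₀s)
  have hη : η q₀ = 1 := (hη1 q₀ rfl).self_of_nhds
  have hsupp : tsupport (scal E W η ψ).1 ⊆ φ.source := by
    exact (tsupport_subset_tsupport fun q h => by simp [h]).trans hηs
  obtain ⟨χ, hχs, hsum⟩ := exists_sum_chart_smul_of_eq_zero hφ hsupp hq₀s (by simp [h0])
  have hK : IsCompact (⋃ m, tsupport (χ m).1) :=
    isCompact_iUnion fun m => (sect_hasCompactSupport (χ m)).isCompact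
  obtain ⟨θ, hθc, hθs, hθ1⟩ := exists_bump (d := d) hK φ.open_source (Set.iUnion_subset hχs)
  have hz : ∀ m, ContMDiff (𝓡 d) 𝓘(ℝ, ℝ) ∞ (fun q => θ q * (φ q m - φ q₀ m)) := by
    intro m
    refine contMDiff_of_tsupport fun q hq => ?_
    have hqs : q ∈ φ.source := hθs (tsupport_subset_tsupport (fun r h => by simp [h]) hq)
    have h1 : ContMDiffOn (𝓡 d) 𝓘(ℝ, ℝ) ∞ (fun r => φ r m - φ q₀ m) φ.source := by
      have : ContDiff ℝ ∞ (fun y : EuclideanSpace ℝ (Fin d) => y m - φ q₀ m) := by fun_prop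
      exact this.contMDiff.comp_contMDiffOn (contMDiffOn_of_mem_maximalAtlas hφ)
    exact θ.contMDiff.contMDiffAt.mul (h1.contMDiffAt (φ.open_source.mem_nhds hqs))
  let z : Fin d → C^∞⟮𝓡 d, Q; 𝓘(ℝ, ℝ), ℝ⟯ := fun m => ⟨_, hz m⟩
  have hzc : ∀ m, HasCompactSupport (z m) := fun m =>
    hθc.of_isClosed_subset isClosed_closure
      (tsupport_subset_tsupport fun q h => by change θ q * _ = 0; rw [h, zero_mul])
  have hψ : scal E W η ψ = ∑ m, scal E W (z m) (χ m) := by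
    refine sect_ext fun q => ?_
    rw [hsum q, AddSubmonoidClass.coe_finsetSum, Finset.sum_apply]
    refine Finset.sum_congr rfl fun m _ => ?_
    rw [scal_apply]
    by_cases hq : q ∈ tsupport (χ m).1
    · have : θ q = 1 := (hθ1 q (Set.mem_iUnion.2 ⟨m, hq⟩)).self_of_nhds
      change _ = ((θ q * (φ q m - φ q₀ m) : ℝ) : ℂ) • _
      rw [this, one_mul]
    · simp [image_eq_zero_of_notMem_tsupport hq]
  have h1 := hS' η hηc ψ q₀
  rw [hη, hψ, map_sum, AddSubmonoidClass.coe_finsetSum, Finset.sum_apply] at h1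
  rw [Complex.ofReal_one, one_smul] at h1
  rw [← h1]
  refine Finset.sum_eq_zero fun m _ => ?_
  rw [hS' (z m) (hzc m)]
  have : z m q₀ = 0 := by change θ q₀ * (φ q₀ m - φ q₀ m) = 0; rw [sub_self, mul_zero]
  rw [this]; simp

end Pointwise

/-! ### The scalar product and formal adjoints -/

section Inner

open MeasureTheory

variable {d N n : ℕ} {Q : Type*} [TopologicalSpace Q] [ChartedSpace (EuclideanSpace ℝ (Fin d)) Q]
  {E : LineBundle d Q N} {W : TopologicalSpace.Opens Q} [MeasurableSpace Q] [BorelSpace Q]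
  {μ : Measure Q}

omit [TopologicalSpace Q] [ChartedSpace (EuclideanSpace ℝ (Fin d)) Q] [MeasurableSpace Q] [BorelSpace Q] in
theorem trace_conjTranspose_mul_eq (φ ψ : Matrix (Fin n) (Fin N) ℂ) :
    (φᴴ * ψ).trace = ∑ m, ∑ i, star (φ i m) * ψ i m := by
  simp [Matrix.trace, Matrix.mul_apply]

theorem memLp_sect [IsFiniteMeasureOnCompacts μ] (ψ : sect E n W) (i : Fin n) (m : Fin N) :
    MemLp (fun q => ψ.1 q i m) 2 μ := by
  have hc : Continuous (fun q => ψ.1 q i m) :=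
    (continuous_apply m).comp ((continuous_apply i).comp (sect_continuous ψ))
  exact hc.memLp_of_hasCompactSupport ((sect_hasCompactSupport ψ).of_isClosed_subset
    isClosed_closure (tsupport_subset_tsupport fun q h => by simp [h]))

theorem isL2Section_sect [IsFiniteMeasureOnCompacts μ] (ψ : sect E n W) : IsL2Section E n μ ψ.1 :=
  ⟨memLp_sect ψ, sect_mul_p ψ⟩

theorem integrable_inner [IsFiniteMeasureOnCompacts μ] {φ : Q → Matrix (Fin n) (Fin N) ℂ}
    (hφ : IsL2Section E n μ φ) (ψ : sect E n W) :
    Integrable (fun q => ((φ q)ᴴ * ψ.1 q).trace) μ := by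
  simp_rw [trace_conjTranspose_mul_eq]
  refine integrable_finsetSum _ fun m _ => integrable_finsetSum _ fun i _ => ?_
  exact (hφ.1 i m).star.integrable_mul (memLp_sect ψ i m)

theorem integrable_inner_sect [IsFiniteMeasureOnCompacts μ] {W' : TopologicalSpace.Opens Q}
    (φ : sect E n W') (ψ : sect E n W) : Integrable (fun q => ((φ.1 q)ᴴ * ψ.1 q).trace) μ :=
  integrable_inner (isL2Section_sect φ) ψ

theorem innerL2_sub_right [IsFiniteMeasureOnCompacts μ] {φ : Q → Matrix (Fin n) (Fin N) ℂ}
    (hφ : IsL2Section E n μ φ) (ψ χ : sect E n W) :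
    innerL2 μ φ (ψ - χ).1 = innerL2 μ φ ψ.1 - innerL2 μ φ χ.1 := by
  unfold innerL2
  rw [← integral_sub (integrable_inner hφ ψ) (integrable_inner hφ χ)]
  refine integral_congr_ae (Filter.Eventually.of_forall fun q => ?_)
  change ((φ q)ᴴ * (ψ.1 q - χ.1 q)).trace = _
  rw [Matrix.mul_sub, Matrix.trace_sub]

theorem innerL2_add_right [IsFiniteMeasureOnCompacts μ] (φ ψ χ : sect E n W) :
    innerL2 μ φ.1 (ψ + χ).1 = innerL2 μ φ.1 ψ.1 + innerL2 μ φ.1 χ.1 := by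
  unfold innerL2
  rw [← integral_add (integrable_inner_sect φ ψ) (integrable_inner_sect φ χ)]
  refine integral_congr_ae (Filter.Eventually.of_forall fun q => ?_)
  change ((φ.1 q)ᴴ * (ψ.1 q + χ.1 q)).trace = _
  rw [Matrix.mul_add, Matrix.trace_add]

theorem innerL2_add_left [IsFiniteMeasureOnCompacts μ] (φ ψ χ : sect E n W) :
    innerL2 μ (φ + ψ).1 χ.1 = innerL2 μ φ.1 χ.1 + innerL2 μ ψ.1 χ.1 := by
  unfold innerL2
  rw [← integral_add (integrable_inner_sect φ χ) (integrable_inner_sect ψ χ)]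
  refine integral_congr_ae (Filter.Eventually.of_forall fun q => ?_)
  change ((φ.1 q + ψ.1 q)ᴴ * χ.1 q).trace = _
  rw [Matrix.conjTranspose_add, Matrix.add_mul, Matrix.trace_add]

theorem innerL2_smul_right (t : ℂ) (φ ψ : sect E n W) :
    innerL2 μ φ.1 (t • ψ).1 = t * innerL2 μ φ.1 ψ.1 := by
  unfold innerL2
  rw [← integral_const_mul]
  refine integral_congr_ae (Filter.Eventually.of_forall fun q => ?_)
  change ((φ.1 q)ᴴ * (t • ψ.1 q)).trace = _
  rw [Matrix.mul_smul, Matrix.trace_smul, smul_eq_mul]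

theorem innerL2_smul_left (t : ℂ) (φ ψ : sect E n W) :
    innerL2 μ (t • φ).1 ψ.1 = star t * innerL2 μ φ.1 ψ.1 := by
  unfold innerL2
  rw [← integral_const_mul]
  refine integral_congr_ae (Filter.Eventually.of_forall fun q => ?_)
  change ((t • φ.1 q)ᴴ * ψ.1 q).trace = _
  rw [Matrix.conjTranspose_smul, Matrix.smul_mul, Matrix.trace_smul, smul_eq_mul]

/-- The integrand is continuous and non-negative, and `μ` charges every non-empty open set. -/
theorem eq_zero_of_innerL2_self [IsFiniteMeasureOnCompacts μ] [μ.IsOpenPosMeasure]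
    {ψ : sect E n W} (h : innerL2 μ ψ.1 ψ.1 = 0) : ψ = 0 := by
  have hre : ∀ q, ((ψ.1 q)ᴴ * ψ.1 q).trace = ((∑ m, ∑ i, ‖ψ.1 q i m‖ ^ 2 : ℝ) : ℂ) := by
    intro q
    rw [trace_conjTranspose_mul_eq]
    push_cast
    exact Finset.sum_congr rfl fun m _ => Finset.sum_congr rfl fun i _ => Complex.conj_mul' _
  have hint := integrable_inner_sect (μ := μ) ψ ψ
  unfold innerL2 at h
  simp_rw [hre] at h hint
  rw [integral_complex_ofReal, Complex.ofReal_eq_zero] at h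
  have hcont : Continuous (fun q => ∑ m, ∑ i, ‖ψ.1 q i m‖ ^ 2) := by
    refine continuous_finsetSum _ fun m _ => continuous_finsetSum _ fun i _ => ?_
    have hc : Continuous (fun q => ψ.1 q i m) :=
      (continuous_apply m).comp ((continuous_apply i).comp (sect_continuous ψ))
    exact hc.norm.pow 2
  have hint' : Integrable (fun q => ∑ m, ∑ i, ‖ψ.1 q i m‖ ^ 2) μ := by
    have := hint.re
    simpa only [RCLike.re_to_complex, Complex.ofReal_re] using this
  rw [integral_eq_zero_iff_of_nonneg (fun q => by positivity) hint'] at h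
  have h0 := (Continuous.ae_eq_iff_eq μ hcont continuous_const).1 h
  refine sect_ext fun q => ?_
  ext i m
  have hq := congrFun h0 q
  have h1 := (Finset.sum_eq_zero_iff_of_nonneg (fun m _ => by positivity)).1 hq m (Finset.mem_univ _)
  have h2 := (Finset.sum_eq_zero_iff_of_nonneg (fun i _ => by positivity)).1 h1 i (Finset.mem_univ _)
  simpa using h2

variable (μ) in
/-- `S'` is a formal adjoint of `S` on `𝓓(W)`. -/
def IsAdj (S S' : Module.End ℂ (sect E n W)) : Prop :=
  ∀ φ ψ : sect E n W, innerL2 μ (S φ).1 ψ.1 = innerL2 μ φ.1 (S' ψ).1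

theorem IsAdj.add [IsFiniteMeasureOnCompacts μ] {S S' R R' : Module.End ℂ (sect E n W)}
    (hS : IsAdj μ S S') (hR : IsAdj μ R R') : IsAdj μ (S + R) (S' + R') := fun φ ψ => by
  rw [LinearMap.add_apply, LinearMap.add_apply, innerL2_add_left, innerL2_add_right, hS, hR]

theorem IsAdj.smul {S S' : Module.End ℂ (sect E n W)}
    (hS : IsAdj μ S S') (t : ℂ) : IsAdj μ (t • S) (star t • S') := fun φ ψ => by
  rw [LinearMap.smul_apply, LinearMap.smul_apply, innerL2_smul_left, innerL2_smul_right, hS]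

theorem IsAdj.mul {S S' R R' : Module.End ℂ (sect E n W)}
    (hS : IsAdj μ S S') (hR : IsAdj μ R R') : IsAdj μ (S * R) (R' * S') := fun φ ψ => by
  rw [Module.End.mul_apply, Module.End.mul_apply, hS, hR]

theorem IsAdj.sub [IsFiniteMeasureOnCompacts μ] {S S' R R' : Module.End ℂ (sect E n W)}
    (hS : IsAdj μ S S') (hR : IsAdj μ R R') : IsAdj μ (S - R) (S' - R') := fun φ ψ => by
  rw [LinearMap.sub_apply, LinearMap.sub_apply, sub_eq_add_neg, sub_eq_add_neg,
    ← neg_one_smul ℂ (R φ), ← neg_one_smul ℂ (R' ψ), innerL2_add_left, innerL2_add_right,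
    innerL2_smul_left, innerL2_smul_right, hS, hR]
  simp

theorem IsAdj.sum [IsFiniteMeasureOnCompacts μ] {ι : Type*} {I : Finset ι}
    {S S' : ι → Module.End ℂ (sect E n W)} (h : ∀ i ∈ I, IsAdj μ (S i) (S' i)) :
    IsAdj μ (∑ i ∈ I, S i) (∑ i ∈ I, S' i) := by
  classical
  induction I using Finset.induction_on with
  | empty =>
    intro φ ψ
    simp [innerL2]
  | insert i I hi ih =>
    rw [Finset.sum_insert hi, Finset.sum_insert hi]
    exact (h i (Finset.mem_insert_self _ _)).add
      (ih fun j hj => h j (Finset.mem_insert_of_mem hj))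

theorem isAdj_rep {a b : smoothFun d n W} (h : ∀ q ∈ W, b.1 q = (a.1 q)ᴴ) :
    IsAdj μ (rep E W a) (rep E W b) := fun φ ψ => by
  refine integral_congr_ae (Filter.Eventually.of_forall fun q => ?_)
  by_cases hq : q ∈ W
  · simp only [rep_apply, h q hq, Matrix.conjTranspose_mul, Matrix.mul_assoc]
  · simp only [sect_eq_zero_of_notMem _ hq, Matrix.mul_zero, Matrix.conjTranspose_zero]

/-- The adjoint of a smooth matrix-valued function. -/
def adjFun (a : smoothFun d n W) : smoothFun d n W := ⟨fun q => (a.1 q)ᴴ, SmoothOn.conjTranspose a.2⟩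

/-- The difference of the operators of `a` and of its pointwise adjoint has formal adjoint `rep E W
a - rep E W a = 0`, so its values have norm zero. -/
theorem isHermitian_of_isHermOp_rep [T2Space Q] [SigmaCompactSpace Q] [IsManifold (𝓡 d) ∞ Q]
    [IsFiniteMeasureOnCompacts μ] [μ.IsOpenPosMeasure] {a : smoothFun d n W}
    (h : IsHermOp E μ (rep E W a)) {q : Q} (hq : q ∈ W) : (a.1 q).IsHermitian := by
  have key : rep E W a = rep E W (adjFun a) := by
    rw [← sub_eq_zero]
    refine LinearMap.ext fun φ => eq_zero_of_innerL2_self (μ := μ) ?_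
    have h1 : ∀ ψ, innerL2 μ ((rep E W a - rep E W (adjFun a)) ψ).1
        (((rep E W a - rep E W (adjFun a)) φ)).1 = innerL2 μ ψ.1 ((0 : Module.End ℂ (sect E n W))
          ((rep E W a - rep E W (adjFun a)) φ)).1 := by
      have hadj : IsAdj μ (rep E W (adjFun a)) (rep E W a) :=
        isAdj_rep fun q _ => (Matrix.conjTranspose_conjTranspose _).symm
      have hself : IsAdj μ (rep E W a) (rep E W a) := h
      have := hself.sub hadj
      have h0 : rep E W a - rep E W a = 0 := sub_self (rep E W a)
      rw [h0] at this
      exact fun ψ => this ψ _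
    rw [h1]
    simp [innerL2]
  exact (eq_of_rep_eq key hq).symm

end Inner

/-! ### Compactly supported functions in the algebra and its centre -/

section Center

variable {d n : ℕ} {Q : Type*} [TopologicalSpace Q] [T2Space Q]
  [ChartedSpace (EuclideanSpace ℝ (Fin d)) Q]

theorem mem_algA_of_hasCompactSupport {a : smoothFun d n (⊤ : TopologicalSpace.Opens Q)}
    (h : HasCompactSupport a.1) : a ∈ algA d Q n := fun i j => by
  have hc : HasCompactSupport (fun q => a.1 q i j) :=
    h.of_isClosed_subset isClosed_closure (tsupport_subset_tsupport fun q hq => by simp [hq])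
  refine tendsto_const_nhds.congr' ?_
  rw [Filter.EventuallyEq, Filter.eventually_iff_exists_mem]
  exact ⟨_, hc.isCompact.compl_mem_cocompact,
    fun q hq => (image_eq_zero_of_notMem_tsupport (f := fun q => a.1 q i j) hq).symm⟩

theorem hasCompactSupport_scalarFun {f : C^∞⟮𝓡 d, Q; 𝓘(ℝ, ℝ), ℝ⟯} (hf : HasCompactSupport f) :
    HasCompactSupport (scalarFun d n f).1 :=
  hf.of_isClosed_subset isClosed_closure (tsupport_subset_tsupport fun q hq => by
    change ((f q : ℝ) : ℂ) • (1 : Matrix (Fin n) (Fin n) ℂ) = 0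
    simp [hq])

theorem scalarFun_mul_comm (f : C^∞⟮𝓡 d, Q; 𝓘(ℝ, ℝ), ℝ⟯)
    (a : smoothFun d n (⊤ : TopologicalSpace.Opens Q)) :
    scalarFun d n f * a = a * scalarFun d n f := by
  refine Subtype.ext (funext fun q => ?_)
  change (((f q : ℝ) : ℂ) • (1 : Matrix (Fin n) (Fin n) ℂ)) * a.1 q
    = a.1 q * (((f q : ℝ) : ℂ) • (1 : Matrix (Fin n) (Fin n) ℂ))
  simp

theorem scalarFun_mem_centerZ {f : C^∞⟮𝓡 d, Q; 𝓘(ℝ, ℝ), ℝ⟯} (hf : HasCompactSupport f) :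
    scalarFun d n f ∈ centerZ d Q n :=
  ⟨mem_algA_of_hasCompactSupport (hasCompactSupport_scalarFun hf), fun a _ => scalarFun_mul_comm f a⟩

end Center

/-! ### The weak closure equals the commutant of the centre -/

section WeakClosure

open MeasureTheory

variable {d N n : ℕ} {Q : Type*} [TopologicalSpace Q] [T2Space Q] [SigmaCompactSpace Q]
  [ChartedSpace (EuclideanSpace ℝ (Fin d)) Q] [IsManifold (𝓡 d) ∞ Q]
  {E : LineBundle d Q N} {W : TopologicalSpace.Opens Q} [MeasurableSpace Q]
  {μ : Measure Q}

theorem exists_rep_of_mem_commutantZ {S : Module.End ℂ (sect E n W)} (hS : S ∈ commutantZ E n W) :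
    ∃ a : smoothFun d n W, S = rep E W a :=
  exists_rep_of_isPointwise (isPointwise_of_commute_scal fun _ hf => hS _ (scalarFun_mem_centerZ hf))

/-- A basic weak neighbourhood involves finitely many sections, whose supports have compact union
inside `W`. If `χ` is one on that union, `a χ` extends to an element of `𝒜` with exactly the same
matrix elements as `a`. -/
theorem rep_mem_weakClosureA (a : smoothFun d n W) : rep E W a ∈ weakClosureA E n μ W := by
  unfold weakClosureA weakTopology
  rw [closure_induced, mem_closure_iff]
  intro o ho hao
  obtain ⟨I, u, hu, hI⟩ := isOpen_pi_iff.1 ho _ hao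
  have hK : IsCompact (⋃ w ∈ I, tsupport w.2.1) :=
    I.isCompact_biUnion fun w _ => sect_hasCompactSupport w.2
  obtain ⟨χ, hc, hW, h1⟩ := exists_bump (d := d) hK W.isOpen
    (Set.iUnion₂_subset fun w _ => sect_tsupport_subset w.2)
  let b : smoothFun d n (⊤ : TopologicalSpace.Opens Q) := ⟨fun q => a.1 q * (scalarFun d n χ).1 q,
    SmoothOn.mul_of_tsupport a.2 (scalarFun d n χ).2 ((tsupport_subset_tsupport fun q hq => by
      change ((χ q : ℝ) : ℂ) • (1 : Matrix (Fin n) (Fin n) ℂ) = 0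
      simp [hq]).trans hW)⟩
  have hb : b ∈ algA d Q n := mem_algA_of_hasCompactSupport
    ((hasCompactSupport_scalarFun (n := n) hc).of_isClosed_subset isClosed_closure
      (tsupport_subset_tsupport fun q hq => by
        change a.1 q * (scalarFun d n χ).1 q = 0
        rw [hq, Matrix.mul_zero]))
  refine ⟨_, hI fun w hw => ?_, Set.mem_image_of_mem _ (Set.mem_image_of_mem _ hb)⟩
  have : rep E W (restrictFun d W b) w.2 = rep E W a w.2 := by
    refine sect_ext fun q => ?_
    change (a.1 q * (((χ q : ℝ) : ℂ) • (1 : Matrix (Fin n) (Fin n) ℂ))) * w.2.1 q = a.1 q * w.2.1 q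
    by_cases hq : q ∈ tsupport w.2.1
    · have := (h1 q (Set.mem_biUnion hw hq)).self_of_nhds
      simp [this]
    · rw [image_eq_zero_of_notMem_tsupport hq, Matrix.mul_zero, Matrix.mul_zero]
  have h2 := (hu w hw).2
  simp only [this]
  exact h2

theorem exists_norm_le_of_mem_algA {a : smoothFun d n (⊤ : TopologicalSpace.Opens Q)}
    (h : a ∈ algA d Q n) (i j : Fin n) : ∃ C, ∀ q, ‖a.1 q i j‖ ≤ C := by
  have hc : Continuous (fun q => a.1 q i j) := continuousOn_univ.1 (a.2 i j).continuousOn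
  let f : ZeroAtInftyContinuousMap Q ℂ := ⟨⟨_, hc⟩, h i j⟩
  obtain ⟨C, hC⟩ := f.isBounded_range.exists_norm_le
  exact ⟨C, fun q => hC _ ⟨q, rfl⟩⟩

/-- Functions vanishing at infinity are bounded. This makes `⟨φ, z S ψ⟩ = ⟨z* φ, S ψ⟩` one of the
matrix elements that define the weak topology. -/
theorem isL2Section_conjTranspose_mul [BorelSpace Q]
    {a : smoothFun d n (⊤ : TopologicalSpace.Opens Q)}
    (ha : a ∈ algA d Q n) {φ : Q → Matrix (Fin n) (Fin N) ℂ} (hφ : IsL2Section E n μ φ) :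
    IsL2Section E n μ (fun q => (a.1 q)ᴴ * φ q) := by
  refine ⟨fun i m => ?_, fun q => by rw [Matrix.mul_assoc, hφ.2]⟩
  simp only [Matrix.mul_apply, Matrix.conjTranspose_apply]
  refine memLp_finsetSum _ fun k _ => ?_
  obtain ⟨C, hC⟩ := exists_norm_le_of_mem_algA ha k i
  have hc : Continuous (fun q => a.1 q k i) := continuousOn_univ.1 (a.2 k i).continuousOn
  refine MemLp.of_le_mul (c := C) (hφ.1 k m)
    (hc.star.aestronglyMeasurable.mul (hφ.1 k m).aestronglyMeasurable)
    (Filter.Eventually.of_forall fun q => ?_)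
  rw [norm_mul, norm_star]
  exact mul_le_mul_of_nonneg_right (hC q) (norm_nonneg _)

/-- Both `⟨φ, S Z ψ⟩` and `⟨φ, Z S ψ⟩` depend continuously on `S`, and they agree for `S` in `𝒜`. -/
theorem weakClosureA_subset_commutantZ [BorelSpace Q] [IsFiniteMeasureOnCompacts μ]
    [μ.IsOpenPosMeasure] : weakClosureA E n μ W ⊆ commutantZ E n W := by
  intro S hS z hz
  unfold weakClosureA weakTopology at hS
  rw [closure_induced] at hS
  have hadj : ∀ (φ : Q → Matrix (Fin n) (Fin N) ℂ) (ψ : sect E n W),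
      innerL2 μ φ (rep E W (restrictFun d W z) ψ).1
        = innerL2 μ (fun q => (z.1 q)ᴴ * φ q) ψ.1 := by
    intro φ ψ
    refine integral_congr_ae (Filter.Eventually.of_forall fun q => ?_)
    change ((φ q)ᴴ * (z.1 q * ψ.1 q)).trace = (((z.1 q)ᴴ * φ q)ᴴ * ψ.1 q).trace
    rw [Matrix.conjTranspose_mul, Matrix.conjTranspose_conjTranspose, Matrix.mul_assoc]
  rw [← sub_eq_zero]
  refine LinearMap.ext fun ψ => eq_zero_of_innerL2_self (μ := μ) ?_
  set Z := rep E W (restrictFun d W z) with hZ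
  -- The test vector is the defect itself, so a single closed condition gives `⟨φ, φ⟩ = 0`.
  set φ := (S * Z - Z * S) ψ with hφ
  let C : Set ({φ : Q → Matrix (Fin n) (Fin N) ℂ // IsL2Section E n μ φ} × sect E n W → ℂ) :=
    {v | v (⟨φ.1, isL2Section_sect φ⟩, Z ψ)
      = v (⟨_, isL2Section_conjTranspose_mul hz.1 (isL2Section_sect φ)⟩, ψ)}
  have hC : IsClosed C := isClosed_eq (continuous_apply _) (continuous_apply _)
  have hmem := closure_minimal (t := C) ?_ hC hS
  · have h1 : innerL2 μ φ.1 (S (Z ψ)).1 = innerL2 μ (fun q => (z.1 q)ᴴ * φ.1 q) (S ψ).1 := hmem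
    rw [← hadj] at h1
    have h2 := innerL2_sub_right (isL2Section_sect (μ := μ) φ) (S (Z ψ)) (Z (S ψ))
    rw [h1, sub_self] at h2
    exact h2
  · rintro _ ⟨_, ⟨a, ha, rfl⟩, rfl⟩
    change innerL2 μ φ.1 (rep E W (restrictFun d W a) (Z ψ)).1
      = innerL2 μ _ (rep E W (restrictFun d W a) ψ).1
    rw [← hadj]
    have : rep E W (restrictFun d W a) (Z ψ) = Z (rep E W (restrictFun d W a) ψ) := by
      rw [hZ, ← Module.End.mul_apply, ← Module.End.mul_apply, ← map_mul, ← map_mul, ← map_mul,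
        ← map_mul, hz.2 a ha]
    rw [this]

theorem weakClosureA_eq_commutantZ [BorelSpace Q] [IsFiniteMeasureOnCompacts μ]
    [μ.IsOpenPosMeasure] : weakClosureA E n μ W = commutantZ E n W := by
  refine Set.Subset.antisymm weakClosureA_subset_commutantZ fun S hS => ?_
  obtain ⟨a, rfl⟩ := exists_rep_of_mem_commutantZ hS
  exact rep_mem_weakClosureA a

end WeakClosure

/-! ### Locality of the Hamiltonian -/

section Local

variable {d N n : ℕ} {Q : Type*} [TopologicalSpace Q] [T2Space Q] [SigmaCompactSpace Q]
  [ChartedSpace (EuclideanSpace ℝ (Fin d)) Q] [IsManifold (𝓡 d) ∞ Q]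
  {E : LineBundle d Q N} {W : TopologicalSpace.Opens Q} {H : Module.End ℂ (sect E n ⊤)}

theorem tsupport_rep_subset (a : smoothFun d n W) (ψ : sect E n W) :
    tsupport (rep E W a ψ).1 ⊆ tsupport ψ.1 :=
  tsupport_subset_tsupport fun q hq => by rw [rep_apply, hq, Matrix.mul_zero]

theorem NCUncertainty.apply (hU : NCUncertainty E H)
    {z b : smoothFun d n (⊤ : TopologicalSpace.Opens Q)} (hz : z ∈ centerZ d Q n)
    (hb : b ∈ algA d Q n) (hzc : HasCompactSupport z.1) (hbc : HasCompactSupport b.1)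
    {ψ : sect E n ⊤} {q : Q} (hq : ψ.1 q = 0) :
    (rep E ⊤ z (H (rep E ⊤ b ψ) - rep E ⊤ b (H ψ))
      - (H (rep E ⊤ b (rep E ⊤ z ψ)) - rep E ⊤ b (H (rep E ⊤ z ψ)))).1 q = 0 := by
  obtain ⟨c, -, hc⟩ := hU z hz b hb hzc hbc
  have h1 : rep E ⊤ z (Complex.I • (H (rep E ⊤ b ψ) - rep E ⊤ b (H ψ)))
      - Complex.I • (H (rep E ⊤ b (rep E ⊤ z ψ)) - rep E ⊤ b (H (rep E ⊤ z ψ))) = rep E ⊤ c ψ :=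
    LinearMap.congr_fun hc ψ
  have h2 : z.1 q * (Complex.I • (H (rep E ⊤ b ψ) - rep E ⊤ b (H ψ)).1 q)
      - Complex.I • (H (rep E ⊤ b (rep E ⊤ z ψ)) - rep E ⊤ b (H (rep E ⊤ z ψ))).1 q
      = c.1 q * ψ.1 q := congrFun (congrArg Subtype.val h1) q
  rw [hq, Matrix.mul_zero, Matrix.mul_smul, ← smul_sub] at h2
  exact (smul_eq_zero.1 h2).resolve_left Complex.I_ne_zero

/-- The Hamiltonian is a local operator. -/
theorem tsupport_apply_subset (hU : NCUncertainty E H) (ψ : sect E n ⊤) :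
    tsupport (H ψ).1 ⊆ tsupport ψ.1 := by
  refine closure_minimal (fun q hq => ?_) isClosed_closure
  by_contra hqs
  refine hq ?_
  -- With `χ` one near `q` and zero on the support of `ψ`, the relation is used for `z = b = χ`.
  -- Every term containing `χ ψ` drops out of `[χ, [H, χ]] ψ`, leaving `-χ² H ψ`, which must vanish
  -- at `q`.
  obtain ⟨χ, hc, hW, h1⟩ := exists_bump (d := d) (isCompact_singleton (x := q))
    (isClosed_tsupport ψ.1).isOpen_compl (Set.singleton_subset_iff.2 hqs)
  have hsc := hasCompactSupport_scalarFun (n := n) hc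
  have h2 := hU.apply (scalarFun_mem_centerZ hc) (mem_algA_of_hasCompactSupport hsc) hsc hsc
    (ψ := ψ) (image_eq_zero_of_notMem_tsupport hqs)
  have h3 : rep E ⊤ (scalarFun d n χ) ψ = 0 := by
    refine sect_ext fun r => ?_
    change (scal E ⊤ χ ψ).1 r = 0
    rw [scal_apply]
    by_cases hr : r ∈ tsupport ψ.1
    · rw [image_eq_zero_of_notMem_tsupport (f := χ) fun h => hW h hr]; simp
    · rw [image_eq_zero_of_notMem_tsupport hr, smul_zero]
  rw [h3, map_zero, map_zero, zero_sub, sub_zero, map_zero, sub_zero, map_neg] at h2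
  have h4 : -((scal E ⊤ χ (scal E ⊤ χ (H ψ))).1 q) = 0 := h2
  simpa [(h1 q rfl).self_of_nhds] using h4

/-- The restriction to `𝓓(W)` of a local operator on `𝓓(Q)`. -/
noncomputable def restrOp (W : TopologicalSpace.Opens Q) (S : Module.End ℂ (sect E n ⊤))
    (hS : ∀ ψ : sect E n ⊤, tsupport (S ψ).1 ⊆ tsupport ψ.1) : Module.End ℂ (sect E n W) where
  toFun ψ := ⟨(S (incl E n W ψ)).1, sect_smooth _, sect_hasCompactSupport _,
    (hS _).trans (sect_tsupport_subset ψ), sect_mul_p _⟩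
  map_add' ψ χ := sect_ext fun q =>
    congrFun (congrArg Subtype.val (map_add S (incl E n W ψ) (incl E n W χ))) q
  map_smul' t ψ := sect_ext fun q =>
    congrFun (congrArg Subtype.val (map_smul S t (incl E n W ψ))) q

theorem rep_scalarFun_mul_of_tsupport_subset {χ : C^∞⟮𝓡 d, Q; 𝓘(ℝ, ℝ), ℝ⟯} {K : Set Q}
    (h1 : ∀ q ∈ K, ∀ᶠ r in 𝓝 q, χ r = 1) (b : smoothFun d n (⊤ : TopologicalSpace.Opens Q))
    {ψ : sect E n ⊤} (hψ : tsupport ψ.1 ⊆ K) :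
    rep E ⊤ (scalarFun d n χ * b) ψ = rep E ⊤ b ψ := by
  refine sect_ext fun q => ?_
  change (((χ q : ℝ) : ℂ) • (1 : Matrix (Fin n) (Fin n) ℂ) * b.1 q) * ψ.1 q = b.1 q * ψ.1 q
  by_cases hq : q ∈ tsupport ψ.1
  · simp [(h1 q (hψ hq)).self_of_nhds]
  · rw [image_eq_zero_of_notMem_tsupport hq, Matrix.mul_zero, Matrix.mul_zero]

/-- The uncertainty relation for functions of arbitrary support. -/
theorem isPointwise_commutator (hU : NCUncertainty E H) (f : C^∞⟮𝓡 d, Q; 𝓘(ℝ, ℝ), ℝ⟯)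
    (b : smoothFun d n (⊤ : TopologicalSpace.Opens Q)) :
    IsPointwise (scal E W f * (restrOp W H (tsupport_apply_subset hU) * rep E W (restrictFun d W b)
        - rep E W (restrictFun d W b) * restrOp W H (tsupport_apply_subset hU))
      - (restrOp W H (tsupport_apply_subset hU) * rep E W (restrictFun d W b)
        - rep E W (restrictFun d W b) * restrOp W H (tsupport_apply_subset hU)) * scal E W f) := by
  intro ψ₀ q hq
  set ψ := incl E n W ψ₀ with hψ
  -- The relation is applied to `χ f` and `χ b`, with `χ` one on the support of `ψ`. Neither `H` nor
  -- multiplication enlarges supports, so `χ` can be deleted from every term.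
  obtain ⟨χ, hc, -, h1⟩ := exists_bump (d := d) (sect_hasCompactSupport ψ) isOpen_univ
    (Set.subset_univ _)
  have hsc := hasCompactSupport_scalarFun (n := n) hc
  have hcomp : ∀ a : smoothFun d n (⊤ : TopologicalSpace.Opens Q),
      HasCompactSupport (scalarFun d n χ * a).1 := fun a =>
    hsc.of_isClosed_subset isClosed_closure (tsupport_subset_tsupport fun r hr => by
      change (scalarFun d n χ).1 r * a.1 r = 0
      rw [hr, Matrix.zero_mul])
  have hz : scalarFun d n χ * scalarFun d n f ∈ centerZ d Q n :=
    ⟨mem_algA_of_hasCompactSupport (hcomp _), fun a _ => by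
      rw [mul_assoc, scalarFun_mul_comm f a, ← mul_assoc, scalarFun_mul_comm χ a, mul_assoc]⟩
  have h2 := hU.apply hz (mem_algA_of_hasCompactSupport (hcomp b)) (hcomp _) (hcomp b)
    (ψ := ψ) (q := q) hq
  have hK : ∀ a : smoothFun d n (⊤ : TopologicalSpace.Opens Q), ∀ ξ : sect E n ⊤,
      tsupport ξ.1 ⊆ tsupport ψ.1 → rep E ⊤ (scalarFun d n χ * a) ξ = rep E ⊤ a ξ :=
    fun a ξ hξ => rep_scalarFun_mul_of_tsupport_subset h1 a hξ
  have hH := tsupport_apply_subset hU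
  have hr : ∀ a : smoothFun d n (⊤ : TopologicalSpace.Opens Q), ∀ ξ : sect E n ⊤,
    tsupport (rep E ⊤ a ξ).1 ⊆ tsupport ξ.1 := fun a ξ => tsupport_rep_subset a ξ
  rw [hK b ψ subset_rfl, hK b (H ψ) (hH _), hK _ ψ subset_rfl, hK b (rep E ⊤ _ ψ) (hr _ _),
    hK b (H _) ((hH _).trans (hr _ _)), map_sub,
    hK _ (H _) ((hH _).trans (hr _ _)), hK _ (rep E ⊤ _ (H ψ)) ((hr _ _).trans (hH _)),
    ← map_sub] at h2
  exact h2

end Local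

/-! ### Jacobi identities -/

section Algebra

variable {d N n : ℕ} {Q : Type*} [TopologicalSpace Q] [T2Space Q] [SigmaCompactSpace Q]
  [ChartedSpace (EuclideanSpace ℝ (Fin d)) Q] [IsManifold (𝓡 d) ∞ Q]
  {E : LineBundle d Q N} {W : TopologicalSpace.Opens Q} {H : Module.End ℂ (sect E n ⊤)}

theorem commutator_symm {R : Type*} [Ring R] (h x y : R) (hxy : x * y = y * x) :
    x * (h * y - y * h) - (h * y - y * h) * x = y * (h * x - x * h) - (h * x - x * h) * y := by
  have : x * (h * y - y * h) - (h * y - y * h) * x - (y * (h * x - x * h) - (h * x - x * h) * y)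
      = h * (x * y - y * x) - (x * y - y * x) * h := by noncomm_ring
  rw [← sub_eq_zero, this, hxy]
  simp

/-- When `t` commutes with `x` and `y`, two uses of the Jacobi identity give `[[x, [h, y]], t] =
-[x, [y, [h, t]]]`. It serves to show that the metric commutes with constant matrices. -/
theorem commutator_comm_of_commute {R : Type*} [Ring R] (h x y t : R) (hx : x * t = t * x)
    (hy : y * t = t * y)
    (hc : x * (y * (h * t - t * h) - (h * t - t * h) * y)
      = (y * (h * t - t * h) - (h * t - t * h) * y) * x) :
    (x * (h * y - y * h) - (h * y - y * h) * x) * t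
      = t * (x * (h * y - y * h) - (h * y - y * h) * x) := by
  have e : (x * (h * y - y * h) - (h * y - y * h) * x) * t
      - t * (x * (h * y - y * h) - (h * y - y * h) * x)
      = (x * (h * (y * t - t * y) - (y * t - t * y) * h)
        - (h * (y * t - t * y) - (y * t - t * y) * h) * x)
      - (x * (y * (h * t - t * h) - (h * t - t * h) * y)
        - (y * (h * t - t * h) - (h * t - t * h) * y) * x)
      + ((x * t - t * x) * (h * y - y * h) - (h * y - y * h) * (x * t - t * x)) := by
    noncomm_ring
  rw [← sub_eq_zero, e, hx, hy, hc]
  simp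

end Algebra

/-! ### Frames and the momentum operators -/

section Momentum

open MeasureTheory

variable {d N n : ℕ} {Q : Type*} [TopologicalSpace Q] [T2Space Q]
  [ChartedSpace (EuclideanSpace ℝ (Fin d)) Q] [IsManifold (𝓡 d) ∞ Q]
  {E : LineBundle d Q N} {φ : OpenPartialHomeomorph Q (EuclideanSpace ℝ (Fin d))}
  {s : Q → Fin N → ℂ}

/-- The non-zero vector `s q` and the rows of `ψ q` lie on one line; expressing both through a unit
vector `u` of that line identifies the component. -/
theorem vecMulVec_coeff {ψ : Q → Matrix (Fin n) (Fin N) ℂ} {q : Q} (hs : s q ᵥ* E.p q = s q)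
    (h0 : s q ≠ 0) (hψ : ψ q * E.p q = ψ q) : Matrix.vecMulVec (coeff s ψ q) (s q) = ψ q := by
  obtain ⟨u, hu, hu1⟩ := exists_eq_vecMulVec_of_trace_one (E.idem q) (E.herm q) (E.trace_one q)
  have hst : s q = (s q ⬝ᵥ star u) • u := by
    conv_lhs => rw [← hs, hu, Matrix.vecMul_vecMulVec]
  have hψc : ψ q = Matrix.vecMulVec (ψ q *ᵥ star u) u := by
    conv_lhs => rw [← hψ, hu, Matrix.mul_vecMulVec]
  set t := s q ⬝ᵥ star u with ht
  have ht0 : t ≠ 0 := fun h => h0 (by rw [hst, h, zero_smul])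
  have hnorm : ((∑ m, ‖s q m‖ ^ 2 : ℝ) : ℂ) = t * star t := by
    have : ((∑ m, ‖s q m‖ ^ 2 : ℝ) : ℂ) = s q ⬝ᵥ star (s q) := by
      rw [dotProduct]
      push_cast
      exact Finset.sum_congr rfl fun m _ => (Complex.mul_conj' _).symm
    rw [this, hst, star_smul, smul_dotProduct, dotProduct_smul, hu1]
    simp
  have hc : coeff s ψ q = t⁻¹ • (ψ q *ᵥ star u) := by
    unfold coeff
    have h1 : ψ q *ᵥ star (s q) = star t • (ψ q *ᵥ star u) := by
      rw [hst, star_smul, Matrix.mulVec_smul]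
    have hst0 : star t ≠ 0 := star_ne_zero.2 ht0
    rw [h1, hnorm, smul_smul]
    congr 1
    field_simp
  rw [hc]
  conv_rhs => rw [hψc]
  conv_lhs => rw [hst]
  rw [Matrix.smul_vecMulVec, Matrix.vecMulVec_smul, smul_smul, inv_mul_cancel₀ ht0, one_smul]

theorem coeff_add (ψ χ : Q → Matrix (Fin n) (Fin N) ℂ) (q : Q) :
    coeff s (ψ + χ) q = coeff s ψ q + coeff s χ q := by
  simp [coeff, Matrix.add_mulVec]

theorem coeff_smul (t : ℂ) (ψ : Q → Matrix (Fin n) (Fin N) ℂ) (q : Q) :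
    coeff s (t • ψ) q = t • coeff s ψ q := by
  simp [coeff, Matrix.smul_mulVec, smul_comm t]

theorem coeff_eq_zero {ψ : Q → Matrix (Fin n) (Fin N) ℂ} {q : Q} (h : ψ q = 0) :
    coeff s ψ q = 0 := by
  simp [coeff, h]

theorem coeff_mul {ψ : Q → Matrix (Fin n) (Fin N) ℂ} (a : Q → Matrix (Fin n) (Fin n) ℂ) (q : Q) :
    coeff s (fun r => a r * ψ r) q = a q *ᵥ coeff s ψ q := by
  simp [coeff, Matrix.mulVec_smul]

theorem tsupport_coeff_subset (ψ : Q → Matrix (Fin n) (Fin N) ℂ) :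
    tsupport (coeff s ψ) ⊆ tsupport ψ :=
  tsupport_subset_tsupport fun _ h => coeff_eq_zero h

/-- `s` is a smooth nowhere vanishing section of `E` over the chart domain. -/
structure IsFrame (E : LineBundle d Q N) (φ : OpenPartialHomeomorph Q (EuclideanSpace ℝ (Fin d)))
    (s : Q → Fin N → ℂ) : Prop where
  smooth : ∀ m, ContMDiffOn (𝓡 d) 𝓘(ℝ, ℂ) ∞ (fun q => s q m) φ.source
  mem_fibre : ∀ q ∈ φ.source, s q ᵥ* E.p q = s q
  ne_zero : ∀ q ∈ φ.source, s q ≠ 0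

theorem sum_norm_sq_pos {v : Fin N → ℂ} (h : v ≠ 0) : 0 < ∑ m, ‖v m‖ ^ 2 := by
  obtain ⟨j, hj⟩ := Function.ne_iff.1 h
  exact Finset.sum_pos' (fun _ _ => by positivity) ⟨j, Finset.mem_univ _, by
    have : 0 < ‖v j‖ := norm_pos_iff.2 hj
    positivity⟩

theorem contMDiffOn_coeff (hs : IsFrame E φ s) {ψ : Q → Matrix (Fin n) (Fin N) ℂ}
    (hψ : SmoothOn d φ.source ψ) :
    ContMDiffOn (𝓡 d) 𝓘(ℝ, Fin n → ℂ) ∞ (coeff s ψ) φ.source := by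
  rw [contMDiffOn_pi_space]
  intro i
  have hr : ContMDiffOn (𝓡 d) 𝓘(ℝ, ℂ) ∞ (fun q => ((∑ m, ‖s q m‖ ^ 2 : ℝ) : ℂ)) φ.source := by
    have : ContMDiffOn (𝓡 d) 𝓘(ℝ, ℂ) ∞ (fun q => ∑ m, s q m * star (s q m)) φ.source :=
      contMDiffOn_finsetSum fun m _ => contMDiffOn_complex_mul (hs.smooth m)
        (contMDiffOn_star (hs.smooth m))
    refine this.congr fun q _ => ?_
    push_cast
    exact Finset.sum_congr rfl fun m _ => (Complex.mul_conj' _).symm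
  have hinv : ContMDiffOn (𝓡 d) 𝓘(ℝ, ℂ) ∞ (fun q => ((∑ m, ‖s q m‖ ^ 2 : ℝ) : ℂ)⁻¹) φ.source := by
    intro q hq
    have h0 : ((∑ m, ‖s q m‖ ^ 2 : ℝ) : ℂ) ≠ 0 := by
      exact_mod_cast (sum_norm_sq_pos (hs.ne_zero q hq)).ne'
    exact ContMDiffAt.comp_contMDiffWithinAt
      (g := fun z : ℂ => z⁻¹) q (contDiffAt_inv ℝ h0).contMDiffAt (hr q hq)
  have hsum : ContMDiffOn (𝓡 d) 𝓘(ℝ, ℂ) ∞ (fun q => ∑ m, ψ q i m * star (s q m)) φ.source :=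
    contMDiffOn_finsetSum fun m _ => contMDiffOn_complex_mul (hψ i m)
      (contMDiffOn_star (hs.smooth m))
  exact contMDiffOn_complex_mul hinv hsum

variable (φ s) in
/-- The components of a section in the frame `s`, as a function on coordinate space. -/
noncomputable def localRep : sect E n (dom φ) →ₗ[ℂ] EuclideanSpace ℝ (Fin d) → Fin n → ℂ where
  toFun ψ := φ.target.indicator (coeff s ψ.1 ∘ φ.symm)
  map_add' ψ χ := by
    funext y
    by_cases hy : y ∈ φ.target
    · simpa [hy] using coeff_add ψ.1 χ.1 _
    · simp [hy]
  map_smul' t ψ := by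
    funext y
    by_cases hy : y ∈ φ.target
    · simpa [hy] using coeff_smul t ψ.1 _
    · simp [hy]

theorem localRep_of_mem (ψ : sect E n (dom φ)) {y : EuclideanSpace ℝ (Fin d)} (hy : y ∈ φ.target) :
    localRep φ s ψ y = coeff s ψ.1 (φ.symm y) :=
  Set.indicator_of_mem hy _

theorem localRep_of_notMem (ψ : sect E n (dom φ)) {y : EuclideanSpace ℝ (Fin d)}
    (hy : y ∉ φ.target) : localRep φ s ψ y = 0 :=
  Set.indicator_of_notMem hy _

theorem localRep_apply (ψ : sect E n (dom φ)) {q : Q} (hq : q ∈ φ.source) :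
    localRep φ s ψ (φ q) = coeff s ψ.1 q := by
  rw [localRep_of_mem ψ (φ.map_source hq), φ.left_inv hq]

theorem tsupport_coeff_sect_subset (ψ : sect E n (dom φ)) : tsupport (coeff s ψ.1) ⊆ φ.source :=
  (tsupport_coeff_subset ψ.1).trans (sect_tsupport_subset ψ)

theorem hasCompactSupport_coeff (ψ : sect E n (dom φ)) : HasCompactSupport (coeff s ψ.1) :=
  (sect_hasCompactSupport ψ).of_isClosed_subset isClosed_closure (tsupport_coeff_subset ψ.1)

theorem hasCompactSupport_localRep (ψ : sect E n (dom φ)) :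
    HasCompactSupport (localRep φ s ψ) :=
  hasCompactSupport_indicator_comp_symm (hasCompactSupport_coeff ψ) (tsupport_coeff_sect_subset ψ)

theorem contDiff_localRep (hφ : φ ∈ IsManifold.maximalAtlas (𝓡 d) ∞ Q) (hs : IsFrame E φ s)
    (ψ : sect E n (dom φ)) : ContDiff ℝ ∞ (localRep φ s ψ) :=
  contDiff_indicator_comp_symm hφ
    (contMDiffOn_coeff hs ((sect_smooth ψ).mono (Set.subset_univ _)))
    (hasCompactSupport_coeff ψ) (tsupport_coeff_sect_subset ψ)

theorem differentiable_localRep (hφ : φ ∈ IsManifold.maximalAtlas (𝓡 d) ∞ Q) (hs : IsFrame E φ s)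
    (ψ : sect E n (dom φ)) : Differentiable ℝ (localRep φ s ψ) :=
  (contDiff_localRep hφ hs ψ).differentiable (by simp)

theorem vecMulVec_localRep (hs : IsFrame E φ s) (ψ : sect E n (dom φ)) {q : Q}
    (hq : q ∈ φ.source) : Matrix.vecMulVec (localRep φ s ψ (φ q)) (s q) = ψ.1 q := by
  rw [localRep_apply ψ hq]
  exact vecMulVec_coeff (hs.mem_fibre q hq) (hs.ne_zero q hq) (sect_mul_p ψ q)

theorem localRep_rep (a : smoothFun d n (dom φ)) (ψ : sect E n (dom φ))
    (y : EuclideanSpace ℝ (Fin d)) :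
    localRep φ s (rep E (dom φ) a ψ) y = a.1 (φ.symm y) *ᵥ localRep φ s ψ y := by
  by_cases hy : y ∈ φ.target
  · rw [localRep_of_mem _ hy, localRep_of_mem _ hy]
    exact coeff_mul a.1 _
  · rw [localRep_of_notMem _ hy, localRep_of_notMem _ hy, Matrix.mulVec_zero]

theorem localRep_scal {x : Fin d → C^∞⟮𝓡 d, Q; 𝓘(ℝ, ℝ), ℝ⟯}
    (hx : ∀ q ∈ φ.source, ∀ k, x k q = φ q k) (k : Fin d) (ψ : sect E n (dom φ))
    (y : EuclideanSpace ℝ (Fin d)) :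
    localRep φ s (scal E (dom φ) (x k) ψ) y = y k • localRep φ s ψ y := by
  have h1 := localRep_rep (s := s) (restrictFun d (dom φ) (scalarFun d n (x k))) ψ y
  refine h1.trans ?_
  by_cases hy : y ∈ φ.target
  · change (((x k (φ.symm y) : ℝ) : ℂ) • (1 : Matrix (Fin n) (Fin n) ℂ)) *ᵥ _ = _
    rw [hx _ (φ.map_target hy), φ.right_inv hy, Matrix.smul_mulVec, Matrix.one_mulVec,
      Complex.coe_smul]
  · rw [localRep_of_notMem _ hy, Matrix.mulVec_zero, smul_zero]

theorem pderiv_eq (l : Fin d) (ψ : sect E n (dom φ)) {q : Q} (hq : q ∈ φ.source) :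
    pderiv φ s l ψ.1 q = Matrix.vecMulVec
      (fderiv ℝ (localRep φ s ψ) (φ q) (EuclideanSpace.single l 1)) (s q) := by
  unfold pderiv
  rw [if_pos hq]
  congr 2
  refine Filter.EventuallyEq.fderiv_eq ?_
  filter_upwards [φ.open_target.mem_nhds (φ.map_source hq)] with y hy
  rw [localRep_of_mem ψ hy]

theorem localRep_eventuallyEq_zero (ψ : sect E n (dom φ)) {q : Q} (hq : q ∈ φ.source)
    (h : q ∉ tsupport ψ.1) : localRep φ s ψ =ᶠ[𝓝 (φ q)] 0 := by
  have h1 : {r | r ∉ tsupport ψ.1} ∈ 𝓝 q := (isClosed_tsupport ψ.1).isOpen_compl.mem_nhds h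
  have h2 := φ.tendsto_symm hq
  filter_upwards [φ.open_target.mem_nhds (φ.map_source hq), h2 h1] with y hy hy'
  rw [localRep_of_mem ψ hy]
  exact coeff_eq_zero (image_eq_zero_of_notMem_tsupport hy')

theorem pderiv_eq_zero (l : Fin d) (ψ : sect E n (dom φ)) {q : Q} (h : q ∉ tsupport ψ.1) :
    pderiv φ s l ψ.1 q = 0 := by
  by_cases hq : q ∈ φ.source
  · rw [pderiv_eq l ψ hq, (localRep_eventuallyEq_zero ψ hq h).fderiv_eq]
    ext i j
    simp [Matrix.vecMulVec_apply]
  · exact if_neg hq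

theorem tsupport_pderiv_subset (l : Fin d) (ψ : sect E n (dom φ)) :
    tsupport (pderiv φ s l ψ.1) ⊆ tsupport ψ.1 :=
  closure_minimal (fun _ hq => by_contra fun h => hq (pderiv_eq_zero l ψ h)) isClosed_closure

theorem smoothOn_pderiv (hφ : φ ∈ IsManifold.maximalAtlas (𝓡 d) ∞ Q) (hs : IsFrame E φ s)
    (l : Fin d) (ψ : sect E n (dom φ)) : SmoothOn d Set.univ (pderiv φ s l ψ.1) := by
  have h1 : SmoothOn d φ.source (pderiv φ s l ψ.1) := by
    refine SmoothOn.congr (a := fun q => Matrix.vecMulVec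
      (fderiv ℝ (localRep φ s ψ) (φ q) (EuclideanSpace.single l 1)) (s q)) ?_
      fun _ hq => pderiv_eq l ψ hq
    intro i j
    have h2 : ContDiff ℝ ∞ (fun y => fderiv ℝ (localRep φ s ψ) y (EuclideanSpace.single l 1) i) :=
      contDiff_pi.1 (((contDiff_localRep hφ hs ψ).fderiv_right (by simp)).clm_apply contDiff_const) i
    exact contMDiffOn_complex_mul
      (h2.contMDiff.comp_contMDiffOn (contMDiffOn_of_mem_maximalAtlas hφ)) (hs.smooth j)
  intro i j
  rw [contMDiffOn_univ]
  refine contMDiff_of_tsupport fun q hq => ?_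
  have hq' : q ∈ φ.source := sect_tsupport_subset ψ (tsupport_pderiv_subset l ψ
    (tsupport_subset_tsupport (f := pderiv φ s l ψ.1) (fun r hr => by rw [hr]; rfl) hq))
  exact (h1 i j).contMDiffAt (φ.open_source.mem_nhds hq')

/-- The momentum operator `-i ∂_l` on `𝓓(V)` for a chart domain `V`. -/
noncomputable def momOp (hφ : φ ∈ IsManifold.maximalAtlas (𝓡 d) ∞ Q) (hs : IsFrame E φ s)
    (l : Fin d) : Module.End ℂ (sect E n (dom φ)) :=
  (-Complex.I) •
  { toFun := fun ψ => ⟨pderiv φ s l ψ.1, smoothOn_pderiv hφ hs l ψ,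
      (sect_hasCompactSupport ψ).of_isClosed_subset isClosed_closure (tsupport_pderiv_subset l ψ),
      (tsupport_pderiv_subset l ψ).trans (sect_tsupport_subset ψ), fun q => by
        by_cases hq : q ∈ φ.source
        · rw [pderiv_eq l ψ hq, Matrix.vecMulVec_mul, hs.mem_fibre q hq]
        · rw [pderiv, if_neg hq, Matrix.zero_mul]⟩
    map_add' := fun ψ χ => sect_ext fun q => by
      change pderiv φ s l (ψ + χ).1 q = pderiv φ s l ψ.1 q + pderiv φ s l χ.1 q
      by_cases hq : q ∈ φ.source
      · rw [pderiv_eq l _ hq, pderiv_eq l _ hq, pderiv_eq l _ hq, map_add,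
          fderiv_add (differentiable_localRep hφ hs ψ _) (differentiable_localRep hφ hs χ _),
          _root_.add_apply, Matrix.add_vecMulVec]
      · simp [pderiv, hq]
    map_smul' := fun t ψ => sect_ext fun q => by
      change pderiv φ s l (t • ψ).1 q = t • pderiv φ s l ψ.1 q
      by_cases hq : q ∈ φ.source
      · rw [pderiv_eq l _ hq, pderiv_eq l _ hq, map_smul,
          fderiv_const_smul (differentiable_localRep hφ hs ψ _),
          _root_.smul_apply, Matrix.smul_vecMulVec]
      · simp [pderiv, hq] }

variable (hφ : φ ∈ IsManifold.maximalAtlas (𝓡 d) ∞ Q) (hs : IsFrame E φ s)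

theorem momOp_apply (l : Fin d) (ψ : sect E n (dom φ)) (q : Q) :
    (momOp hφ hs l ψ).1 q = (-Complex.I) • pderiv φ s l ψ.1 q := rfl

theorem momOp_rep_const (l : Fin d) (T : Matrix (Fin n) (Fin n) ℂ) :
    momOp hφ hs l * rep E (dom φ) (constFun d (dom φ) T)
      = rep E (dom φ) (constFun d (dom φ) T) * momOp hφ hs l := by
  refine LinearMap.ext fun ψ => sect_ext fun q => ?_
  rw [Module.End.mul_apply, Module.End.mul_apply, rep_apply, momOp_apply, momOp_apply,
    Matrix.mul_smul]
  congr 1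
  by_cases hq : q ∈ φ.source
  · rw [pderiv_eq l _ hq, pderiv_eq l _ hq]
    have hT : (constFun d (dom φ) T).1 q = T := rfl
    rw [hT, Matrix.mul_vecMulVec]
    congr 1
    have h1 : localRep φ s (rep E (dom φ) (constFun d (dom φ) T) ψ)
        = fun y => ((Matrix.mulVecLin T).restrictScalars ℝ).toContinuousLinearMap
          (localRep φ s ψ y) := funext fun y => localRep_rep _ ψ y
    have h2 := (((Matrix.mulVecLin T).restrictScalars ℝ).toContinuousLinearMap).hasFDerivAt.comp
      (φ q) (differentiable_localRep hφ hs ψ (φ q)).hasFDerivAt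
    rw [h1]
    erw [h2.fderiv]
    rfl
  · simp [pderiv, hq]

/-- The canonical commutation relations, by the Leibniz rule for `x^k f`. -/
theorem scal_momOp_commutator {x : Fin d → C^∞⟮𝓡 d, Q; 𝓘(ℝ, ℝ), ℝ⟯}
    (hx : ∀ q ∈ φ.source, ∀ k, x k q = φ q k) (k l : Fin d) :
    scal E (dom φ) (x k) * momOp hφ hs l - momOp hφ hs l * scal E (dom φ) (x k)
      = (if l = k then Complex.I else 0) • (1 : Module.End ℂ (sect E n (dom φ))) := by
  refine LinearMap.ext fun ψ => sect_ext fun q => ?_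
  change (scal E (dom φ) (x k) (momOp hφ hs l ψ)).1 q - (momOp hφ hs l (scal E (dom φ) (x k) ψ)).1 q
    = (if l = k then Complex.I else 0) • ψ.1 q
  rw [scal_apply, momOp_apply, momOp_apply]
  by_cases hq : q ∈ φ.source
  · rw [pderiv_eq l _ hq, pderiv_eq l _ hq, ← vecMulVec_localRep hs ψ hq, hx q hq]
    have h1 : localRep φ s (scal E (dom φ) (x k) ψ) = fun y => y k • localRep φ s ψ y :=
      funext fun y => localRep_scal hx k ψ y
    have hk : HasFDerivAt (fun y : EuclideanSpace ℝ (Fin d) => y k)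
        (EuclideanSpace.proj k : EuclideanSpace ℝ (Fin d) →L[ℝ] ℝ) (φ q) :=
      (EuclideanSpace.proj k : EuclideanSpace ℝ (Fin d) →L[ℝ] ℝ).hasFDerivAt
    have h2 := hk.smul (differentiable_localRep hφ hs ψ (φ q)).hasFDerivAt
    rw [h1]
    erw [h2.fderiv]
    ext i j
    by_cases hlk : l = k <;>
      simp [Matrix.vecMulVec_apply, hlk, eq_comm] <;> ring
  · simp [pderiv, hq, sect_eq_zero_of_notMem ψ (show q ∉ dom φ from hq)]

theorem localRep_momOp (l : Fin d) (ψ : sect E n (dom φ)) (y : EuclideanSpace ℝ (Fin d)) :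
    localRep φ s (momOp hφ hs l ψ) y
      = (-Complex.I) • fderiv ℝ (localRep φ s ψ) y (EuclideanSpace.single l 1) := by
  by_cases hy : y ∈ φ.target
  · have hq := φ.map_target hy
    have h1 := vecMulVec_localRep hs (momOp hφ hs l ψ) hq
    rw [momOp_apply, pderiv_eq l ψ hq, φ.right_inv hy, ← Matrix.smul_vecMulVec] at h1
    obtain ⟨j, hj⟩ := Function.ne_iff.1 (hs.ne_zero _ hq)
    funext i
    have h2 := congrFun (congrFun h1 i) j
    rw [Matrix.vecMulVec_apply, Matrix.vecMulVec_apply] at h2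
    exact mul_right_cancel₀ hj h2
  · rw [localRep_of_notMem _ hy]
    -- Outside `φ.target` the derivative must vanish as well. The closed support of `localRep φ s ψ`
    -- lies in the compact image of the support of the component, which stays inside `φ.target`.
    have hsupp : y ∉ tsupport (localRep φ s ψ) := by
      intro h
      have hK := ((hasCompactSupport_coeff (s := s) ψ).isCompact.image_of_continuousOn
        (φ.continuousOn.mono (tsupport_coeff_sect_subset ψ))).isClosed
      have := closure_minimal (support_indicator_comp_symm_subset.trans
        (Set.image_mono Set.inter_subset_left)) hK h
      obtain ⟨q, hq, rfl⟩ := this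
      exact hy (φ.map_source (tsupport_coeff_sect_subset ψ hq))
    have h0 : localRep φ s ψ =ᶠ[𝓝 y] 0 := notMem_tsupport_iff_eventuallyEq.1 hsupp
    rw [h0.fderiv_eq]
    simp

end Momentum

/-! ### Hermiticity of the momentum operators -/

section MomentumHermitian

open MeasureTheory

variable {d N n : ℕ} {Q : Type*} [TopologicalSpace Q] [T2Space Q]
  [ChartedSpace (EuclideanSpace ℝ (Fin d)) Q] [IsManifold (𝓡 d) ∞ Q]
  {E : LineBundle d Q N} {φ : OpenPartialHomeomorph Q (EuclideanSpace ℝ (Fin d))}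
  {s : Q → Fin N → ℂ} [MeasurableSpace Q] [BorelSpace Q] {μ : Measure Q}

theorem IsAdaptedFrame.isFrame (h : IsAdaptedFrame E μ φ s) : IsFrame E φ s :=
  ⟨h.smooth, h.mem_fibre, h.ne_zero⟩

theorem IsFrame.continuousOn_sum_norm_sq (h : IsFrame E φ s) :
    ContinuousOn (fun q => ∑ m, ‖s q m‖ ^ 2) φ.source :=
  continuousOn_finsetSum _ fun m _ => (h.smooth m).continuousOn.norm.pow 2

/-- The normalization `|s|² dμ = dx` as an equality of measures on `Q`, the form needed for a change
of variables. -/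
theorem IsAdaptedFrame.withDensity_eq_map (h : IsAdaptedFrame E μ φ s) :
    (μ.restrict φ.source).withDensity (fun q => ENNReal.ofReal (∑ m, ‖s q m‖ ^ 2))
      = Measure.map φ.symm (volume.restrict φ.target) := by
  have hsymm : AEMeasurable φ.symm (volume.restrict φ.target) :=
    φ.continuousOn_symm.aemeasurable φ.open_target.measurableSet
  ext B hB
  rw [withDensity_apply _ hB, Measure.restrict_restrict hB, Measure.map_apply_of_aemeasurable hsymm hB,
    h.density _ Set.inter_subset_right (hB.inter φ.open_source.measurableSet),
    Measure.restrict_apply₀' φ.open_target.measurableSet.nullMeasurableSet]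
  congr 1
  rw [Set.inter_comm, φ.image_source_inter_eq', Set.inter_comm]

theorem trace_vecMulVec_mul (f g : Fin n → ℂ) (v : Fin N → ℂ) :
    ((Matrix.vecMulVec f v)ᴴ * Matrix.vecMulVec g v).trace
      = (∑ m, ‖v m‖ ^ 2 : ℝ) • ∑ i, star (f i) * g i := by
  rw [trace_conjTranspose_mul_eq, Finset.sum_smul]
  refine Finset.sum_congr rfl fun m _ => ?_
  rw [Finset.smul_sum]
  refine Finset.sum_congr rfl fun i _ => ?_
  rw [Matrix.vecMulVec_apply, Matrix.vecMulVec_apply, star_mul', Complex.real_smul]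
  push_cast
  rw [← Complex.mul_conj']
  simp only [RCLike.star_def]
  ring

/-- In an adapted frame, the scalar product is that of `L²(dx)`. -/
theorem innerL2_eq_integral_localRep
    (h : IsAdaptedFrame E μ φ s) (ψ χ : sect E n (dom φ)) :
    innerL2 μ ψ.1 χ.1 = ∫ y, ∑ i, star (localRep φ s ψ y i) * localRep φ s χ y i := by
  have hcont : ∀ ξ : sect E n (dom φ), Continuous (coeff s ξ.1) := fun ξ =>
    continuous_iff_continuousAt.2 fun q => by
      by_cases hq : q ∈ tsupport ξ.1
      · exact (contMDiffOn_coeff h.isFrame ((sect_smooth ξ).mono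
          (Set.subset_univ _))).continuousOn.continuousAt
          (φ.open_source.mem_nhds (sect_tsupport_subset ξ hq))
      · have : coeff s ξ.1 =ᶠ[𝓝 q] 0 := notMem_tsupport_iff_eventuallyEq.1
          fun hh => hq (tsupport_coeff_subset _ hh)
        exact continuousAt_const.congr this.symm
  have hG : Continuous (fun q => ∑ i, star (coeff s ψ.1 q i) * coeff s χ.1 q i) :=
    continuous_finsetSum _ fun i _ => (((continuous_apply i).comp (hcont ψ)).star).mul
      ((continuous_apply i).comp (hcont χ))
  have hsymm : AEMeasurable φ.symm (volume.restrict φ.target) :=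
    φ.continuousOn_symm.aemeasurable φ.open_target.measurableSet
  have hdens : AEMeasurable (fun q => ENNReal.ofReal (∑ m, ‖s q m‖ ^ 2)) (μ.restrict φ.source) :=
    (h.isFrame.continuousOn_sum_norm_sq.aemeasurable φ.open_source.measurableSet).ennreal_ofReal
  have e1 : innerL2 μ ψ.1 χ.1 = ∫ q in φ.source,
      (ENNReal.ofReal (∑ m, ‖s q m‖ ^ 2)).toReal
        • ∑ i, star (coeff s ψ.1 q i) * coeff s χ.1 q i ∂μ := by
    unfold innerL2
    rw [← setIntegral_eq_integral_of_forall_compl_eq_zero (s := φ.source)]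
    · refine setIntegral_congr_fun φ.open_source.measurableSet fun q hq => ?_
      rw [ENNReal.toReal_ofReal (by positivity), ← trace_vecMulVec_mul,
        ← localRep_apply ψ hq, ← localRep_apply χ hq, vecMulVec_localRep h.isFrame ψ hq,
        vecMulVec_localRep h.isFrame χ hq]
    · intro q hq
      rw [sect_eq_zero_of_notMem χ (show q ∉ dom φ from hq), Matrix.mul_zero, Matrix.trace_zero]
  rw [e1, ← integral_withDensity_eq_integral_toReal_smul₀ hdens
    (Filter.Eventually.of_forall fun _ => ENNReal.ofReal_lt_top), h.withDensity_eq_map,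
    integral_map hsymm hG.aestronglyMeasurable, ← integral_indicator φ.open_target.measurableSet]
  refine integral_congr_ae (Filter.Eventually.of_forall fun y => ?_)
  by_cases hy : y ∈ φ.target
  · simp only [Set.indicator_of_mem hy, localRep_of_mem _ hy]
  · simp only [Set.indicator_of_notMem hy, localRep_of_notMem _ hy]
    simp

/-- Integration by parts, without boundary terms as `f` has compact support; its sign cancels
against the conjugation of `-i`. -/
theorem integral_star_mul_fderiv {f g : EuclideanSpace ℝ (Fin d) → ℂ} (hf : ContDiff ℝ ∞ f)
    (hg : ContDiff ℝ ∞ g) (hfc : HasCompactSupport f) (v : EuclideanSpace ℝ (Fin d)) :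
    ∫ y, star (-Complex.I * fderiv ℝ f y v) * g y
      = ∫ y, star (f y) * (-Complex.I * fderiv ℝ g y v) := by
  have hsf : ContDiff ℝ ∞ (fun y => star (f y)) := Complex.conjCLE.contDiff.comp hf
  have hfd := hf.differentiable (by simp)
  have hgd := hg.differentiable (by simp)
  have hder : ∀ y, fderiv ℝ (fun y => star (f y)) y v = star (fderiv ℝ f y v) := by
    intro y
    have := (Complex.conjCLE.toContinuousLinearMap.hasFDerivAt (x := f y)).comp y (hfd y).hasFDerivAt
    have h2 : HasFDerivAt (fun y => star (f y)) _ y := this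
    rw [h2.fderiv]
    rfl
  have hsc : HasCompactSupport (fun y => star (f y)) :=
    hfc.of_isClosed_subset isClosed_closure (tsupport_subset_tsupport fun y h => by simp [h])
  have hcf : Continuous (fun y => fderiv ℝ (fun y => star (f y)) y v) :=
    (hsf.continuous_fderiv (by simp)).clm_apply continuous_const
  have hcg : Continuous (fun y => fderiv ℝ g y v) :=
    (hg.continuous_fderiv (by simp)).clm_apply continuous_const
  have key := integral_mul_fderiv_eq_neg_fderiv_mul_of_integrable (𝕜 := ℂ)
    (μ := (volume : Measure (EuclideanSpace ℝ (Fin d))))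
    (f := fun y => star (f y)) (g := g) (v := v)
    ((hcf.mul hg.continuous).integrable_of_hasCompactSupport
      (hsc.fderiv_apply ℝ v).mul_right)
    ((hsf.continuous.mul hcg).integrable_of_hasCompactSupport hsc.mul_right)
    ((hsf.continuous.mul hg.continuous).integrable_of_hasCompactSupport hsc.mul_right)
    (fun y _ => hsf.differentiable (by simp) y) (fun y _ => hgd y)
  have e1 : ∀ y, star (-Complex.I * fderiv ℝ f y v) * g y
      = Complex.I * (fderiv ℝ (fun y => star (f y)) y v * g y) := by
    intro y
    rw [hder, star_mul']
    simp [mul_assoc]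
  have e2 : ∀ y, star (f y) * (-Complex.I * fderiv ℝ g y v)
      = -Complex.I * (star (f y) * fderiv ℝ g y v) := fun y => by ring
  simp_rw [e1, e2, integral_const_mul]
  rw [key]
  ring

/-- In an adapted frame the scalar product is that of Lebesgue measure, so `-i ∂_l` is symmetric
without a divergence correction. -/
theorem isAdj_momOp (hφ : φ ∈ IsManifold.maximalAtlas (𝓡 d) ∞ Q)
    (h : IsAdaptedFrame E μ φ s) (l : Fin d) :
    IsAdj (n := n) μ (momOp hφ h.isFrame l) (momOp hφ h.isFrame l) := by
  intro ψ χ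
  rw [innerL2_eq_integral_localRep h, innerL2_eq_integral_localRep h]
  have hcd : ∀ (ξ : sect E n (dom φ)) i, ContDiff ℝ ∞ (fun y => localRep φ s ξ y i) := fun ξ i =>
    contDiff_pi.1 (contDiff_localRep hφ h.isFrame ξ) i
  have hcs : ∀ (ξ : sect E n (dom φ)) i, HasCompactSupport (fun y => localRep φ s ξ y i) :=
    fun ξ i => (hasCompactSupport_localRep ξ).of_isClosed_subset isClosed_closure
      (tsupport_subset_tsupport (f := localRep φ s ξ) fun y hy => by rw [hy]; rfl)
  have hint : ∀ (ξ η : sect E n (dom φ)) i,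
      Integrable (fun y => star (localRep φ s ξ y i) * localRep φ s η y i) := fun ξ η i =>
    ((hcd ξ i).continuous.star.mul (hcd η i).continuous).integrable_of_hasCompactSupport
      (hcs η i).mul_left
  rw [integral_finsetSum _ fun i _ => hint _ _ i, integral_finsetSum _ fun i _ => hint _ _ i]
  refine Finset.sum_congr rfl fun i _ => ?_
  have hcomp : ∀ (ξ : sect E n (dom φ)) y, localRep φ s (momOp hφ h.isFrame l ξ) y i
      = -Complex.I * fderiv ℝ (fun y => localRep φ s ξ y i) y (EuclideanSpace.single l 1) := by
    intro ξ y
    rw [localRep_momOp, Pi.smul_apply, smul_eq_mul,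
      fderiv_apply (differentiable_localRep hφ h.isFrame ξ y) i]
    rfl
  simp_rw [hcomp]
  exact integral_star_mul_fderiv (hcd ψ i) (hcd χ i) (hcs ψ i) _

end MomentumHermitian

/-! ### Commutators of symmetrized products in a complex algebra -/

section AbstractAlgebra

variable {R : Type*} [Ring R] [Algebra ℂ R] {ι : Type*} [Fintype ι]

/-- The symmetrized product `½ ∑ (G_l p_l + p_l G_l)`. -/
noncomputable def symProd (G p : ι → R) : R := (1 / 2 : ℂ) • ∑ l, (G l * p l + p l * G l)

/-- The derivation `[x, ·]` kills each `G l` and sends `p l` to `i δ_{lm}`; the two orderings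
contribute equally, which absorbs the factor one half. -/
theorem commutator_symProd [DecidableEq ι] {x : R} {G p : ι → R} {m : ι}
    (hp : ∀ l, x * p l - p l * x = (if l = m then Complex.I else 0) • (1 : R))
    (hG : ∀ l, x * G l = G l * x) :
    x * symProd G p - symProd G p * x = Complex.I • G m := by
  have h1 : ∀ l, x * (G l * p l + p l * G l) - (G l * p l + p l * G l) * x
      = (2 : ℂ) • (if l = m then Complex.I else 0) • G l := by
    intro l
    have : x * (G l * p l + p l * G l) - (G l * p l + p l * G l) * x
        = (x * G l - G l * x) * p l + p l * (x * G l - G l * x)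
          + G l * (x * p l - p l * x) + (x * p l - p l * x) * G l := by noncomm_ring
    rw [this, hG, sub_self, hp, zero_mul, mul_zero, two_smul]
    simp
  rw [symProd, mul_smul_comm, smul_mul_assoc, ← smul_sub, Finset.mul_sum, Finset.sum_mul,
    ← Finset.sum_sub_distrib, Finset.sum_congr rfl fun l _ => h1 l, ← Finset.smul_sum, smul_smul]
  simp [ite_smul]

theorem symProd_sub {G p A : ι → R} (hGA : ∀ l, G l * A l = A l * G l) :
    symProd G (fun l => p l - A l) = symProd G p - ∑ l, G l * A l := by
  have h1 : ∀ l, G l * (p l - A l) + (p l - A l) * G l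
      = (G l * p l + p l * G l) - (2 : ℂ) • (G l * A l) := by
    intro l
    rw [mul_sub, sub_mul, ← hGA, two_smul]
    abel
  rw [symProd, Finset.sum_congr rfl fun l _ => h1 l, Finset.sum_sub_distrib, smul_sub,
    ← Finset.smul_sum, smul_smul]
  simp [symProd]

theorem symProd_commutator {G p A : ι → R} {t : R} (hGA : ∀ l, G l * A l = A l * G l)
    (hp : ∀ l, p l * t = t * p l) (hG : ∀ l, G l * t = t * G l) :
    symProd G (fun l => p l - A l) * t - t * symProd G (fun l => p l - A l)
      = -∑ l, G l * (A l * t - t * A l) := by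
  have h0 : symProd G p * t = t * symProd G p := by
    rw [symProd, smul_mul_assoc, mul_smul_comm, Finset.sum_mul, Finset.mul_sum]
    congr 1
    refine Finset.sum_congr rfl fun l _ => ?_
    rw [add_mul, mul_add, mul_assoc, mul_assoc, hp, hG, ← mul_assoc, ← mul_assoc, hp, hG,
      mul_assoc, mul_assoc]
  have h1 : ∀ l, G l * (A l * t - t * A l) = G l * A l * t - t * (G l * A l) := by
    intro l
    rw [mul_sub, ← mul_assoc, ← mul_assoc, hG, mul_assoc t]
  rw [symProd_sub hGA, sub_mul, mul_sub, h0, Finset.sum_congr rfl fun l _ => h1 l,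
    Finset.sum_sub_distrib, ← Finset.sum_mul, ← Finset.mul_sum]
  abel

/-- Differentiating `[x, t] = 0` in time gives `[x, ṫ] = -[ẋ, t]`. -/
theorem commutator_velocity {h x t r : R} (hxt : x * t = t * x)
    (hr : (Complex.I • (h * x - x * h)) * t - t * (Complex.I • (h * x - x * h)) = -r) :
    x * (Complex.I • (h * t - t * h)) - (Complex.I • (h * t - t * h)) * x = r := by
  have : x * (h * t - t * h) - (h * t - t * h) * x + ((h * x - x * h) * t - t * (h * x - x * h))
      = h * (x * t - t * x) - (x * t - t * x) * h := by noncomm_ring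
  rw [hxt, sub_self, mul_zero, zero_mul, sub_self] at this
  rw [smul_mul_assoc, mul_smul_comm, ← smul_sub] at hr
  rw [mul_smul_comm, smul_mul_assoc, ← smul_sub, eq_neg_of_add_eq_zero_left this, smul_neg, hr,
    neg_neg]

theorem commutator_smul_velocity {h x y g : R}
    (hg : x * (h * y - y * h) - (h * y - y * h) * x = g) :
    x * (Complex.I • (h * y - y * h)) - (Complex.I • (h * y - y * h)) * x = Complex.I • g := by
  rw [mul_smul_comm, smul_mul_assoc, ← smul_sub, hg]

/-- The commutator of `x` with `P k * B k + B k * P k` is `2i G k * B k`. The prefactor `i/2` turns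
it into `-G k * B k`, cancelling the commutator of `x` with `S`. -/
theorem commute_add_symm {x S : R} {P B G : ι → R} (hS : x * S - S * x = ∑ l, G l * B l)
    (hP : ∀ k, x * P k - P k * x = Complex.I • G k) (hB : ∀ k, x * B k = B k * x)
    (hGB : ∀ k, G k * B k = B k * G k) :
    (S + (Complex.I / 2) • ∑ k, (P k * B k + B k * P k)) * x
      = x * (S + (Complex.I / 2) • ∑ k, (P k * B k + B k * P k)) := by
  have h1 : ∀ k, x * (P k * B k + B k * P k) - (P k * B k + B k * P k) * x
      = (2 * Complex.I) • (G k * B k) := by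
    intro k
    have : x * (P k * B k + B k * P k) - (P k * B k + B k * P k) * x
        = (x * P k - P k * x) * B k + B k * (x * P k - P k * x)
          + P k * (x * B k - B k * x) + (x * B k - B k * x) * P k := by noncomm_ring
    rw [this, hB, sub_self, hP, zero_mul, mul_zero, mul_smul, two_smul, smul_mul_assoc,
      mul_smul_comm, ← hGB]
    simp
  rw [eq_comm, ← sub_eq_zero, mul_add, add_mul, add_sub_add_comm, hS, mul_smul_comm,
    smul_mul_assoc, ← smul_sub, Finset.mul_sum, Finset.sum_mul, ← Finset.sum_sub_distrib,
    Finset.sum_congr rfl fun k _ => h1 k, ← Finset.smul_sum, smul_smul]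
  have : Complex.I / 2 * (2 * Complex.I) = -1 := by
    rw [show Complex.I / 2 * (2 * Complex.I) = Complex.I * Complex.I by ring, Complex.I_mul_I]
  rw [this]
  simp

/-- The cancellation for a single ordering: the commutator is now `i G k * B k`, so the prefactor is
`i` instead of `i/2`. -/
theorem commute_add_right {x S : R} {P B G : ι → R} (hS : x * S - S * x = ∑ l, G l * B l)
    (hP : ∀ k, x * P k - P k * x = Complex.I • G k) (hB : ∀ k, x * B k = B k * x) :
    (S + Complex.I • ∑ k, P k * B k) * x = x * (S + Complex.I • ∑ k, P k * B k) := by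
  have h1 : ∀ k, x * (P k * B k) - (P k * B k) * x = Complex.I • (G k * B k) := by
    intro k
    have : x * (P k * B k) - (P k * B k) * x
        = (x * P k - P k * x) * B k + P k * (x * B k - B k * x) := by noncomm_ring
    rw [this, hB, sub_self, hP, mul_zero, smul_mul_assoc, add_zero]
  rw [eq_comm, ← sub_eq_zero, mul_add, add_mul, add_sub_add_comm, hS, mul_smul_comm,
    smul_mul_assoc, ← smul_sub, Finset.mul_sum, Finset.sum_mul, ← Finset.sum_sub_distrib,
    Finset.sum_congr rfl fun k _ => h1 k, ← Finset.smul_sum, smul_smul, Complex.I_mul_I]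
  simp

theorem commute_sub {x S S' : R} (h : x * S - S * x = x * S' - S' * x) :
    (S - S') * x = x * (S - S') := by
  have : x * (S - S') - (S - S') * x = (x * S - S * x) - (x * S' - S' * x) := by noncomm_ring
  rw [eq_comm, ← sub_eq_zero, this, h, sub_self]

theorem star_I_smul_sub (a b : R) : star Complex.I • (a - b) = Complex.I • (b - a) := by
  rw [show star Complex.I = -Complex.I from Complex.conj_I, neg_smul, ← smul_neg, neg_sub]

/-- Taking adjoints exchanges the two orderings. The sign from conjugating `i/2` cancels the sign
from the antihermitian `B k`, whose adjoint is `C k`. -/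
theorem star_smul_symm (P B C : ι → R) (h : ∀ k, C k = -B k) :
    star (Complex.I / 2) • ∑ k, (C k * P k + P k * C k)
      = (Complex.I / 2) • ∑ k, (P k * B k + B k * P k) := by
  have : star (Complex.I / 2) = -(Complex.I / 2) := by simp [neg_div]
  rw [this, neg_smul, ← smul_neg, ← Finset.sum_neg_distrib]
  congr 1
  refine Finset.sum_congr rfl fun k _ => ?_
  rw [h]
  noncomm_ring

/-- The left side is `[x, [h, y]]` with all products reversed, that is, its formal adjoint when `x`,
`y`, `h` are symmetric. -/
theorem commutator_adj_eq (x y h : R) :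
    (y * h - h * y) * x - x * (y * h - h * y) = x * (h * y - y * h) - (h * y - y * h) * x := by
  noncomm_ring

end AbstractAlgebra

/-! ### Real functions as operators -/

section Assembly

open MeasureTheory

variable {d N n : ℕ} {Q : Type*} [TopologicalSpace Q] [T2Space Q] [SigmaCompactSpace Q]
  [ChartedSpace (EuclideanSpace ℝ (Fin d)) Q] [IsManifold (𝓡 d) ∞ Q]
  {E : LineBundle d Q N} {W : TopologicalSpace.Opens Q} {H : Module.End ℂ (sect E n ⊤)}
  {φ : OpenPartialHomeomorph Q (EuclideanSpace ℝ (Fin d))} {s : Q → Fin N → ℂ}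

/-- A real function that is smooth on `W`, as a scalar matrix-valued function. -/
def realFun (n : ℕ) (W : TopologicalSpace.Opens Q) (f : Q → ℝ)
    (hf : ContMDiffOn (𝓡 d) 𝓘(ℝ, ℝ) ∞ f W) : smoothFun d n W :=
  ⟨fun q => (f q : ℂ) • (1 : Matrix (Fin n) (Fin n) ℂ),
    SmoothOn.fun_smul (contMDiffOn_ofReal hf) (smoothOn_const 1)⟩

theorem realFun_mul_comm {f : Q → ℝ} (hf : ContMDiffOn (𝓡 d) 𝓘(ℝ, ℝ) ∞ f W)
    (a : smoothFun d n W) : realFun n W f hf * a = a * realFun n W f hf := by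
  refine Subtype.ext (funext fun q => ?_)
  change ((f q : ℂ) • (1 : Matrix (Fin n) (Fin n) ℂ)) * a.1 q
    = a.1 q * ((f q : ℂ) • (1 : Matrix (Fin n) (Fin n) ℂ))
  simp

theorem rep_realFun_mul_comm {f : Q → ℝ} (hf : ContMDiffOn (𝓡 d) 𝓘(ℝ, ℝ) ∞ f W)
    (a : smoothFun d n W) :
    rep E W (realFun n W f hf) * rep E W a = rep E W a * rep E W (realFun n W f hf) := by
  rw [← map_mul, ← map_mul, realFun_mul_comm]

theorem scal_mul_rep_comm (f : C^∞⟮𝓡 d, Q; 𝓘(ℝ, ℝ), ℝ⟯) (a : smoothFun d n W) :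
    scal E W f * rep E W a = rep E W a * scal E W f :=
  rep_realFun_mul_comm (f := f) f.contMDiff.contMDiffOn a

theorem rep_congr {a b : smoothFun d n W} (h : ∀ q ∈ W, a.1 q = b.1 q) :
    rep E W a = rep E W b := by
  refine LinearMap.ext fun ψ => sect_ext fun q => ?_
  by_cases hq : q ∈ W
  · rw [rep_apply, rep_apply, h q hq]
  · rw [sect_eq_zero_of_notMem _ hq, sect_eq_zero_of_notMem _ hq]

section Adj

variable [MeasurableSpace Q] [BorelSpace Q] {μ : Measure Q}

theorem isAdj_rep_realFun {f : Q → ℝ} (hf : ContMDiffOn (𝓡 d) 𝓘(ℝ, ℝ) ∞ f W) :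
    IsAdj μ (rep E W (realFun n W f hf)) (rep E W (realFun n W f hf)) :=
  isAdj_rep fun q _ => by
    change (f q : ℂ) • (1 : Matrix (Fin n) (Fin n) ℂ) = ((f q : ℂ) • (1 : Matrix (Fin n) (Fin n) ℂ))ᴴ
    simp [Matrix.conjTranspose_smul]

theorem isAdj_scal (f : C^∞⟮𝓡 d, Q; 𝓘(ℝ, ℝ), ℝ⟯) :
    IsAdj (n := n) μ (scal E W f) (scal E W f) :=
  isAdj_rep_realFun (f := f) f.contMDiff.contMDiffOn

theorem isAdj_velocity [IsFiniteMeasureOnCompacts μ] {h t : Module.End ℂ (sect E n W)}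
    (hh : IsAdj μ h h) (ht : IsAdj μ t t) :
    IsAdj μ (Complex.I • (h * t - t * h)) (Complex.I • (h * t - t * h)) := by
  have := ((hh.mul ht).sub (ht.mul hh)).smul Complex.I
  have e := star_I_smul_sub (R := Module.End ℂ (sect E n W)) (t * h) (h * t)
  rwa [e] at this

end Adj

end Assembly

/-! ### The metric `g^{kl}` -/

section Metric

open MeasureTheory

variable {d N n : ℕ} {Q : Type*} [TopologicalSpace Q] [T2Space Q] [SigmaCompactSpace Q]
  [ChartedSpace (EuclideanSpace ℝ (Fin d)) Q] [IsManifold (𝓡 d) ∞ Q]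
  {E : LineBundle d Q N} {W : TopologicalSpace.Opens Q} {H : Module.End ℂ (sect E n ⊤)}
  [MeasurableSpace Q] [BorelSpace Q] {μ : Measure Q}

/-- A central matrix is scalar, and hermiticity makes the scalar real. Writing it as a normalized
trace makes its smooth dependence on `c` evident; for `n = 0` all matrices coincide. -/
theorem eq_re_trace_smul_one {c : Matrix (Fin n) (Fin n) ℂ} (hc : ∀ T, c * T = T * c)
    (hh : c.IsHermitian) : c = (((c.trace / n).re : ℝ) : ℂ) • (1 : Matrix (Fin n) (Fin n) ℂ) := by
  rcases Nat.eq_zero_or_pos n with rfl | hn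
  · exact Subsingleton.elim _ _
  obtain ⟨α, rfl⟩ := Matrix.mem_range_scalar_of_commute_single (M := c)
    fun i j _ => (hc _).symm
  have hn' : (n : ℂ) ≠ 0 := by exact_mod_cast hn.ne'
  have htr : (Matrix.scalar (Fin n) α).trace / n = α := by
    rw [Matrix.scalar_apply, Matrix.trace_diagonal]
    simp [hn']
  have hα : star α = α := by
    have := congrFun (congrFun hh ⟨0, hn⟩) ⟨0, hn⟩
    simpa [Matrix.conjTranspose_apply] using this
  have hre : ((α.re : ℝ) : ℂ) = α := Complex.conj_eq_iff_re.1 hα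
  rw [htr, hre, Matrix.scalar_apply, Matrix.smul_one_eq_diagonal]

theorem exists_metric [IsFiniteMeasureOnCompacts μ] [μ.IsOpenPosMeasure] (hH : IsHermOp E μ H)
    (hU : NCUncertainty E H) (W : TopologicalSpace.Opens Q)
    (x : Fin d → C^∞⟮𝓡 d, Q; 𝓘(ℝ, ℝ), ℝ⟯) :
    ∃ (g : Q → Matrix (Fin d) (Fin d) ℝ)
      (hg : ∀ k l, ContMDiffOn (𝓡 d) 𝓘(ℝ, ℝ) ∞ (fun q => g q k l) W),
      (∀ q ∈ W, (g q).IsSymm) ∧ ∀ k l,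
        scal E W (x k) * (restrOp W H (tsupport_apply_subset hU) * scal E W (x l)
          - scal E W (x l) * restrOp W H (tsupport_apply_subset hU))
        - (restrOp W H (tsupport_apply_subset hU) * scal E W (x l)
          - scal E W (x l) * restrOp W H (tsupport_apply_subset hU)) * scal E W (x k)
        = rep E W (realFun n W (fun q => g q k l) (hg k l)) := by
  set h := restrOp W H (tsupport_apply_subset hU) with hh
  have hpt := fun k l => exists_rep_of_isPointwise
    (isPointwise_commutator (W := W) hU (x k) (scalarFun d n (x l)))
  choose c hc using hpt
  have hcD : ∀ k l, scal E W (x k) * (h * scal E W (x l) - scal E W (x l) * h)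
      - (h * scal E W (x l) - scal E W (x l) * h) * scal E W (x k) = rep E W (c k l) := hc
  have hadjh : IsAdj μ h h := fun φ ψ => hH (incl E n W φ) (incl E n W ψ)
  have hherm : ∀ k l, ∀ q ∈ W, ((c k l).1 q).IsHermitian := by
    intro k l q hq
    refine isHermitian_of_isHermOp_rep (μ := μ) (E := E) ?_ hq
    have h1 : IsAdj μ (h * scal E W (x l) - scal E W (x l) * h)
        (scal E W (x l) * h - h * scal E W (x l)) :=
      (hadjh.mul (isAdj_scal (x l))).sub ((isAdj_scal (x l)).mul hadjh)
    have h2 := ((isAdj_scal (μ := μ) (x k)).mul h1).sub (h1.mul (isAdj_scal (x k)))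
    have e := commutator_adj_eq (scal E W (x k)) (scal E W (x l)) h
    rw [e, hcD] at h2
    exact h2
  have hcomm : ∀ k l, ∀ q ∈ W, ∀ T : Matrix (Fin n) (Fin n) ℂ,
      (c k l).1 q * T = T * (c k l).1 q := by
    intro k l q hq T
    -- The extended uncertainty relation applies to the constant `T`, which need not vanish at
    -- infinity: `[x^l, [h, T]]` is a matrix function, so it commutes with `x^k`, and the Jacobi
    -- identity carries this over to `[c, T] = 0`.
    obtain ⟨c', hc'⟩ := exists_rep_of_isPointwise
      (isPointwise_commutator (W := W) hU (x l) (constFun d ⊤ T))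
    have h1 := commutator_comm_of_commute h (scal E W (x k)) (scal E W (x l))
      (rep E W (restrictFun d W (constFun d ⊤ T))) (scal_mul_rep_comm _ _) (scal_mul_rep_comm _ _)
      (by rw [hc']; exact scal_mul_rep_comm _ _)
    rw [hcD, ← map_mul, ← map_mul] at h1
    exact eq_of_rep_eq h1 hq
  have hsm : ∀ k l, ContMDiffOn (𝓡 d) 𝓘(ℝ, ℝ) ∞
      (fun q => (((c k l).1 q).trace / (n : ℂ)).re) W := by
    intro k l
    have h1 : ContMDiffOn (𝓡 d) 𝓘(ℝ, ℂ) ∞ (fun q => ((c k l).1 q).trace * (n : ℂ)⁻¹) W :=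
      contMDiffOn_complex_mul (contMDiffOn_finsetSum fun i _ => (c k l).2 i i) contMDiffOn_const
    exact Complex.reCLM.contDiff.contMDiff.comp_contMDiffOn h1
  refine ⟨fun q => Matrix.of fun k l => (((c k l).1 q).trace / (n : ℂ)).re, hsm, fun q hq => ?_,
    fun k l => ?_⟩
  · ext k l
    have h1 := commutator_symm h (scal E W (x l)) (scal E W (x k)) (scal_mul_rep_comm _ _)
    rw [hcD, hcD] at h1
    change (((c l k).1 q).trace / (n : ℂ)).re = (((c k l).1 q).trace / (n : ℂ)).re
    rw [eq_of_rep_eq h1 hq]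
  · rw [hcD]
    exact rep_congr fun q hq => eq_re_trace_smul_one (hcomm k l q hq) (hherm k l q hq)

end Metric

/-! ### The kinetic velocity as an operator -/

section Kinetic

open MeasureTheory

variable {d N n : ℕ} {Q : Type*} [TopologicalSpace Q] [T2Space Q] [SigmaCompactSpace Q]
  [ChartedSpace (EuclideanSpace ℝ (Fin d)) Q] [IsManifold (𝓡 d) ∞ Q]
  {E : LineBundle d Q N} {φ : OpenPartialHomeomorph Q (EuclideanSpace ℝ (Fin d))}
  {s : Q → Fin N → ℂ}

theorem sect_sum_apply {W : TopologicalSpace.Opens Q} {ι : Type*} (I : Finset ι)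
    (S : ι → Module.End ℂ (sect E n W)) (ψ : sect E n W) (q : Q) :
    ((∑ i ∈ I, S i) ψ).1 q = ∑ i ∈ I, (S i ψ).1 q := by
  rw [LinearMap.sum_apply, AddSubmonoidClass.coe_finsetSum, Finset.sum_apply]

theorem kinVel_eq_symProd (hφ : φ ∈ IsManifold.maximalAtlas (𝓡 d) ∞ Q) (hs : IsFrame E φ s)
    {g : Q → Matrix (Fin d) (Fin d) ℝ}
    (hg : ∀ k l, ContMDiffOn (𝓡 d) 𝓘(ℝ, ℝ) ∞ (fun q => g q k l) (dom φ))
    (A : Fin d → smoothFun d n (dom φ)) (k : Fin d) (ψ : sect E n (dom φ)) (q : Q) :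
    kinVel φ s g (fun l => (A l).1) k ψ.1 q
      = (symProd (fun l => rep E (dom φ) (realFun n (dom φ) (fun q => g q k l) (hg k l)))
          (fun l => momOp hφ hs l - rep E (dom φ) (A l)) ψ).1 q := by
  have hG : ∀ l (χ : sect E n (dom φ)) r,
      (rep E (dom φ) (realFun n (dom φ) (fun q => g q k l) (hg k l)) χ).1 r
        = ((g r k l : ℝ) : ℂ) • χ.1 r := by
    intro l χ r
    change (((g r k l : ℝ) : ℂ) • (1 : Matrix (Fin n) (Fin n) ℂ)) * χ.1 r = _
    simp
  have hcov : ∀ l (χ : sect E n (dom φ)) r, covMom φ s (fun l => (A l).1) l χ.1 r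
      = ((momOp hφ hs l - rep E (dom φ) (A l) : Module.End ℂ (sect E n (dom φ))) χ).1 r :=
    fun l χ r => rfl
  change _ = (1 / 2 : ℂ) • ((∑ l, _ : Module.End ℂ (sect E n (dom φ))) ψ).1 q
  rw [sect_sum_apply]
  unfold kinVel
  congr 1
  refine Finset.sum_congr rfl fun l _ => ?_
  have h1 : (fun r => ((g r k l : ℝ) : ℂ) • ψ.1 r)
      = (rep E (dom φ) (realFun n (dom φ) (fun q => g q k l) (hg k l)) ψ).1 :=
    funext fun r => (hG l ψ r).symm
  rw [h1, hcov, hcov, ← hG]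
  rfl

end Kinetic

/-! ### The gauge potential and the velocities of constant matrices -/

section Dynamics

open MeasureTheory

variable {d N n : ℕ} {Q : Type*} [TopologicalSpace Q] [T2Space Q] [SigmaCompactSpace Q]
  [ChartedSpace (EuclideanSpace ℝ (Fin d)) Q] [IsManifold (𝓡 d) ∞ Q]
  {E : LineBundle d Q N} {φ : OpenPartialHomeomorph Q (EuclideanSpace ℝ (Fin d))}
  {s : Q → Fin N → ℂ} [MeasurableSpace Q] [BorelSpace Q] {μ : Measure Q}
  [IsFiniteMeasureOnCompacts μ]

theorem exists_rep_of_commute_coord (hφ : φ ∈ IsManifold.maximalAtlas (𝓡 d) ∞ Q)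
    {x : Fin d → C^∞⟮𝓡 d, Q; 𝓘(ℝ, ℝ), ℝ⟯} (hx : ∀ q ∈ φ.source, ∀ k, x k q = φ q k)
    {S : Module.End ℂ (sect E n (dom φ))}
    (hS : ∀ k, S * scal E (dom φ) (x k) = scal E (dom φ) (x k) * S) :
    ∃ a : smoothFun d n (dom φ), S = rep E (dom φ) a :=
  exists_rep_of_isPointwise (isPointwise_of_commute_coord hφ hx hS)

/-- By Cramer's rule the entries of the inverse are rational in those of `g`, with denominator `det
g`. -/
theorem contMDiffOn_inv_apply {W : TopologicalSpace.Opens Q} {g : Q → Matrix (Fin d) (Fin d) ℝ}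
    (hg : ∀ k l, ContMDiffOn (𝓡 d) 𝓘(ℝ, ℝ) ∞ (fun q => g q k l) W)
    (hdet : ∀ q ∈ W, (g q).det ≠ 0) (k l : Fin d) :
    ContMDiffOn (𝓡 d) 𝓘(ℝ, ℝ) ∞ (fun q => (g q)⁻¹ k l) W := by
  have hdetS : ∀ f : Q → Matrix (Fin d) (Fin d) ℝ,
      (∀ k l, ContMDiffOn (𝓡 d) 𝓘(ℝ, ℝ) ∞ (fun q => f q k l) W) →
      ContMDiffOn (𝓡 d) 𝓘(ℝ, ℝ) ∞ (fun q => (f q).det) W := by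
    intro f hf
    simp only [Matrix.det_apply]
    refine contMDiffOn_finsetSum fun σ _ => ?_
    have h1 : ContMDiffOn (𝓡 d) 𝓘(ℝ, ℝ) ∞ (fun q => ∏ i, f q (σ i) i) W :=
      contMDiffOn_finsetProd fun i _ => hf _ _
    have h2 : ContMDiffOn (𝓡 d) 𝓘(ℝ, ℝ) ∞
        (fun q => ((Equiv.Perm.sign σ : ℤ) : ℝ) * ∏ i, f q (σ i) i) W := contMDiffOn_const.mul h1
    exact h2.congr fun q _ => by rw [Units.smul_def, zsmul_eq_mul]
  have hadj : ContMDiffOn (𝓡 d) 𝓘(ℝ, ℝ) ∞ (fun q => (g q).adjugate k l) W := by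
    simp only [Matrix.adjugate_apply]
    refine hdetS _ fun i j => ?_
    by_cases hil : i = l
    · subst hil
      simpa using contMDiffOn_const
    · simpa [Matrix.updateRow_apply, hil] using hg i j
  have hinv : ContMDiffOn (𝓡 d) 𝓘(ℝ, ℝ) ∞ (fun q => ((g q).det)⁻¹) W := fun q hq =>
    ContMDiffAt.comp_contMDiffWithinAt (g := fun z : ℝ => z⁻¹) q
      (contDiffAt_inv ℝ (hdet q hq)).contMDiffAt (hdetS g hg q hq)
  exact (hinv.mul hadj).congr fun q _ => by
    change _ = ((g q).det)⁻¹ * (g q).adjugate k l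
    rw [Matrix.inv_def, Matrix.smul_apply, Ring.inverse_eq_inv', smul_eq_mul]

variable {h : Module.End ℂ (sect E n (dom φ))} {x : Fin d → C^∞⟮𝓡 d, Q; 𝓘(ℝ, ℝ), ℝ⟯}
  {g : Q → Matrix (Fin d) (Fin d) ℝ}
  (hg : ∀ k l, ContMDiffOn (𝓡 d) 𝓘(ℝ, ℝ) ∞ (fun q => g q k l) (dom φ))

variable (E) in
/-- The operator of multiplication by `g^{kl}`. -/
noncomputable def metricOp (k l : Fin d) : Module.End ℂ (sect E n (dom φ)) :=
  rep E (dom φ) (realFun n (dom φ) (fun q => g q k l) (hg k l))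

theorem metricOp_symm (hsymm : ∀ q ∈ dom φ, (g q).IsSymm) (k l : Fin d) :
    metricOp (n := n) E hg k l = metricOp E hg l k :=
  rep_congr fun q hq => by
    change ((g q k l : ℝ) : ℂ) • (1 : Matrix (Fin n) (Fin n) ℂ) = ((g q l k : ℝ) : ℂ) • 1
    rw [(hsymm q hq).apply l k]

section RaiseIndex

variable (hdet : ∀ q ∈ dom φ, (g q).det ≠ 0) (M : Fin d → smoothFun d n (dom φ))

/-- The functions `∑ₖ (g⁻¹)_{lk} M_k`. -/
noncomputable def raiseIndex (l : Fin d) : smoothFun d n (dom φ) :=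
  ∑ k, realFun n (dom φ) _ (contMDiffOn_inv_apply hg hdet l k) * M k

theorem raiseIndex_apply (l : Fin d) (q : Q) :
    (raiseIndex hg hdet M l).1 q = ∑ k, (((g q)⁻¹ l k : ℝ) : ℂ) • (M k).1 q := by
  rw [raiseIndex, AddSubmonoidClass.coe_finsetSum, Finset.sum_apply]
  refine Finset.sum_congr rfl fun k _ => ?_
  change (((g q)⁻¹ l k : ℝ) : ℂ) • (1 : Matrix (Fin n) (Fin n) ℂ) * (M k).1 q = _
  rw [Matrix.smul_mul, Matrix.one_mul]

variable {M} in
theorem isHermitian_raiseIndex (hM : ∀ k, ∀ q ∈ dom φ, ((M k).1 q).IsHermitian) (l : Fin d)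
    {q : Q} (hq : q ∈ dom φ) : ((raiseIndex hg hdet M l).1 q).IsHermitian := by
  rw [raiseIndex_apply, Matrix.IsHermitian, Matrix.conjTranspose_sum]
  refine Finset.sum_congr rfl fun k _ => ?_
  rw [Matrix.conjTranspose_smul, (hM k q hq).eq]
  simp

theorem sum_metricOp_mul_raiseIndex (k : Fin d) :
    ∑ l, metricOp E hg k l * rep E (dom φ) (raiseIndex hg hdet M l) = rep E (dom φ) (M k) := by
  refine LinearMap.ext fun ψ => sect_ext fun q => ?_
  rw [sect_sum_apply, rep_apply]
  by_cases hq : q ∈ dom φ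
  · have h1 : ∀ l, ((metricOp E hg k l * rep E (dom φ) (raiseIndex hg hdet M l) :
          Module.End ℂ (sect E n (dom φ))) ψ).1 q
        = (∑ m, ((g q k l * (g q)⁻¹ l m : ℝ) : ℂ) • (M m).1 q) * ψ.1 q := by
      intro l
      change ((g q k l : ℝ) : ℂ) • (1 : Matrix (Fin n) (Fin n) ℂ)
        * ((raiseIndex hg hdet M l).1 q * ψ.1 q) = _
      rw [raiseIndex_apply, Matrix.smul_mul, Matrix.one_mul, ← Matrix.smul_mul, Finset.smul_sum]
      simp_rw [smul_smul, Complex.ofReal_mul]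
    rw [Finset.sum_congr rfl fun l _ => h1 l, ← Matrix.sum_mul, Finset.sum_comm]
    simp_rw [← Finset.sum_smul, ← Complex.ofReal_sum]
    have h3 : ∀ m, ∑ l, g q k l * (g q)⁻¹ l m = (1 : Matrix (Fin d) (Fin d) ℝ) k m := by
      intro m
      rw [← Matrix.mul_nonsing_inv (g q) (isUnit_iff_ne_zero.2 (hdet q hq)), Matrix.mul_apply]
    simp_rw [h3, Matrix.one_apply]
    simp
  · rw [sect_eq_zero_of_notMem ψ hq, Matrix.mul_zero]
    exact Finset.sum_eq_zero fun l _ => sect_eq_zero_of_notMem _ hq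

end RaiseIndex

/-- The velocity `ẋ^k` and the symmetrized product of `g^{kl}` with `-i ∂_l` have equal commutators
with all coordinates, so they differ by a matrix function `M k`, hermitian because both are
symmetric. Solving `∑ g^{kl} A_l = M k` with the inverse metric gives the potential. -/
theorem exists_potential [μ.IsOpenPosMeasure] (hφ : φ ∈ IsManifold.maximalAtlas (𝓡 d) ∞ Q)
    (hx : ∀ q ∈ φ.source, ∀ k, x k q = φ q k) (hs : IsAdaptedFrame E μ φ s)
    (hh : IsAdj μ h h) (hsymm : ∀ q ∈ dom φ, (g q).IsSymm)
    (hmet : ∀ k l, scal E (dom φ) (x k) * (h * scal E (dom φ) (x l) - scal E (dom φ) (x l) * h)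
        - (h * scal E (dom φ) (x l) - scal E (dom φ) (x l) * h) * scal E (dom φ) (x k)
        = metricOp E hg k l) (hdet : ∀ q ∈ dom φ, (g q).det ≠ 0) :
    ∃ A : Fin d → smoothFun d n (dom φ), (∀ l, ∀ q ∈ dom φ, ((A l).1 q).IsHermitian) ∧
      ∀ k, Complex.I • (h * scal E (dom φ) (x k) - scal E (dom φ) (x k) * h)
        = symProd (metricOp E hg k) fun l => momOp hφ hs.isFrame l - rep E (dom φ) (A l) := by
  have hM : ∀ k, ∃ a : smoothFun d n (dom φ),
      symProd (metricOp E hg k) (momOp hφ hs.isFrame)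
        - Complex.I • (h * scal E (dom φ) (x k) - scal E (dom φ) (x k) * h) = rep E (dom φ) a := by
    intro k
    have h1 : ∀ m, scal E (dom φ) (x m) * symProd (metricOp E hg k) (momOp hφ hs.isFrame)
        - symProd (metricOp E hg k) (momOp hφ hs.isFrame) * scal E (dom φ) (x m)
        = Complex.I • metricOp E hg m k := fun m => by
      rw [metricOp_symm hg hsymm m k]
      exact commutator_symProd (R := Module.End ℂ (sect E n (dom φ)))
        (x := scal E (dom φ) (x m)) (G := metricOp E hg k) (p := momOp hφ hs.isFrame) (m := m)
        (scal_momOp_commutator hφ hs.isFrame hx m) fun l => scal_mul_rep_comm _ _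
    exact exists_rep_of_commute_coord hφ hx fun m => commute_sub
      (R := Module.End ℂ (sect E n (dom φ))) (x := scal E (dom φ) (x m))
      (S := symProd (metricOp E hg k) (momOp hφ hs.isFrame))
      (S' := Complex.I • (h * scal E (dom φ) (x k) - scal E (dom φ) (x k) * h))
      ((h1 m).trans (commutator_smul_velocity (R := Module.End ℂ (sect E n (dom φ))) (h := h)
        (x := scal E (dom φ) (x m)) (y := scal E (dom φ) (x k)) (g := metricOp E hg m k)
        (hmet m k)).symm)
  choose M hM using hM
  have hMherm : ∀ k, ∀ q ∈ dom φ, ((M k).1 q).IsHermitian := by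
    intro k q hq
    refine isHermitian_of_isHermOp_rep (μ := μ) (E := E) ?_ hq
    have hG : ∀ l, IsAdj (n := n) μ (metricOp E hg k l) (metricOp E hg k l) :=
      fun l => isAdj_rep_realFun _
    have h1 : IsAdj (n := n) μ (symProd (metricOp E hg k) (momOp hφ hs.isFrame))
        (symProd (metricOp E hg k) (momOp hφ hs.isFrame)) := by
      have h2 := (IsAdj.sum (I := Finset.univ) fun l _ =>
        ((hG l).mul (isAdj_momOp hφ hs l)).add ((isAdj_momOp hφ hs l).mul (hG l))).smul (1 / 2)
      have h3 : star (1 / 2 : ℂ) = 1 / 2 := by simp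
      rw [h3] at h2
      have h4 : ∀ l : Fin d, (momOp hφ hs.isFrame l * metricOp E hg k l
          + metricOp E hg k l * momOp hφ hs.isFrame l : Module.End ℂ (sect E n (dom φ)))
          = metricOp E hg k l * momOp hφ hs.isFrame l
          + momOp hφ hs.isFrame l * metricOp E hg k l := fun l => add_comm _ _
      rw [Finset.sum_congr rfl fun l _ => h4 l] at h2
      exact h2
    have h5 := h1.sub (isAdj_velocity hh (isAdj_scal (x k)))
    rw [hM] at h5
    exact h5
  refine ⟨raiseIndex hg hdet M, fun l q hq => isHermitian_raiseIndex hg hdet hMherm l hq,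
    fun k => ?_⟩
  rw [symProd_sub (R := Module.End ℂ (sect E n (dom φ))) (G := metricOp E hg k)
    (p := momOp hφ hs.isFrame) (A := fun l => rep E (dom φ) (raiseIndex hg hdet M l))
    fun l => rep_realFun_mul_comm _ _, sum_metricOp_mul_raiseIndex hg hdet M k, ← hM k]
  exact (sub_sub_cancel (symProd (metricOp E hg k) (momOp hφ hs.isFrame))
    (Complex.I • (h * scal E (dom φ) (x k) - scal E (dom φ) (x k) * h))).symm

/-- The commutator `[A_k, T]` as a smooth function. -/
def gaugeComm (A : Fin d → smoothFun d n (dom φ)) (T : Matrix (Fin n) (Fin n) ℂ) (k : Fin d) :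
    smoothFun d n (dom φ) :=
  A k * constFun d (dom φ) T - constFun d (dom φ) T * A k

section Field

variable (hφ : φ ∈ IsManifold.maximalAtlas (𝓡 d) ∞ Q)
  (hx : ∀ q ∈ φ.source, ∀ k, x k q = φ q k) (hs : IsFrame E φ s)
  (hmet : ∀ k l, scal E (dom φ) (x k) * (h * scal E (dom φ) (x l) - scal E (dom φ) (x l) * h)
        - (h * scal E (dom φ) (x l) - scal E (dom φ) (x l) * h) * scal E (dom φ) (x k)
        = metricOp E hg k l)
  {A : Fin d → smoothFun d n (dom φ)}
  (hA : ∀ k, Complex.I • (h * scal E (dom φ) (x k) - scal E (dom φ) (x k) * h)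
        = symProd (metricOp E hg k) fun l => momOp hφ hs l - rep E (dom φ) (A l))
  (T : Matrix (Fin n) (Fin n) ℂ)

theorem rep_sub {W : TopologicalSpace.Opens Q} (a b : smoothFun d n W) :
    rep E W (a - b) = rep E W a - rep E W b :=
  LinearMap.ext fun ψ => sect_ext fun q => Matrix.sub_mul (a.1 q) (b.1 q) (ψ.1 q)

theorem rep_neg {W : TopologicalSpace.Opens Q} (a : smoothFun d n W) :
    rep E W (-a) = -rep E W a :=
  LinearMap.ext fun ψ => sect_ext fun q => Matrix.neg_mul (a.1 q) (ψ.1 q)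

-- Momenta and metric commute with the constant `T`, so only the potential contributes to `[ẋ^m,
-- T]`; since `[x^m, T] = 0`, the Jacobi identity transfers the result to `Ṫ`.
include hA in
theorem scal_velocity_const_commutator (m : Fin d) :
    scal E (dom φ) (x m) * (Complex.I • (h * rep E (dom φ) (constFun d (dom φ) T)
        - rep E (dom φ) (constFun d (dom φ) T) * h))
      - (Complex.I • (h * rep E (dom φ) (constFun d (dom φ) T)
        - rep E (dom φ) (constFun d (dom φ) T) * h)) * scal E (dom φ) (x m)
      = ∑ l, metricOp E hg m l * rep E (dom φ) (gaugeComm A T l) := by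
  have h2 := symProd_commutator (G := metricOp E hg m) (p := momOp hφ hs)
    (A := fun l => rep E (dom φ) (A l)) (t := rep E (dom φ) (constFun d (dom φ) T))
    (fun l => rep_realFun_mul_comm _ _) (fun l => momOp_rep_const hφ hs l T)
    (fun l => rep_realFun_mul_comm _ _)
  rw [← hA] at h2
  have h1 := commutator_velocity (h := h) (x := scal E (dom φ) (x m))
    (t := rep E (dom φ) (constFun d (dom φ) T)) (scal_mul_rep_comm _ _) h2
  refine h1.trans (Finset.sum_congr rfl fun l _ => ?_)
  rw [gaugeComm, rep_sub, map_mul, map_mul]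

/-- The scalar part of the velocity of a constant matrix `T`. -/
noncomputable def scalarForce (h : Module.End ℂ (sect E n (dom φ)))
    (x : Fin d → C^∞⟮𝓡 d, Q; 𝓘(ℝ, ℝ), ℝ⟯) (A : Fin d → smoothFun d n (dom φ))
    (T : Matrix (Fin n) (Fin n) ℂ) : Module.End ℂ (sect E n (dom φ)) :=
  Complex.I • (h * rep E (dom φ) (constFun d (dom φ) T)
      - rep E (dom φ) (constFun d (dom φ) T) * h)
    + (Complex.I / 2) • ∑ k,
      ((Complex.I • (h * scal E (dom φ) (x k) - scal E (dom φ) (x k) * h))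
          * rep E (dom φ) (gaugeComm A T k)
        + rep E (dom φ) (gaugeComm A T k)
          * (Complex.I • (h * scal E (dom φ) (x k) - scal E (dom φ) (x k) * h)))

/-- The remainder of the velocity of a constant matrix `T`, in the unsymmetrized form. -/
noncomputable def unsymmForce (h : Module.End ℂ (sect E n (dom φ)))
    (x : Fin d → C^∞⟮𝓡 d, Q; 𝓘(ℝ, ℝ), ℝ⟯) (A : Fin d → smoothFun d n (dom φ))
    (T : Matrix (Fin n) (Fin n) ℂ) : Module.End ℂ (sect E n (dom φ)) :=
  Complex.I • (h * rep E (dom φ) (constFun d (dom φ) T)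
      - rep E (dom φ) (constFun d (dom φ) T) * h)
    + Complex.I • ∑ k,
      (Complex.I • (h * scal E (dom φ) (x k) - scal E (dom φ) (x k) * h))
          * rep E (dom φ) (gaugeComm A T k)

-- By `commute_add_symm` the remainder commutes with every coordinate, hence it is a matrix function
-- on `𝓓(V)`.
include hx hmet hA in
theorem scalarForce_mem_weakClosureA : scalarForce h x A T ∈ weakClosureA E n μ (dom φ) := by
  obtain ⟨a, ha⟩ := exists_rep_of_commute_coord (S := scalarForce h x A T) hφ hx fun m =>
    commute_add_symm
      (R := Module.End ℂ (sect E n (dom φ))) (x := scal E (dom φ) (x m))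
      (S := Complex.I • (h * rep E (dom φ) (constFun d (dom φ) T)
        - rep E (dom φ) (constFun d (dom φ) T) * h))
      (P := fun k => Complex.I • (h * scal E (dom φ) (x k) - scal E (dom φ) (x k) * h))
      (B := fun k => rep E (dom φ) (gaugeComm A T k)) (G := fun k => metricOp E hg m k)
      (scal_velocity_const_commutator hg hφ hs hA T m)
      (fun k => commutator_smul_velocity (R := Module.End ℂ (sect E n (dom φ))) (h := h)
        (x := scal E (dom φ) (x m)) (y := scal E (dom φ) (x k)) (g := metricOp E hg m k)
        (hmet m k)) (fun k => scal_mul_rep_comm _ _)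
      (fun k => rep_realFun_mul_comm _ _)
  rw [ha]
  exact rep_mem_weakClosureA a

include hx hmet hA in
theorem unsymmForce_mem_weakClosureA : unsymmForce h x A T ∈ weakClosureA E n μ (dom φ) := by
  obtain ⟨a, ha⟩ := exists_rep_of_commute_coord (S := unsymmForce h x A T) hφ hx fun m =>
    commute_add_right
      (R := Module.End ℂ (sect E n (dom φ))) (x := scal E (dom φ) (x m))
      (S := Complex.I • (h * rep E (dom φ) (constFun d (dom φ) T)
        - rep E (dom φ) (constFun d (dom φ) T) * h))
      (P := fun k => Complex.I • (h * scal E (dom φ) (x k) - scal E (dom φ) (x k) * h))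
      (B := fun k => rep E (dom φ) (gaugeComm A T k)) (G := fun k => metricOp E hg m k)
      (scal_velocity_const_commutator hg hφ hs hA T m)
      (fun k => commutator_smul_velocity (R := Module.End ℂ (sect E n (dom φ))) (h := h)
        (x := scal E (dom φ) (x m)) (y := scal E (dom φ) (x k)) (g := metricOp E hg m k)
        (hmet m k)) (fun k => scal_mul_rep_comm _ _)
  rw [ha]
  exact rep_mem_weakClosureA a

/-- The velocities are symmetric, while `[A_k, T]` is antihermitian; its sign is compensated by the
conjugate of `i/2`, and the symmetrization absorbs the reversal of products. -/
theorem isHermOp_scalarForce (hh : IsAdj μ h h)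
    (hAh : ∀ l, ∀ q ∈ dom φ, ((A l).1 q).IsHermitian) {T : Matrix (Fin n) (Fin n) ℂ}
    (hT : T.IsHermitian) : IsHermOp E μ (scalarForce h x A T) := by
  have hτ : IsAdj μ (rep E (dom φ) (constFun d (dom φ) T)) (rep E (dom φ) (constFun d (dom φ) T)) :=
    isAdj_rep fun q _ => hT.symm
  have hB : ∀ k, IsAdj μ (rep E (dom φ) (gaugeComm A T k))
      (rep E (dom φ) (-gaugeComm A T k)) := fun k => isAdj_rep fun q hq => by
    change -((A k).1 q * T - T * (A k).1 q) = ((A k).1 q * T - T * (A k).1 q)ᴴ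
    rw [Matrix.conjTranspose_sub, Matrix.conjTranspose_mul, Matrix.conjTranspose_mul, hT.eq,
      (hAh k q hq).eq, neg_sub]
  have hP : ∀ k, IsAdj μ (Complex.I • (h * scal E (dom φ) (x k) - scal E (dom φ) (x k) * h))
      (Complex.I • (h * scal E (dom φ) (x k) - scal E (dom φ) (x k) * h)) := fun k =>
    isAdj_velocity hh (isAdj_scal (x k))
  have h1 := (isAdj_velocity hh hτ).add ((IsAdj.sum (I := Finset.univ) fun k _ =>
    ((hP k).mul (hB k)).add ((hB k).mul (hP k))).smul (Complex.I / 2))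
  rw [star_smul_symm _ (fun k => rep E (dom φ) (gaugeComm A T k)) _ fun k => rep_neg _] at h1
  exact h1

end Field

end Dynamics

/-! ### Splitting off the remainder -/

section Force

theorem eq_neg_smul_add_add_smul {M : Type*} [AddCommGroup M] [Module ℂ M] (c : ℂ) (a v : M) :
    a = (-c) • v + (a + c • v) := by
  rw [neg_smul, add_comm a, neg_add_cancel_left]

variable {d N n : ℕ} {Q : Type*} [TopologicalSpace Q] [T2Space Q]
  [SigmaCompactSpace Q] [ChartedSpace (EuclideanSpace ℝ (Fin d)) Q] [IsManifold (𝓡 d) ∞ Q]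
  {E : LineBundle d Q N} {φ : OpenPartialHomeomorph Q (EuclideanSpace ℝ (Fin d))}

theorem velocity_const_eq_add_scalarForce (h : Module.End ℂ (sect E n (dom φ)))
    (x : Fin d → C^∞⟮𝓡 d, Q; 𝓘(ℝ, ℝ), ℝ⟯) (A : Fin d → smoothFun d n (dom φ))
    (T : Matrix (Fin n) (Fin n) ℂ) (ψ : sect E n (dom φ)) (q : Q) :
    ((Complex.I • (h * rep E (dom φ) (constFun d (dom φ) T)
        - rep E (dom φ) (constFun d (dom φ) T) * h) : Module.End ℂ (sect E n (dom φ))) ψ).1 q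
      = (-(Complex.I / 2)) • ∑ k,
        (((Complex.I • (h * scal E (dom φ) (x k) - scal E (dom φ) (x k) * h) :
            Module.End ℂ (sect E n (dom φ))) (rep E (dom φ) (gaugeComm A T k) ψ)).1 q
          + (gaugeComm A T k).1 q * ((Complex.I • (h * scal E (dom φ) (x k)
            - scal E (dom φ) (x k) * h) : Module.End ℂ (sect E n (dom φ))) ψ).1 q)
        + (scalarForce h x A T ψ).1 q := by
  have h1 := congrArg (fun v => ((Complex.I • (h * rep E (dom φ) (constFun d (dom φ) T)
        - rep E (dom φ) (constFun d (dom φ) T) * h) : Module.End ℂ (sect E n (dom φ))) ψ).1 q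
      + (Complex.I / 2) • v) (sect_sum_apply Finset.univ (fun k =>
    ((Complex.I • (h * scal E (dom φ) (x k) - scal E (dom φ) (x k) * h))
        * rep E (dom φ) (gaugeComm A T k)
      + rep E (dom φ) (gaugeComm A T k)
        * (Complex.I • (h * scal E (dom φ) (x k) - scal E (dom φ) (x k) * h)) :
          Module.End ℂ (sect E n (dom φ)))) ψ q)
  exact (eq_neg_smul_add_add_smul (Complex.I / 2) _ _).trans (congrArg₂ (· + ·) rfl h1.symm)

theorem velocity_const_eq_add_unsymmForce (h : Module.End ℂ (sect E n (dom φ)))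
    (x : Fin d → C^∞⟮𝓡 d, Q; 𝓘(ℝ, ℝ), ℝ⟯) (A : Fin d → smoothFun d n (dom φ))
    (T : Matrix (Fin n) (Fin n) ℂ) (ψ : sect E n (dom φ)) :
    (Complex.I • (h * rep E (dom φ) (constFun d (dom φ) T)
        - rep E (dom φ) (constFun d (dom φ) T) * h) : Module.End ℂ (sect E n (dom φ))) ψ
      = (-Complex.I) • ∑ k,
        (Complex.I • (h * scal E (dom φ) (x k) - scal E (dom φ) (x k) * h) :
            Module.End ℂ (sect E n (dom φ))) (rep E (dom φ) (gaugeComm A T k) ψ)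
        + unsymmForce h x A T ψ := by
  rw [unsymmForce, LinearMap.add_apply, LinearMap.smul_apply _ (∑ k, _), LinearMap.sum_apply]
  exact eq_neg_smul_add_add_smul _ _ _

end Force

end GaugeQM

theorem mainTheorem7 {d N n : ℕ} {Q : Type*} [TopologicalSpace Q] [T2Space Q] [SigmaCompactSpace Q]
    [ChartedSpace (EuclideanSpace ℝ (Fin d)) Q] [IsManifold (𝓡 d) ∞ Q]
    [MeasurableSpace Q] [BorelSpace Q] (μ : MeasureTheory.Measure Q)
    [MeasureTheory.IsFiniteMeasureOnCompacts μ] [μ.IsOpenPosMeasure]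
    (E : GaugeQM.LineBundle d Q N)
    (H : Module.End ℂ (GaugeQM.sect E n ⊤)) (hH : GaugeQM.IsHermOp E μ H)
    (hU : GaugeQM.NCUncertainty E H)
    (T : Fin (n ^ 2 - 1) → Matrix (Fin n) (Fin n) ℂ) (hT : GaugeQM.IsSuGenerators T)
    (φ : OpenPartialHomeomorph Q (EuclideanSpace ℝ (Fin d)))
    (hφ : φ ∈ IsManifold.maximalAtlas (𝓡 d) ∞ Q)
    (x : Fin d → C^∞⟮𝓡 d, Q; 𝓘(ℝ, ℝ), ℝ⟯) (hx : ∀ q ∈ φ.source, ∀ k, x k q = φ q k)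
    (s : Q → Fin N → ℂ) (hs : GaugeQM.IsAdaptedFrame E μ φ s) :
    let V := GaugeQM.dom φ
    let xdot : Fin d → Module.End ℂ (GaugeQM.sect E n ⊤) :=
      fun k => GaugeQM.velocity E H (GaugeQM.scalarFun d n (x k))
    let Tdot : Fin (n ^ 2 - 1) → Module.End ℂ (GaugeQM.sect E n ⊤) :=
      fun a => GaugeQM.velocity E H (GaugeQM.constFun d ⊤ (T a))
    (∀ W : TopologicalSpace.Opens Q,
      GaugeQM.weakClosureA E n μ W = GaugeQM.commutantZ E n W) ∧
    ∃ g : Q → Matrix (Fin d) (Fin d) ℝ,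
      (∀ k l, ContMDiffOn (𝓡 d) 𝓘(ℝ, ℝ) ∞ (fun q => g q k l) V) ∧
      (∀ q ∈ V, (g q).IsSymm) ∧
      (∀ k l, ∀ ψ : GaugeQM.sect E n V, ∀ q,
        ((GaugeQM.rep E ⊤ (GaugeQM.scalarFun d n (x k)) * xdot l
          - xdot l * GaugeQM.rep E ⊤ (GaugeQM.scalarFun d n (x k))) (GaugeQM.incl E n V ψ)).1 q
          = (Complex.I * ((g q k l : ℝ) : ℂ)) • ψ.1 q) ∧
      ((∀ q ∈ V, (g q).det ≠ 0) →
        ∃ A : Fin d → GaugeQM.smoothFun d n V,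
          (∀ l, ∀ q ∈ V, ((A l).1 q).IsHermitian) ∧
          ∀ k, ∀ ψ : GaugeQM.sect E n V, ∀ q,
            (xdot k (GaugeQM.incl E n V ψ)).1 q
              = GaugeQM.kinVel φ s g (fun l => (A l).1) k ψ.1 q) ∧
      ∀ A : Fin d → GaugeQM.smoothFun d n V,
        (∀ l, ∀ q ∈ V, ((A l).1 q).IsHermitian) →
        (∀ k, ∀ ψ : GaugeQM.sect E n V, ∀ q,
          (xdot k (GaugeQM.incl E n V ψ)).1 q
            = GaugeQM.kinVel φ s g (fun l => (A l).1) k ψ.1 q) →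
        let B : Fin d → Fin (n ^ 2 - 1) → GaugeQM.smoothFun d n V :=
          fun k a => A k * GaugeQM.constFun d V (T a) - GaugeQM.constFun d V (T a) * A k
        (∃ A₀ : Fin (n ^ 2 - 1) → Module.End ℂ (GaugeQM.sect E n V), ∀ a,
          GaugeQM.IsHermOp E μ (A₀ a) ∧
          A₀ a ∈ GaugeQM.weakClosureA E n μ V ∧
          ∀ ψ : GaugeQM.sect E n V, ∀ q,
            (Tdot a (GaugeQM.incl E n V ψ)).1 q
              = (-(Complex.I / 2)) • ∑ k,
                  ((xdot k (GaugeQM.incl E n V (GaugeQM.rep E V (B k a) ψ))).1 q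
                    + (B k a).1 q * (xdot k (GaugeQM.incl E n V ψ)).1 q)
                + (A₀ a ψ).1 q) ∧
        ∃ R : Fin (n ^ 2 - 1) → Module.End ℂ (GaugeQM.sect E n V), ∀ a,
          R a ∈ GaugeQM.weakClosureA E n μ V ∧
          ∀ ψ : GaugeQM.sect E n V,
            Tdot a (GaugeQM.incl E n V ψ)
              = (-Complex.I) • ∑ k,
                  xdot k (GaugeQM.incl E n V (GaugeQM.rep E V (B k a) ψ))
                + GaugeQM.incl E n V (R a ψ) := by
  intro V xdot Tdot
  obtain ⟨g, hg, hsymm, hmet⟩ := GaugeQM.exists_metric hH hU (GaugeQM.dom φ) x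
  set h : Module.End ℂ (GaugeQM.sect E n (GaugeQM.dom φ)) :=
    GaugeQM.restrOp (GaugeQM.dom φ) H (GaugeQM.tsupport_apply_subset hU)
  have hh : GaugeQM.IsAdj μ h h := fun χ ψ =>
    hH (GaugeQM.incl E n (GaugeQM.dom φ) χ) (GaugeQM.incl E n (GaugeQM.dom φ) ψ)
  -- `restrOp` keeps the underlying functions, so on `𝓓(V)` the velocities of `H` are by definition
  -- those of its restriction `h`.
  have hxdot : ∀ k (ψ : GaugeQM.sect E n V),
      xdot k (GaugeQM.incl E n V ψ) = GaugeQM.incl E n V ((Complex.I •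
        (h * GaugeQM.scal E (GaugeQM.dom φ) (x k) - GaugeQM.scal E (GaugeQM.dom φ) (x k) * h) :
          Module.End ℂ (GaugeQM.sect E n (GaugeQM.dom φ))) ψ) := fun k ψ => rfl
  have hTdot : ∀ a (ψ : GaugeQM.sect E n V),
      Tdot a (GaugeQM.incl E n V ψ) = GaugeQM.incl E n V ((Complex.I •
        (h * GaugeQM.rep E (GaugeQM.dom φ) (GaugeQM.constFun d (GaugeQM.dom φ) (T a))
          - GaugeQM.rep E (GaugeQM.dom φ) (GaugeQM.constFun d (GaugeQM.dom φ) (T a)) * h) :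
          Module.End ℂ (GaugeQM.sect E n (GaugeQM.dom φ))) ψ) := fun k ψ => rfl
  refine ⟨fun W => GaugeQM.weakClosureA_eq_commutantZ, g, hg, hsymm, fun k l ψ q => ?_,
    fun hdet => ?_, fun A hAh hA => ?_⟩
  · have h1 := GaugeQM.commutator_smul_velocity
      (R := Module.End ℂ (GaugeQM.sect E n (GaugeQM.dom φ))) (hmet k l)
    have h2 := congrFun (congrArg Subtype.val (LinearMap.congr_fun h1 ψ)) q
    refine h2.trans ?_
    change Complex.I • ((((g q k l : ℝ) : ℂ) • (1 : Matrix (Fin n) (Fin n) ℂ)) * ψ.1 q) = _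
    rw [Matrix.smul_mul, Matrix.one_mul, smul_smul]
  · obtain ⟨A, hAh, hA⟩ := GaugeQM.exists_potential hg hφ hx hs hh hsymm hmet hdet
    refine ⟨A, hAh, fun k ψ q => ?_⟩
    rw [GaugeQM.kinVel_eq_symProd hφ hs.isFrame hg A k ψ q, hxdot, hA]
    rfl
  -- The pointwise relation `(*)` for the given potential, as an identity of operators on `𝓓(V)`.
  · have hA' : ∀ k, Complex.I • (h * GaugeQM.scal E (GaugeQM.dom φ) (x k)
        - GaugeQM.scal E (GaugeQM.dom φ) (x k) * h)
        = GaugeQM.symProd (GaugeQM.metricOp E hg k) fun l =>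
          GaugeQM.momOp hφ hs.isFrame l - GaugeQM.rep E (GaugeQM.dom φ) (A l) := fun k =>
      LinearMap.ext fun ψ => GaugeQM.sect_ext fun q =>
        (hA k ψ q).trans (GaugeQM.kinVel_eq_symProd hφ hs.isFrame hg A k ψ q)
    refine ⟨⟨fun a => GaugeQM.scalarForce h x A (T a), fun a =>
      ⟨GaugeQM.isHermOp_scalarForce hh hAh (hT.herm a),
        GaugeQM.scalarForce_mem_weakClosureA hg hφ hx hs.isFrame hmet hA' (T a),
        fun ψ q => ?_⟩⟩, fun a => GaugeQM.unsymmForce h x A (T a), fun a =>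
      ⟨GaugeQM.unsymmForce_mem_weakClosureA hg hφ hx hs.isFrame hmet hA' (T a), fun ψ => ?_⟩⟩
    · exact GaugeQM.velocity_const_eq_add_scalarForce h x A (T a) ψ q
    · rw [hTdot, GaugeQM.velocity_const_eq_add_unsymmForce h x A (T a) ψ, map_add, map_smul, map_sum]
      rfl
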